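/- Let $K$ be a field of characteristic zero, $n$ a natural number, $P_n=K[x_1,\ldots,x_n]$, $\partial_i=\partial/\partial x_i$, $H_i=\partial_ix_i\in\operatorname{End}_K(P_n)$ (an invertible operator), and let the Jacobian algebra $\mathbb{A}_n$ be the subalgebra of $\operatorname{End}_K(P_n)$ generated by all $x_i$, $\partial_i$, $H_i^{-1}$. Put $y_i=H_i^{-1}\partial_i$ and $E_{st}(i)=x_i^sy_i^t-x_i^{s+1}y_i^{t+1}$ for $s,t\ge 0$. Let $\mathfrak{p}_i$ be the two-sided ideal of $\mathbb{A}_n$ generated by all $E_{st}(i)$, let $\mathfrak{a}_n=\mathfrak{p}_1+\cdots+\mathfrak{p}_n$, and let $\mathcal{A}_n=\mathbb{A}_n/\mathfrak{a}_n$; the images of $x_i,H_i$ in $\mathcal{A}_n$ are denoted by the same letters. Let $\mathbb{G}_n=\operatorname{Aut}_{K\text{-alg}}(\mathbb{A}_n)$ and let $\operatorname{Inn}(\mathbb{A}_n)$ be the group of all $a\mapsto vav^{-1}$ with $v\in\mathbb{A}_n^*$. The ideal $\mathfrak{a}_n$ is the unique maximal two-sided ideal of $\mathbb{A}_n$ and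 $\sigma(\mathfrak{a}_n)\subseteq\mathfrak{a}_n$ for all $\sigma\in\mathbb{G}_n$, so there is the group homomorphism $\xi:\mathbb{G}_n\to\operatorname{Aut}_{K\text{-alg}}(\mathcal{A}_n)$, $\xi(\sigma)(a+\mathfrak{a}_n)=\sigma(a)+\mathfrak{a}_n$. Let $\mathcal{H}_1(i)$ be the subgroup of $\mathbb{A}_n^*$ generated by the units $H_i+j$ $(j\ge 0)$ and $H_i-j+E_{j-1,j-1}(i)$ $(j\ge 1)$. The following formulas define injective group homomorphisms into $\mathbb{G}_n$, and their images are denoted $S_n$, $\mathbb{T}^n$, $\mathbb{U}_n$ respectively: permutations $\tau$ of $\{1,\ldots,n\}$ act by $x_i\mapsto x_{\tau(i)}$, $y_i\mapsto y_{\tau(i)}$, $H_i\mapsto H_{\tau(i)}$; elements $\lambda\in (K^*)^n$ act by $t_\lambda:x_i\mapsto\lambda_ix_i$, $y_i\mapsto\lambda_i^{-1}y_i$, $H_i\mapsto H_i$; elements $u=(u_1,\ldots,u_n)\in\prod_i\mathcal{H}_1(i)$ act by $\mu_u:x_i\mapsto x_iu_i$, $y_i\mapsto u_i^{-1}y_i$,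 $H_i\mapsto H_i$. Let $\mathcal{L}_1(i)\subseteq\mathcal{A}_n$ be the subalgebra $K[H_i,(H_i+j)^{-1}:j\in\mathbb{Z}]$. Likewise, the formulas $x_i\mapsto x_{\tau(i)}$, $H_i\mapsto H_{\tau(i)}$ and $\sigma_u:x_i\mapsto u_ix_i$, $H_i\mapsto H_i$ define injective group homomorphisms from the symmetric group and from $\prod_{i=1}^n\mathcal{L}_1(i)^*$ to $\operatorname{Aut}_{K\text{-alg}}(\mathcal{A}_n)$; their images are denoted $S_n$ and $\prod_{i=1}^n\{\sigma_{u_i}\mid u_i\in\mathcal{L}_1(i)^*\}$. Then, with all products internal products of subgroups (the factor on the right of $\ltimes$ being normal): 1. $\mathbb{G}_n=S_n\ltimes(\mathbb{T}^n\times\mathbb{U}_n)\ltimes\ker\xi$. 2. $\operatorname{im}\xi=S_n\ltimes\prod_{i=1}^n\{\sigma_{u_i}\mid u_i\in\mathcal{L}_1(i)^*\}$. 3. $\ker\xi\subseteq\operatorname{Inn}(\mathbb{A}_n)$. More precisely, let $\sigma\in\ker\xi$. There is a natural number $d$ such that all the elements $\sigma(H_i)-H_i$, $\sigma(x_i)-x_i$,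 $\sigma(y_i)-y_i$ lie in the $K$-span of the products $b\,E_{st}(k)$ with $1\le k\le n$, $0\le s,t<d$, and $b$ in the subalgebra generated by $x_l,\partial_l,H_l^{-1}$ $(l\ne k)$. For every such $d$, put $p(i,d)=\sum_{j<d}E_{jj}(i)$ and $q(i,d)=1-p(i,d)$. Then the element $$\varphi=\prod_{i=1}^nq(i,d)+\sum_{\emptyset\ne I\subseteq\{1,\ldots,n\}}\Bigl(\sum_{\alpha\in\{0,\ldots,d-1\}^I}\prod_{j\in I}\sigma(y_j^{d-\alpha_j})\prod_{i\in I}x_i^{d-\alpha_i}\prod_{i\in I}E_{\alpha_i\alpha_i}(i)\Bigr)\prod_{i\in I}p(i,d)\prod_{i\notin I}q(i,d)$$ is a unit of $\mathbb{A}_n$, $\varphi\in 1+\mathfrak{a}_n$, and $\sigma(a)=\varphi a\varphi^{-1}$ for all $a\in\mathbb{A}_n$. -/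

import Mathlib

noncomputable section

namespace BavulaJacobian

/-! ## Internal products of subgroups -/

/-- `C` is the internal semidirect product `A ⋉ B`: `A` normalizes `B`, the two subgroups meet
trivially and together they generate `C` (so `C = A B` and `B` is normal in `C`). -/
def IsSemidirect {G : Type*} [Group G] (A B C : Subgroup G) : Prop :=
  (∀ a ∈ A, ∀ b ∈ B, a * b * a⁻¹ ∈ B) ∧ A ⊓ B = ⊥ ∧ A ⊔ B = C

/-- `C` is the internal direct product `A × B`. -/
def IsDirect {G : Type*} [Group G] (A B C : Subgroup G) : Prop :=
  (∀ a ∈ A, ∀ b ∈ B, a * b = b * a) ∧ A ⊓ B = ⊥ ∧ A ⊔ B = C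

/-- The group `Inn(R)` of inner automorphisms of a `K`-algebra `R`. -/
def innerAut (K R : Type*) [CommSemiring K] [Ring R] [Algebra K R] : Subgroup (R ≃ₐ[K] R) where
  carrier := {σ | ∃ v : Rˣ, ∀ a : R, σ a = v * a * (v⁻¹ : Rˣ)}
  one_mem' := ⟨1, fun a => by simp⟩
  mul_mem' := by
    rintro σ τ ⟨v, hv⟩ ⟨w, hw⟩
    exact ⟨v * w, fun a => by simp [AlgEquiv.mul_apply, hv, hw, mul_assoc]⟩
  inv_mem' := by
    rintro σ ⟨v, hv⟩
    refine ⟨v⁻¹, fun a => σ.injective ?_⟩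
    have h1 : σ (σ⁻¹ a) = a := AlgEquiv.apply_symm_apply σ a
    rw [h1, hv (_ * _ * _)]
    simp [mul_assoc]

/-! ## The Jacobian algebra as an algebra of operators on `K[x₁, …, xₙ]` -/

section Operators

variable (K : Type*) [Field K] {n : ℕ}

/-- Multiplication by `xᵢ` on `K[x₁, …, xₙ]`. -/
def xOp (i : Fin n) : Module.End K (MvPolynomial (Fin n) K) :=
  LinearMap.mulLeft K (MvPolynomial.X i)

/-- The partial derivative `∂ᵢ` on `K[x₁, …, xₙ]`. -/
def dOp (i : Fin n) : Module.End K (MvPolynomial (Fin n) K) :=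
  (MvPolynomial.pderiv i).toLinearMap

/-- `Hᵢ = ∂ᵢ xᵢ`. -/
def hOp (i : Fin n) : Module.End K (MvPolynomial (Fin n) K) :=
  dOp K i * xOp K i

/-- `Hᵢ⁻¹ : x^α ↦ (αᵢ + 1)⁻¹ x^α`, see `hOp_mul_hInvOp` and `hInvOp_mul_hOp`. -/
def hInvOp (i : Fin n) : Module.End K (MvPolynomial (Fin n) K) :=
  (MvPolynomial.basisMonomials (Fin n) K).constr K
    (fun α => MvPolynomial.monomial α ((α i + 1 : K)⁻¹))

theorem hOp_monomial (i : Fin n) (α : Fin n →₀ ℕ) (c : K) :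
    hOp K i (MvPolynomial.monomial α c) = MvPolynomial.monomial α ((α i + 1 : K) * c) := by
  simp [hOp, dOp, xOp, MvPolynomial.X, MvPolynomial.monomial_mul, MvPolynomial.pderiv_monomial]
  ring_nf

theorem hInvOp_monomial (i : Fin n) (α : Fin n →₀ ℕ) (c : K) :
    hInvOp K i (MvPolynomial.monomial α c) =
      MvPolynomial.monomial α ((α i + 1 : K)⁻¹ * c) := by
  have h : MvPolynomial.monomial α c = c • MvPolynomial.basisMonomials (Fin n) K α := by
    simp [MvPolynomial.smul_monomial]
  rw [h, map_smul, hInvOp, Module.Basis.constr_basis, MvPolynomial.smul_monomial, smul_eq_mul,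
    mul_comm]

theorem hOp_mul_hInvOp [CharZero K] (i : Fin n) : hOp K i * hInvOp K i = 1 := by
  refine (MvPolynomial.basisMonomials (Fin n) K).ext fun α => ?_
  have h : (α i + 1 : K) ≠ 0 := Nat.cast_add_one_ne_zero _
  simp only [Module.End.mul_apply, Module.End.one_apply, MvPolynomial.coe_basisMonomials,
    hInvOp_monomial, hOp_monomial, mul_one, mul_inv_cancel₀ h]

theorem hInvOp_mul_hOp [CharZero K] (i : Fin n) : hInvOp K i * hOp K i = 1 := by
  refine (MvPolynomial.basisMonomials (Fin n) K).ext fun α => ?_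
  have h : (α i + 1 : K) ≠ 0 := Nat.cast_add_one_ne_zero _
  simp only [Module.End.mul_apply, Module.End.one_apply, MvPolynomial.coe_basisMonomials,
    hInvOp_monomial, hOp_monomial, mul_one, inv_mul_cancel₀ h]

variable (n)

/-- The Weyl algebra `Aₙ` inside `End_K(K[x₁, …, xₙ])`. -/
def weylAlgebra : Subalgebra K (Module.End K (MvPolynomial (Fin n) K)) :=
  Algebra.adjoin K (Set.range (xOp K) ∪ Set.range (dOp K))

/-- The Jacobian algebra `𝔸ₙ`, generated by the Weyl algebra and `H₁⁻¹, …, Hₙ⁻¹`. -/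
def jacobianAlgebra : Subalgebra K (Module.End K (MvPolynomial (Fin n) K)) :=
  Algebra.adjoin K ((weylAlgebra K n : Set _) ∪ Set.range (hInvOp K))

/-- The Jacobian algebra `𝔸ₙ` as a type. -/
abbrev Jac : Type _ := ↥(jacobianAlgebra K n)

end Operators

/-! ## Elements and ideals of `𝔸ₙ` -/

section Elements

variable (K : Type*) [Field K] {n : ℕ}

/-- `xᵢ ∈ 𝔸ₙ`. -/
def xEl (i : Fin n) : Jac K n :=
  ⟨xOp K i, Algebra.subset_adjoin (Or.inl (Algebra.subset_adjoin (Or.inl ⟨i, rfl⟩)))⟩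

/-- `∂ᵢ ∈ 𝔸ₙ`. -/
def dEl (i : Fin n) : Jac K n :=
  ⟨dOp K i, Algebra.subset_adjoin (Or.inl (Algebra.subset_adjoin (Or.inr ⟨i, rfl⟩)))⟩

/-- `Hᵢ⁻¹ ∈ 𝔸ₙ`. -/
def hInvEl (i : Fin n) : Jac K n :=
  ⟨hInvOp K i, Algebra.subset_adjoin (Or.inr ⟨i, rfl⟩)⟩

/-- `Hᵢ = ∂ᵢ xᵢ ∈ 𝔸ₙ`. -/
def hEl (i : Fin n) : Jac K n := dEl K i * xEl K i

/-- `yᵢ = Hᵢ⁻¹ ∂ᵢ ∈ 𝔸ₙ`. -/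
def yEl (i : Fin n) : Jac K n := hInvEl K i * dEl K i

/-- The matrix unit `E_{st}(i) = xᵢ^s yᵢ^t - xᵢ^{s+1} yᵢ^{t+1}`. -/
def matUnit (i : Fin n) (s t : ℕ) : Jac K n :=
  xEl K i ^ s * yEl K i ^ t - xEl K i ^ (s + 1) * yEl K i ^ (t + 1)

/-- The height one prime `𝔭ᵢ = 𝔸₁ ⊗ ⋯ ⊗ F ⊗ ⋯ ⊗ 𝔸₁` (`F` in the `i`-th place), that is, the
two-sided ideal of `𝔸ₙ` generated by the matrix units `E_{st}(i)`. -/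
def pIdeal (i : Fin n) : TwoSidedIdeal (Jac K n) :=
  TwoSidedIdeal.span (Set.range fun st : ℕ × ℕ => matUnit K i st.1 st.2)

variable (n)

/-- The ideal `𝔞ₙ = 𝔭₁ + ⋯ + 𝔭ₙ`. -/
def aIdeal : TwoSidedIdeal (Jac K n) := ⨆ i, pIdeal K i

/-- The factor algebra `𝒜ₙ = 𝔸ₙ / 𝔞ₙ`. -/
abbrev JacQuot : Type _ := Jac K n ⧸ (aIdeal K n).asIdeal

/-- The canonical map `𝔸ₙ → 𝒜ₙ`, `a ↦ a + 𝔞ₙ`. -/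
abbrev red : Jac K n →ₐ[K] JacQuot K n := Ideal.Quotient.mkₐ K (aIdeal K n).asIdeal

/-- The group `𝔾ₙ` of `K`-algebra automorphisms of `𝔸ₙ`. -/
abbrev JacAut : Type _ := Jac K n ≃ₐ[K] Jac K n

/-- The group of `K`-algebra automorphisms of `𝒜ₙ`. -/
abbrev QuotAut : Type _ := JacQuot K n ≃ₐ[K] JacQuot K n

/-- Every automorphism of `𝔸ₙ` maps `𝔞ₙ` into itself. -/
def AIdealStable : Prop :=
  ∀ (σ : JacAut K n) (a : Jac K n), a ∈ aIdeal K n → σ a ∈ aIdeal K n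

variable {K n}

theorem AIdealStable.map_eq (hs : AIdealStable K n) (σ : JacAut K n) :
    (aIdeal K n).asIdeal = (aIdeal K n).asIdeal.map ((σ : Jac K n →+* Jac K n)) := by
  apply le_antisymm
  · intro a ha
    have h1 : σ.symm a ∈ (aIdeal K n).asIdeal :=
      TwoSidedIdeal.mem_asIdeal.2 (hs σ.symm a (TwoSidedIdeal.mem_asIdeal.1 ha))
    have h2 := Ideal.mem_map_of_mem ((σ : Jac K n →+* Jac K n)) h1
    simpa using h2
  · rw [Ideal.map_le_iff_le_comap]
    intro a ha
    exact TwoSidedIdeal.mem_asIdeal.2 (hs σ a (TwoSidedIdeal.mem_asIdeal.1 ha))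

/-- The homomorphism `ξ : 𝔾ₙ → Aut(𝒜ₙ)`, `ξ(σ) : a + 𝔞ₙ ↦ σ(a) + 𝔞ₙ`. -/
def xi (hs : AIdealStable K n) : JacAut K n →* QuotAut K n where
  toFun σ := Ideal.quotientEquivAlg _ _ σ (hs.map_eq σ)
  map_one' := by
    ext a
    obtain ⟨a, rfl⟩ := Ideal.Quotient.mk_surjective a
    rfl
  map_mul' σ τ := by
    ext a
    obtain ⟨a, rfl⟩ := Ideal.Quotient.mk_surjective a
    rfl

theorem xi_red (hs : AIdealStable K n) (σ : JacAut K n) (a : Jac K n) :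
    xi hs σ (red K n a) = red K n (σ a) := rfl

end Elements

/-! ## The subgroups `Sₙ`, `𝕋ⁿ`, `𝕌ₙ` of `𝔾ₙ` and the automorphisms `σ_u` of `𝒜ₙ`

Automorphisms of `𝔸ₙ` are determined by the images of `xᵢ, yᵢ, Hᵢ` (and those of `𝒜ₙ` by the images
of `xᵢ, Hᵢ`), so each of the following formulas determines the homomorphism in question. -/

section Subgroups

variable {K : Type*} [Field K] {n : ℕ}

/-- `τ(xᵢ) = x_{τ(i)}`, `τ(yᵢ) = y_{τ(i)}`, `τ(Hᵢ) = H_{τ(i)}`. -/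
def IsPermAction (s : Equiv.Perm (Fin n) →* JacAut K n) : Prop :=
  ∀ τ i, s τ (xEl K i) = xEl K (τ i) ∧ s τ (yEl K i) = yEl K (τ i) ∧ s τ (hEl K i) = hEl K (τ i)

/-- `t_λ(xᵢ) = λᵢ xᵢ`, `t_λ(yᵢ) = λᵢ⁻¹ yᵢ`, `t_λ(Hᵢ) = Hᵢ`. -/
def IsTorusAction (t : (Fin n → Kˣ) →* JacAut K n) : Prop :=
  ∀ l i, t l (xEl K i) = (l i : K) • xEl K i ∧ t l (yEl K i) = (((l i)⁻¹ : Kˣ) : K) • yEl K i ∧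
    t l (hEl K i) = hEl K i

variable (K) in
/-- The subgroup `ℋ₁(i)` of the group of units of `𝔸ₙ` generated by `Hᵢ + j` (`j ≥ 0`) and
`(Hᵢ - j)₁ = Hᵢ - j + E_{j-1,j-1}(i)` (`j ≥ 1`). -/
def hGroup (i : Fin n) : Subgroup (Jac K n)ˣ :=
  Subgroup.closure
    ({v | ∃ j : ℕ, (v : Jac K n) = hEl K i + (j : Jac K n)} ∪
      {v | ∃ j : ℕ, 1 ≤ j ∧
        (v : Jac K n) = hEl K i - (j : Jac K n) + matUnit K i (j - 1) (j - 1)})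

/-- `μ_u(xᵢ) = xᵢ uᵢ`, `μ_u(yᵢ) = uᵢ⁻¹ yᵢ`, `μ_u(Hᵢ) = Hᵢ` for
`u = (u₁, …, uₙ) ∈ ℋ₁(1) × ⋯ × ℋ₁(n)`. -/
def IsMuAction (μ : (∀ i : Fin n, hGroup K i) →* JacAut K n) : Prop :=
  ∀ u i, μ u (xEl K i) = xEl K i * ((u i : (Jac K n)ˣ) : Jac K n) ∧
    μ u (yEl K i) = (((u i : (Jac K n)ˣ)⁻¹ : (Jac K n)ˣ) : Jac K n) * yEl K i ∧
    μ u (hEl K i) = hEl K i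

variable (K) in
/-- The subalgebra `ℒ₁(i) = K[Hᵢ, (Hᵢ + j)⁻¹ : j ∈ ℤ]` of `𝒜ₙ`. -/
def lAlg (i : Fin n) : Subalgebra K (JacQuot K n) :=
  Algebra.adjoin K
    ({red K n (hEl K i)} ∪
      {v | ∃ j : ℤ, v * (red K n (hEl K i) + (j : JacQuot K n)) = 1 ∧
        (red K n (hEl K i) + (j : JacQuot K n)) * v = 1})

/-- The symmetric group acting on `𝒜ₙ`: `τ(xᵢ) = x_{τ(i)}`, `τ(Hᵢ) = H_{τ(i)}`. -/
def IsPermActionQuot (s : Equiv.Perm (Fin n) →* QuotAut K n) : Prop :=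
  ∀ τ i, s τ (red K n (xEl K i)) = red K n (xEl K (τ i)) ∧
    s τ (red K n (hEl K i)) = red K n (hEl K (τ i))

/-- `σ_u(xᵢ) = uᵢ xᵢ`, `σ_u(Hᵢ) = Hᵢ` for `u = (u₁, …, uₙ) ∈ ℒ₁(1)* × ⋯ × ℒ₁(n)*`. -/
def IsSigmaAction (sg : (∀ i : Fin n, (lAlg K i)ˣ) →* QuotAut K n) : Prop :=
  ∀ u i, sg u (red K n (xEl K i)) = ((u i : lAlg K i) : JacQuot K n) * red K n (xEl K i) ∧
    sg u (red K n (hEl K i)) = red K n (hEl K i)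

end Subgroups

/-! ## The explicit conjugating unit -/

section Conjugator

variable (K : Type*) [Field K] {n : ℕ}

/-- The subalgebra `⨂_{l ≠ k} 𝔸₁(l)` of `𝔸ₙ`. -/
def jacOmit (k : Fin n) : Subalgebra K (Jac K n) :=
  Algebra.adjoin K {a | ∃ l, l ≠ k ∧ (a = xEl K l ∨ a = dEl K l ∨ a = hInvEl K l)}

variable (n) in
/-- The subspace `∑ₖ (⨂_{l ≠ k} 𝔸₁(l)) ⊗ (∑_{s,t < d} K E_{st}(k))` of `𝔸ₙ`. -/
def boundedPart (d : ℕ) : Submodule K (Jac K n) :=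
  Submodule.span K
    {a | ∃ (k : Fin n) (s t : ℕ) (b : Jac K n),
      s < d ∧ t < d ∧ b ∈ jacOmit K k ∧ a = b * matUnit K k s t}

/-- The projection `p(i, d) = ∑_{j < d} E_{jj}(i)`. -/
def pProj (i : Fin n) (d : ℕ) : Jac K n := ∑ j ∈ Finset.range d, matUnit K i j j

/-- The projection `q(i, d) = 1 - p(i, d)`. -/
def qProj (i : Fin n) (d : ℕ) : Jac K n := 1 - pProj K i d

/-- The product `∏_{i ∈ I} f(i)`, taken in increasing order of `i` (in every use below the factors
commute). -/
def prodOver {R : Type*} [Monoid R] (I : Finset (Fin n)) (f : I → R) : R :=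
  (List.ofFn fun i : Fin n => if hi : i ∈ I then f ⟨i, hi⟩ else 1).prod

variable {K}

/-- `σ(Hᵢ) - Hᵢ`, `σ(xᵢ) - xᵢ`, `σ(yᵢ) - yᵢ` lie in `boundedPart K n d` for all `i`. -/
def IsBound (σ : JacAut K n) (d : ℕ) : Prop :=
  ∀ i, σ (hEl K i) - hEl K i ∈ boundedPart K n d ∧ σ (xEl K i) - xEl K i ∈ boundedPart K n d ∧
    σ (yEl K i) - yEl K i ∈ boundedPart K n d

/-- The element
`q({1,…,n}, d) + ∑_{∅ ≠ I} (∑_{α ∈ {0,…,d-1}^I} ∏_{j ∈ I} σ(y_j^{d-α_j}) · ∏_{i ∈ I} x_i^{d-α_i} ·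
  ∏_{i ∈ I} E_{α_i α_i}(i)) · ∏_{i ∈ I} p(i, d) · ∏_{i ∉ I} q(i, d)`. -/
def conjUnit (σ : JacAut K n) (d : ℕ) : Jac K n :=
  prodOver Finset.univ (fun i => qProj K i.1 d) +
    ∑ I : {I : Finset (Fin n) // I.Nonempty},
      (∑ α : I.1 → Fin d,
        prodOver I.1 (fun j => σ (yEl K j.1 ^ (d - (α j : ℕ)))) *
          prodOver I.1 (fun i => xEl K i.1 ^ (d - (α i : ℕ))) *
          prodOver I.1 (fun i => matUnit K i.1 (α i : ℕ) (α i : ℕ))) *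
        prodOver I.1 (fun i => pProj K i.1 d) * prodOver (I.1)ᶜ (fun i => qProj K i.1 d)

end Conjugator

end BavulaJacobian

end

open BavulaJacobian

/-! Everything is read off the action on monomials x^α when all exponents are large. There an
element of 𝔸ₙ is a finite sum of shifts α ↦ α + γ whose coefficients are rational functions of α
with denominators products of linear forms αᵢ + j (`exists_band`). An element lies in 𝔞ₙ exactly
when it kills x^α for all α far out (`mem_aIdeal_iff`), so 𝒜ₙ is the algebra of germs at infinity of
such operators. Commutators with Hᵢ isolate a single shift and difference operators lower the degree
of its coefficient, so an ideal not contained in 𝔞ₙ is everything (`eq_top_of_not_mem_aIdeal`).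
Hence 𝔞ₙ is the unique maximal ideal and is stable under automorphisms.

Polynomials form a simple 𝔸ₙ-module and 𝔸ₙ contains the rank one projection onto the constants.
Therefore every automorphism σ is conjugation by a linear automorphism φ of Pₙ
(`exists_intertwines`). The subgroups Sₙ, 𝕋ⁿ and 𝕌ₙ arise from explicit φ: permutations of variables
and diagonal operators.

To determine σ modulo 𝔞ₙ, note that σ(xᵢ) and σ(Hᵢ) become units of 𝒜ₙ. Since ℤⁿ has two unique sums
and the linear forms αᵢ + j are prime, a unit is one shift times a scalar and a product of powers of
such forms (`isUnit_red_form`). The relations [Hᵢ, xⱼ] = δᵢⱼ xⱼ make the eigenvalues of σ(Hᵢ)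
additive along a lattice of full rank, hence affine. Being also products of linear forms and
positive integers, they are α_{τ(i)} + 1 + mᵢ for a permutation τ (`exists_perm_form`). A dimension
count using φ shows mᵢ = 0 (`shift_le_zero`, applied to σ and its inverse). Commutativity of the xᵢ
then forces the coefficient of σ(xᵢ), after removal of τ, to depend on αᵢ alone (`lamProd_cocycle`).
So σ agrees modulo 𝔞ₙ with an element of Sₙ(𝕋ⁿ × 𝕌ₙ), which gives (1). Applying ξ gives (2), because
the units of ℒ₁(i) are scalars times classes of elements of ℋ₁(i) (`exists_lAlg_unit_eq`).

If σ is in ker ξ, then φ commutes with Hᵢ and xᵢ on monomials with all exponents at least d, so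
after rescaling it fixes them (`exists_intertwines_fixing`). A monomial with small exponents is
y^(d-α) applied to such a monomial, whence φ(x^α) = σ(y^(d-α)) x^(d-α) x^α, with the product over
the small exponents only. This is the formula for the conjugating unit (`conjUnit_eq`). The same
formula for the inverse of σ shows that φ is invertible inside 𝔸ₙ. -/

noncomputable section

namespace BavulaJacobian

open Filter

/-! ## Monomials with integer exponents -/

section Monomials

variable {n : ℕ}

/-- The exponent vector of natural numbers underlying a nonnegative integer vector. -/
def natExp (α : Fin n → ℤ) : Fin n →₀ ℕ := Finsupp.equivFunOnFinite.symm fun i => (α i).toNat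

@[simp] theorem natExp_apply (α : Fin n → ℤ) (i : Fin n) : natExp α i = (α i).toNat := rfl

/-- The integer vector of an exponent vector. -/
def intExp (β : Fin n →₀ ℕ) : Fin n → ℤ := fun i => (β i : ℤ)

@[simp] theorem intExp_apply (β : Fin n →₀ ℕ) (i : Fin n) : intExp β i = (β i : ℤ) := rfl

@[simp] theorem natExp_intExp (β : Fin n →₀ ℕ) : natExp (intExp β) = β := by
  ext i; simp

theorem intExp_natExp {α : Fin n → ℤ} (h : 0 ≤ α) : intExp (natExp α) = α := by
  ext i; simpa using h i

theorem intExp_nonneg (β : Fin n →₀ ℕ) : 0 ≤ intExp β := fun i => by simp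

theorem natExp_injOn {α β : Fin n → ℤ} (hα : 0 ≤ α) (hβ : 0 ≤ β) (h : natExp α = natExp β) :
    α = β := by
  rw [← intExp_natExp hα, h, intExp_natExp hβ]

variable (K : Type*) [Field K]

open Classical in
/-- The monomial `x^α`, with the convention `x^α = 0` if some exponent is negative. -/
def zm (α : Fin n → ℤ) : MvPolynomial (Fin n) K :=
  if 0 ≤ α then MvPolynomial.monomial (natExp α) 1 else 0

theorem zm_of_nonneg {α : Fin n → ℤ} (h : 0 ≤ α) :
    zm K α = MvPolynomial.monomial (natExp α) 1 := if_pos h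

theorem zm_of_not_nonneg {α : Fin n → ℤ} (h : ¬ 0 ≤ α) : zm K α = 0 := if_neg h

theorem zm_of_neg {α : Fin n → ℤ} {i : Fin n} (h : α i < 0) : zm K α = 0 :=
  zm_of_not_nonneg K fun h' => absurd (h' i) (by simpa using h)

@[simp] theorem zm_intExp (β : Fin n →₀ ℕ) : zm K (intExp β) = MvPolynomial.monomial β 1 := by
  rw [zm_of_nonneg K (intExp_nonneg β), natExp_intExp]

theorem zm_ne_zero {α : Fin n → ℤ} (h : 0 ≤ α) : zm K α ≠ 0 := by
  rw [zm_of_nonneg K h]; simp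

theorem zm_zero : zm K (0 : Fin n → ℤ) = 1 := by
  rw [zm_of_nonneg K le_rfl]
  have : natExp (0 : Fin n → ℤ) = 0 := by ext; simp
  rw [this]; rfl

theorem coeff_zm {α : Fin n → ℤ} (hα : 0 ≤ α) (β : Fin n → ℤ) :
    MvPolynomial.coeff (natExp α) (zm K β) = if β = α then 1 else 0 := by
  by_cases hβ : 0 ≤ β
  · rw [zm_of_nonneg K hβ, MvPolynomial.coeff_monomial]
    by_cases h : β = α
    · simp [h]
    · rw [if_neg h, if_neg fun h' => h (natExp_injOn hβ hα h')]
  · rw [zm_of_not_nonneg K hβ, if_neg]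
    · simp
    · rintro rfl; exact hβ hα

variable {K}

theorem eq_sum_zm (p : MvPolynomial (Fin n) K) :
    p = ∑ β ∈ p.support, p.coeff β • zm K (intExp β) := by
  conv_lhs => rw [p.as_sum]
  refine Finset.sum_congr rfl fun β _ => ?_
  rw [zm_intExp, MvPolynomial.smul_monomial, smul_eq_mul, mul_one]

theorem linearMap_ext_zm {V : Type*} [AddCommGroup V] [Module K V]
    {T U : MvPolynomial (Fin n) K →ₗ[K] V}
    (h : ∀ α : Fin n → ℤ, 0 ≤ α → T (zm K α) = U (zm K α)) : T = U := by
  refine (MvPolynomial.basisMonomials (Fin n) K).ext fun β => ?_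
  have := h (intExp β) (intExp_nonneg β)
  simpa using this

theorem zm_mul {α β : Fin n → ℤ} (hα : 0 ≤ α) (hβ : 0 ≤ β) :
    zm K α * zm K β = zm K (β + α) := by
  rw [zm_of_nonneg K hα, zm_of_nonneg K hβ, zm_of_nonneg K (add_nonneg hβ hα),
    MvPolynomial.monomial_mul, one_mul]
  have : natExp α + natExp β = natExp (β + α) := by
    ext i
    have h1 := hα i
    have h2 := hβ i
    simp only [Pi.zero_apply] at h1 h2
    simp only [Finsupp.coe_add, Pi.add_apply, natExp_apply]
    omega
  rw [this]

theorem X_eq_zm (i : Fin n) : (MvPolynomial.X i : MvPolynomial (Fin n) K) = zm K (Pi.single i 1) := by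
  have h : (Pi.single i 1 : Fin n → ℤ) = intExp (Finsupp.single i 1) := by
    ext j
    by_cases h : j = i
    · subst h; simp
    · simp [Pi.single_apply, Finsupp.single_apply, h, Ne.symm h]
  rw [h, zm_intExp]; rfl

theorem single_nonneg (i : Fin n) : (0 : Fin n → ℤ) ≤ Pi.single i 1 := by
  intro j
  by_cases h : j = i
  · subst h; simp
  · simp [Pi.single_apply, h]

theorem xOp_zm (i : Fin n) {α : Fin n → ℤ} (h : 0 ≤ α) :
    xOp K i (zm K α) = zm K (α + Pi.single i 1) := by
  rw [xOp, LinearMap.mulLeft_apply, X_eq_zm, zm_mul (single_nonneg i) h]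

theorem hOp_zm (i : Fin n) (α : Fin n → ℤ) :
    hOp K i (zm K α) = (α i + 1 : K) • zm K α := by
  by_cases h : 0 ≤ α
  · rw [zm_of_nonneg K h, hOp_monomial, MvPolynomial.smul_monomial, smul_eq_mul, natExp_apply]
    have h1 : (((α i).toNat : ℤ) : K) = (α i : K) := by rw [Int.toNat_of_nonneg (h i)]
    rw [← h1, Int.cast_natCast, mul_one]
  · simp [zm_of_not_nonneg K h]

theorem hInvOp_zm (i : Fin n) (α : Fin n → ℤ) :
    hInvOp K i (zm K α) = (α i + 1 : K)⁻¹ • zm K α := by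
  by_cases h : 0 ≤ α
  · rw [zm_of_nonneg K h, hInvOp_monomial, MvPolynomial.smul_monomial, smul_eq_mul, natExp_apply]
    have h1 : (((α i).toNat : ℤ) : K) = (α i : K) := by rw [Int.toNat_of_nonneg (h i)]
    rw [← h1, Int.cast_natCast, mul_one]
  · simp [zm_of_not_nonneg K h]

theorem nonneg_sub_single {i : Fin n} {α : Fin n → ℤ} (h : 0 ≤ α) (hi : 0 < α i) :
    0 ≤ α - Pi.single i 1 := by
  intro j
  have := h j
  by_cases hj : j = i
  · subst hj; simp; omega
  · simpa [Pi.single_apply, hj] using this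

theorem dOp_zm (i : Fin n) (α : Fin n → ℤ) :
    dOp K i (zm K α) = (α i : K) • zm K (α - Pi.single i 1) := by
  by_cases h : 0 ≤ α
  · rcases (h i).eq_or_lt with hi | hi
    · simp only [Pi.zero_apply] at hi
      rw [zm_of_nonneg K h, dOp, Derivation.coeFn_coe, MvPolynomial.pderiv_monomial]
      simp [← hi]
    · simp only [Pi.zero_apply] at hi
      obtain ⟨β, rfl⟩ : ∃ β, α = β + Pi.single i 1 := ⟨α - Pi.single i 1, by simp⟩
      have hβ : 0 ≤ β := by simpa using nonneg_sub_single h hi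
      rw [← xOp_zm i hβ]
      have := hOp_zm (K := K) i β
      rw [hOp, Module.End.mul_apply] at this
      rw [this]; simp
  · rw [zm_of_not_nonneg K h]
    have : ¬ 0 ≤ α - Pi.single i 1 := fun h' => h (by
      simpa using add_nonneg h' (single_nonneg i))
    rw [zm_of_not_nonneg K this]; simp

end Monomials

/-! ### The generators of 𝔸ₙ acting on monomials -/

section Action

variable {K : Type*} [Field K] {n : ℕ}

theorem jac_ext {a b : Jac K n} (h : ∀ α : Fin n → ℤ, 0 ≤ α → a.1 (zm K α) = b.1 (zm K α)) :
    a = b := Subtype.ext (linearMap_ext_zm h)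

theorem jac_mul_apply (a b : Jac K n) (p : MvPolynomial (Fin n) K) :
    (a * b).1 p = a.1 (b.1 p) := rfl

theorem jac_one_apply (p : MvPolynomial (Fin n) K) : (1 : Jac K n).1 p = p := rfl

theorem jac_add_apply (a b : Jac K n) (p : MvPolynomial (Fin n) K) :
    (a + b).1 p = a.1 p + b.1 p := rfl

theorem jac_sub_apply (a b : Jac K n) (p : MvPolynomial (Fin n) K) :
    (a - b).1 p = a.1 p - b.1 p := rfl

theorem jac_zero_apply (p : MvPolynomial (Fin n) K) : (0 : Jac K n).1 p = 0 := rfl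

theorem jac_neg_apply (a : Jac K n) (p : MvPolynomial (Fin n) K) : (-a).1 p = - a.1 p := rfl

theorem jac_smul_apply (c : K) (a : Jac K n) (p : MvPolynomial (Fin n) K) :
    (c • a).1 p = c • a.1 p := rfl

theorem jac_natCast_apply (m : ℕ) (p : MvPolynomial (Fin n) K) :
    (m : Jac K n).1 p = (m : K) • p := by
  have : (m : Jac K n) = (m : K) • (1 : Jac K n) := by simp [Nat.cast_smul_eq_nsmul]
  rw [this]; rfl

theorem xEl_zm (i : Fin n) {α : Fin n → ℤ} (h : 0 ≤ α) :
    (xEl K i).1 (zm K α) = zm K (α + Pi.single i 1) := xOp_zm i h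

theorem dEl_zm (i : Fin n) (α : Fin n → ℤ) :
    (dEl K i).1 (zm K α) = (α i : K) • zm K (α - Pi.single i 1) := dOp_zm i α

theorem hEl_zm (i : Fin n) (α : Fin n → ℤ) :
    (hEl K i).1 (zm K α) = (α i + 1 : K) • zm K α := hOp_zm i α

theorem hInvEl_zm (i : Fin n) (α : Fin n → ℤ) :
    (hInvEl K i).1 (zm K α) = (α i + 1 : K)⁻¹ • zm K α := hInvOp_zm i α

variable [CharZero K]

theorem yEl_zm (i : Fin n) (α : Fin n → ℤ) :
    (yEl K i).1 (zm K α) = zm K (α - Pi.single i 1) := by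
  rw [yEl, jac_mul_apply, dEl_zm, map_smul, hInvEl_zm, smul_smul]
  by_cases h : α i = 0
  · rw [zm_of_neg K (i := i) (by simp [h])]; simp
  · have : (α i : K) ≠ 0 := by exact_mod_cast h
    simp [this]

theorem hEl_mul_hInvEl (i : Fin n) : hEl K i * hInvEl K i = 1 :=
  Subtype.ext (hOp_mul_hInvOp K i)

theorem hInvEl_mul_hEl (i : Fin n) : hInvEl K i * hEl K i = 1 :=
  Subtype.ext (hInvOp_mul_hOp K i)

theorem dEl_eq (i : Fin n) : dEl K i = hEl K i * yEl K i := by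
  rw [yEl, ← mul_assoc, hEl_mul_hInvEl, one_mul]

theorem yEl_mul_xEl (i : Fin n) : yEl K i * xEl K i = 1 :=
  jac_ext fun α h => by rw [jac_mul_apply, xEl_zm i h, yEl_zm, jac_one_apply]; simp

theorem xEl_pow_zm (i : Fin n) (s : ℕ) {α : Fin n → ℤ} (h : 0 ≤ α) :
    (xEl K i ^ s).1 (zm K α) = zm K (α + Pi.single i (s : ℤ)) := by
  induction s with
  | zero => simp
  | succ s ih =>
    have h0 : (0 : Fin n → ℤ) ≤ Pi.single i (s : ℤ) := by
      intro j
      by_cases h : j = i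
      · subst h; simp
      · simp [Pi.single_apply, h]
    rw [pow_succ', jac_mul_apply, ih, xEl_zm i (add_nonneg h h0), add_assoc, ← Pi.single_add]
    push_cast; rfl

theorem yEl_pow_zm (i : Fin n) (s : ℕ) (α : Fin n → ℤ) :
    (yEl K i ^ s).1 (zm K α) = zm K (α - Pi.single i (s : ℤ)) := by
  induction s with
  | zero => simp
  | succ s ih =>
    rw [pow_succ', jac_mul_apply, ih, yEl_zm i, sub_sub, ← Pi.single_add]
    push_cast; rfl

theorem xEl_pow_mul_yEl_pow_zm (i : Fin n) (s t : ℕ) {α : Fin n → ℤ} (h : 0 ≤ α) :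
    (xEl K i ^ s * yEl K i ^ t).1 (zm K α) =
      if (t : ℤ) ≤ α i then zm K (α + Pi.single i ((s : ℤ) - t)) else 0 := by
  rw [jac_mul_apply, yEl_pow_zm]
  split_ifs with ht
  · rw [xEl_pow_zm]
    · congr 1
      rw [sub_add_eq_add_sub, add_sub_assoc, ← Pi.single_sub]
    · intro j
      have := h j
      by_cases hj : j = i
      · subst hj; simpa using ht
      · simpa [Pi.single_apply, hj] using this
  · rw [zm_of_neg K (i := i) (by simpa using ht)]; simp

theorem matUnit_zm (i : Fin n) (s t : ℕ) (α : Fin n → ℤ) :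
    (matUnit K i s t).1 (zm K α) =
      if α i = t then zm K (α + Pi.single i ((s : ℤ) - t)) else 0 := by
  by_cases h : 0 ≤ α
  · rw [matUnit, jac_sub_apply, xEl_pow_mul_yEl_pow_zm i s t h,
      xEl_pow_mul_yEl_pow_zm i (s + 1) (t + 1) h]
    have : ((s + 1 : ℕ) : ℤ) - ((t + 1 : ℕ) : ℤ) = s - t := by push_cast; ring
    rw [this]
    -- Both terms give the same monomial when the exponent exceeds `t` and both vanish below `t`;
    -- only exponent `t` survives.
    rcases lt_trichotomy (α i) t with h1 | h1 | h1
    · rw [if_neg (by omega), if_neg (by omega), if_neg (by omega)]; simp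
    · rw [if_pos (by omega), if_neg (by push_cast; omega), if_pos (by omega)]; simp
    · rw [if_pos (by omega), if_pos (by push_cast; omega), if_neg (by omega)]; simp
  · rw [zm_of_not_nonneg K h, map_zero]
    split_ifs with ht
    · obtain ⟨j, hj⟩ : ∃ j, α j < 0 := by
        by_contra! h'; exact h h'
      have hji : j ≠ i := by rintro rfl; omega
      rw [zm_of_neg K (i := j) (by simpa [Pi.single_apply, hji] using hj)]
    · rfl

theorem matUnit_zm_self (i : Fin n) (t : ℕ) (α : Fin n → ℤ) :
    (matUnit K i t t).1 (zm K α) = if α i = t then zm K α else 0 := by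
  rw [matUnit_zm]; simp

end Action

/-! ### Properties holding when all exponents are large -/

section Far

variable {n : ℕ}

theorem eventually_add {p : (Fin n → ℤ) → Prop} (h : ∀ᶠ α in atTop, p α) (γ : Fin n → ℤ) :
    ∀ᶠ α in atTop, p (α + γ) := by
  obtain ⟨d, hd⟩ := eventually_atTop.1 h
  exact eventually_atTop.2 ⟨d - γ, fun α hα => hd _ (by
    intro i; have := hα i; simp only [Pi.sub_apply, Pi.add_apply] at *; omega)⟩

theorem eventually_nonneg_add (γ : Fin n → ℤ) : ∀ᶠ α : Fin n → ℤ in atTop, 0 ≤ α + γ :=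
  eventually_add (eventually_ge_atTop 0) γ

theorem eventually_nonneg : ∀ᶠ α : Fin n → ℤ in atTop, 0 ≤ α := eventually_ge_atTop 0

theorem eventually_apply {p : ℤ → Prop} (h : ∀ᶠ z in atTop, p z) (i : Fin n) :
    ∀ᶠ α : Fin n → ℤ in atTop, p (α i) := by
  obtain ⟨d, hd⟩ := eventually_atTop.1 h
  exact eventually_atTop.2 ⟨fun _ => d, fun α hα => hd _ (hα i)⟩

theorem eventually_of_eventually_apply {p : ℤ → Prop} {i : Fin n}
    (h : ∀ᶠ α : Fin n → ℤ in atTop, p (α i)) : ∀ᶠ z in atTop, p z := by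
  obtain ⟨d, hd⟩ := eventually_atTop.1 h
  refine eventually_atTop.2 ⟨d i, fun z hz => ?_⟩
  have := hd (Function.update d i z) (by
    intro j
    by_cases hj : j = i
    · subst hj; simpa using hz
    · simp [hj])
  simpa using this

end Far

/-! ### Germs at infinity of rational functions on ℤⁿ -/

section Rational

variable {K : Type*} [Field K] {n : ℕ}

/-- Evaluation of a polynomial at an integer vector. -/
def ev (α : Fin n → ℤ) : MvPolynomial (Fin n) K →+* K := MvPolynomial.eval fun i => (α i : K)

@[simp] theorem ev_X (α : Fin n → ℤ) (i : Fin n) :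
    ev α (MvPolynomial.X i : MvPolynomial (Fin n) K) = α i := by simp [ev]

@[simp] theorem ev_C (α : Fin n → ℤ) (c : K) : ev α (MvPolynomial.C c) = c := by simp [ev]

variable (K n) in
/-- The products of linear forms `X i + j` with `j` an integer. -/
def linSub : Submonoid (MvPolynomial (Fin n) K) :=
  Submonoid.closure (Set.range fun p : Fin n × ℤ => MvPolynomial.X p.1 + MvPolynomial.C (p.2 : K))

theorem X_add_C_mem_linSub (i : Fin n) (j : ℤ) :
    (MvPolynomial.X i + MvPolynomial.C (j : K)) ∈ linSub K n :=
  Submonoid.subset_closure ⟨(i, j), rfl⟩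

/-- The shift `X i ↦ X i + γ i` of polynomials. -/
def shiftPoly (γ : Fin n → ℤ) : MvPolynomial (Fin n) K →ₐ[K] MvPolynomial (Fin n) K :=
  MvPolynomial.aeval fun i => MvPolynomial.X i + MvPolynomial.C (γ i : K)

theorem ev_shiftPoly (γ α : Fin n → ℤ) (p : MvPolynomial (Fin n) K) :
    ev α (shiftPoly γ p) = ev (α + γ) p := by
  induction p using MvPolynomial.induction_on with
  | C a => simp [shiftPoly]
  | add p q hp hq => simp [hp, hq]
  | mul_X p i hp => rw [map_mul, map_mul, hp]; simp [shiftPoly]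

theorem shiftPoly_mem_linSub (γ : Fin n → ℤ) {D : MvPolynomial (Fin n) K} (h : D ∈ linSub K n) :
    shiftPoly γ D ∈ linSub K n := by
  induction h using Submonoid.closure_induction with
  | mem x hx =>
    obtain ⟨⟨i, j⟩, rfl⟩ := hx
    have := X_add_C_mem_linSub (K := K) i (γ i + j)
    simpa [shiftPoly, add_assoc] using this
  | one => rw [map_one]; exact one_mem _
  | mul x y _ _ hx hy => rw [map_mul]; exact mul_mem hx hy

/-- A function on `ℤⁿ` which, far out, is a rational function whose denominator is a product of
linear forms `X i + j`. -/
def Rat (f : (Fin n → ℤ) → K) : Prop :=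
  ∃ D ∈ linSub K n, ∃ g : MvPolynomial (Fin n) K, ∀ᶠ α in atTop, ev α D * f α = ev α g

theorem Rat.congr {f g : (Fin n → ℤ) → K} (hf : Rat f) (h : f =ᶠ[atTop] g) : Rat g := by
  obtain ⟨D, hD, p, hp⟩ := hf
  refine ⟨D, hD, p, ?_⟩
  filter_upwards [hp, h] with α h1 h2
  rw [← h2, h1]

theorem rat_ev (p : MvPolynomial (Fin n) K) : Rat fun α => ev α p :=
  ⟨1, one_mem _, p, Eventually.of_forall fun α => by simp⟩

theorem rat_const (c : K) : Rat fun _ : Fin n → ℤ => c := by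
  simpa using rat_ev (n := n) (MvPolynomial.C c)

theorem rat_apply (i : Fin n) : Rat fun α : Fin n → ℤ => (α i : K) := by
  simpa using rat_ev (K := K) (MvPolynomial.X i)

theorem Rat.add {f g : (Fin n → ℤ) → K} (hf : Rat f) (hg : Rat g) : Rat fun α => f α + g α := by
  obtain ⟨D, hD, p, hp⟩ := hf
  obtain ⟨E, hE, q, hq⟩ := hg
  refine ⟨D * E, mul_mem hD hE, p * E + q * D, ?_⟩
  filter_upwards [hp, hq] with α h1 h2
  simp only [map_mul, map_add]
  linear_combination ev α E * h1 + ev α D * h2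

theorem Rat.mul {f g : (Fin n → ℤ) → K} (hf : Rat f) (hg : Rat g) : Rat fun α => f α * g α := by
  obtain ⟨D, hD, p, hp⟩ := hf
  obtain ⟨E, hE, q, hq⟩ := hg
  refine ⟨D * E, mul_mem hD hE, p * q, ?_⟩
  filter_upwards [hp, hq] with α h1 h2
  simp only [map_mul, ← h1, ← h2]
  ring

theorem Rat.const_mul {f : (Fin n → ℤ) → K} (hf : Rat f) (c : K) : Rat fun α => c * f α :=
  (rat_const c).mul hf

theorem Rat.sub {f g : (Fin n → ℤ) → K} (hf : Rat f) (hg : Rat g) : Rat fun α => f α - g α := by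
  simpa [sub_eq_add_neg] using hf.add (hg.const_mul (-1))

theorem rat_sum {ι : Type*} (s : Finset ι) {f : ι → (Fin n → ℤ) → K} (hf : ∀ i ∈ s, Rat (f i)) :
    Rat fun α => ∑ i ∈ s, f i α := by
  classical
  induction s using Finset.induction_on with
  | empty => simpa using rat_const (n := n) (0 : K)
  | insert a s ha ih =>
    simp only [Finset.sum_insert ha]
    exact (hf a (by simp)).add (ih fun i hi => hf i (by simp [hi]))

theorem Rat.shift {f : (Fin n → ℤ) → K} (hf : Rat f) (γ : Fin n → ℤ) : Rat fun α => f (α + γ) := by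
  obtain ⟨D, hD, p, hp⟩ := hf
  refine ⟨shiftPoly γ D, shiftPoly_mem_linSub γ hD, shiftPoly γ p, ?_⟩
  filter_upwards [eventually_add hp γ] with α h1
  rw [ev_shiftPoly, ev_shiftPoly, h1]

variable [CharZero K]

/-- A translated orthant of ℤⁿ is a product of infinite subsets of `K` in characteristic zero, hence
Zariski dense. -/
theorem eq_zero_of_eventually_ev {p : MvPolynomial (Fin n) K}
    (h : ∀ᶠ α in atTop, ev α p = 0) : p = 0 := by
  obtain ⟨d, hd⟩ := eventually_atTop.1 h
  refine MvPolynomial.funext_set (fun i => (fun z : ℤ => (z : K)) '' Set.Ici (d i))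
    (fun i => (Set.Ici_infinite (d i)).image Int.cast_injective.injOn) fun x hx => ?_
  choose z hz hzx using fun i => hx i (Set.mem_univ i)
  have h1 : x = fun i => (z i : K) := funext fun i => (hzx i).symm
  rw [h1, map_zero]
  exact hd z hz

theorem eventually_ne_neg (j : ℤ) : ∀ᶠ z : ℤ in atTop, (z + j : K) ≠ 0 := by
  filter_upwards [eventually_gt_atTop (-j)] with z hz
  have : z + j ≠ 0 := by omega
  exact_mod_cast this

theorem eventually_ev_ne_zero {D : MvPolynomial (Fin n) K} (h : D ∈ linSub K n) :
    ∀ᶠ α in atTop, ev α D ≠ 0 := by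
  induction h using Submonoid.closure_induction with
  | mem x hx =>
    obtain ⟨⟨i, j⟩, rfl⟩ := hx
    filter_upwards [eventually_apply (eventually_ne_neg (K := K) j) i] with α h
    simpa using h
  | one => simp
  | mul x y _ _ hx hy =>
    filter_upwards [hx, hy] with α h1 h2
    rw [map_mul]; exact mul_ne_zero h1 h2

theorem rat_inv (i : Fin n) (j : ℤ) : Rat fun α : Fin n → ℤ => (α i + j : K)⁻¹ := by
  refine ⟨_, X_add_C_mem_linSub i j, 1, ?_⟩
  filter_upwards [eventually_apply (eventually_ne_neg (K := K) j) i] with α h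
  simp [mul_inv_cancel₀ h]

/-- Germs of rational functions have no zero divisors, since the product of the numerators vanishes
as a polynomial. -/
theorem Rat.eventually_eq_zero_or {f g : (Fin n → ℤ) → K} (hf : Rat f) (hg : Rat g)
    (h : ∀ᶠ α in atTop, f α * g α = 0) : f =ᶠ[atTop] 0 ∨ g =ᶠ[atTop] 0 := by
  obtain ⟨D, hD, p, hp⟩ := hf
  obtain ⟨E, hE, q, hq⟩ := hg
  have : p * q = 0 := by
    refine eq_zero_of_eventually_ev ?_
    filter_upwards [hp, hq, h] with α h1 h2 h3
    rw [map_mul, ← h1, ← h2]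
    linear_combination ev α D * ev α E * h3
  rcases mul_eq_zero.1 this with rfl | rfl
  · left
    filter_upwards [hp, eventually_ev_ne_zero hD] with α h1 h2
    simpa [h2] using h1
  · right
    filter_upwards [hq, eventually_ev_ne_zero hE] with α h1 h2
    simpa [h2] using h1

end Rational

/-! ### Expansion into shifts, and 𝔞ₙ as the operators vanishing far out -/

section Band

variable {K : Type*} [Field K] {n : ℕ}

theorem subalgebra_eq_top (S : Subalgebra K (Jac K n)) (hx : ∀ i, xEl K i ∈ S)
    (hd : ∀ i, dEl K i ∈ S) (hh : ∀ i, hInvEl K i ∈ S) : S = ⊤ := by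
  have h1 : weylAlgebra K n ≤ S.map (jacobianAlgebra K n).val := by
    refine Algebra.adjoin_le ?_
    rintro _ (⟨i, rfl⟩ | ⟨i, rfl⟩)
    · exact ⟨_, hx i, rfl⟩
    · exact ⟨_, hd i, rfl⟩
  have h2 : jacobianAlgebra K n ≤ S.map (jacobianAlgebra K n).val := by
    refine Algebra.adjoin_le ?_
    rintro _ (h | ⟨i, rfl⟩)
    · exact h1 h
    · exact ⟨_, hh i, rfl⟩
  refine eq_top_iff.2 fun a _ => ?_
  obtain ⟨b, hb, hba⟩ := h2 a.2
  have : b = a := Subtype.ext hba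
  exact this ▸ hb

theorem jac_induction {p : Jac K n → Prop} (hx : ∀ i, p (xEl K i)) (hd : ∀ i, p (dEl K i))
    (hh : ∀ i, p (hInvEl K i)) (hc : ∀ c : K, p (algebraMap K _ c))
    (hadd : ∀ a b, p a → p b → p (a + b)) (hmul : ∀ a b, p a → p b → p (a * b)) (a : Jac K n) :
    p a := by
  let S : Subalgebra K (Jac K n) :=
    { carrier := {a | p a}
      mul_mem' := fun {a b} ha hb => hmul a b ha hb
      add_mem' := fun {a b} ha hb => hadd a b ha hb
      algebraMap_mem' := hc }
  have : a ∈ S := by rw [subalgebra_eq_top S hx hd hh]; trivial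
  exact this

theorem jac_algebraMap_apply (c : K) (p : MvPolynomial (Fin n) K) :
    (algebraMap K (Jac K n) c).1 p = c • p := rfl

variable [CharZero K]

/-- Far out, every element of `𝔸ₙ` is a finite sum of shifts with rational coefficients. -/
theorem exists_band (a : Jac K n) : ∃ (ι : Type) (_ : Fintype ι) (γ : ι → Fin n → ℤ)
    (f : ι → (Fin n → ℤ) → K), (∀ i, Rat (f i)) ∧
      ∀ᶠ α in atTop, a.1 (zm K α) = ∑ i, f i α • zm K (α + γ i) := by
  induction a using jac_induction with
  | hx i =>
    refine ⟨Unit, inferInstance, fun _ => Pi.single i 1, fun _ _ => 1, fun _ => rat_const 1, ?_⟩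
    filter_upwards [eventually_nonneg] with α h
    simp [xEl_zm i h]
  | hd i =>
    refine ⟨Unit, inferInstance, fun _ => -Pi.single i 1, fun _ α => α i,
      fun _ => rat_apply i, Eventually.of_forall fun α => ?_⟩
    simp [dEl_zm, sub_eq_add_neg]
  | hh i =>
    refine ⟨Unit, inferInstance, fun _ => 0, fun _ α => (α i + (1 : ℤ) : K)⁻¹,
      fun _ => rat_inv i 1, Eventually.of_forall fun α => ?_⟩
    simp [hInvEl_zm]
  | hc c =>
    refine ⟨Unit, inferInstance, fun _ => 0, fun _ α => c,
      fun _ => rat_const c, Eventually.of_forall fun α => ?_⟩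
    simp [jac_algebraMap_apply]
  | hadd a b ha hb =>
    obtain ⟨ι, _, γ, f, hf, h1⟩ := ha
    obtain ⟨κ, _, δ, g, hg, h2⟩ := hb
    refine ⟨ι ⊕ κ, inferInstance, Sum.elim γ δ, Sum.elim f g, ?_, ?_⟩
    · rintro (i | i)
      exacts [hf i, hg i]
    · filter_upwards [h1, h2] with α h3 h4
      simp [jac_add_apply, h3, h4]
  | hmul a b ha hb =>
    obtain ⟨ι, _, γ, f, hf, h1⟩ := ha
    obtain ⟨κ, _, δ, g, hg, h2⟩ := hb
    -- The right factor acts first and moves `α` to `α + δ`, so the coefficient of the left factor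
    -- is evaluated there.
    refine ⟨κ × ι, inferInstance, fun i => δ i.1 + γ i.2, fun i α => g i.1 α * f i.2 (α + δ i.1),
      fun i => (hg i.1).mul ((hf i.2).shift _), ?_⟩
    have h3 := eventually_all.2 fun k => eventually_add h1 (δ k)
    filter_upwards [h2, h3] with α h4 h5
    rw [jac_mul_apply, h4, map_sum, Fintype.sum_prod_type]
    refine Finset.sum_congr rfl fun k _ => ?_
    rw [map_smul, h5 k, Finset.smul_sum]
    refine Finset.sum_congr rfl fun i _ => ?_
    rw [smul_smul, add_assoc]

/-- The coefficient of `x^(α+γ)` in `a(x^α)`. -/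
def cf (a : Jac K n) (γ α : Fin n → ℤ) : K := (a.1 (zm K α)).coeff (natExp (α + γ))

/-- The same shift may occur several times in the given expansion, so the coefficient at `γ`
collects a whole fibre of `δ`. -/
theorem cf_eventuallyEq {a : Jac K n} {ι : Type*} (s : Finset ι) {δ : ι → Fin n → ℤ}
    {f : ι → (Fin n → ℤ) → K}
    (h : ∀ᶠ α in atTop, a.1 (zm K α) = ∑ i ∈ s, f i α • zm K (α + δ i)) (γ : Fin n → ℤ) :
    cf a γ =ᶠ[atTop] fun α => ∑ i ∈ s with δ i = γ, f i α := by
  filter_upwards [h, eventually_nonneg_add γ] with α h1 h2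
  rw [cf, h1, MvPolynomial.coeff_sum, Finset.sum_filter]
  refine Finset.sum_congr rfl fun i _ => ?_
  rw [MvPolynomial.coeff_smul, coeff_zm K h2, smul_eq_mul]
  simp

theorem cf_eventuallyEq_single {a : Jac K n} {δ : Fin n → ℤ} {f : (Fin n → ℤ) → K}
    (h : ∀ᶠ α in atTop, a.1 (zm K α) = f α • zm K (α + δ)) : cf a δ =ᶠ[atTop] f := by
  have := cf_eventuallyEq (a := a) (Finset.univ : Finset Unit) (δ := fun _ => δ) (f := fun _ => f)
    (by simpa using h) δ
  simpa using this

theorem cf_eventuallyEq_zero {a : Jac K n} {δ γ : Fin n → ℤ} {f : (Fin n → ℤ) → K}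
    (h : ∀ᶠ α in atTop, a.1 (zm K α) = f α • zm K (α + δ)) (hne : δ ≠ γ) :
    cf a γ =ᶠ[atTop] 0 := by
  have := cf_eventuallyEq (a := a) (Finset.univ : Finset Unit) (δ := fun _ => δ) (f := fun _ => f)
    (by simpa using h) γ
  simp only [hne, Finset.filter_false, Finset.sum_empty] at this
  exact this

theorem rat_cf (a : Jac K n) (γ : Fin n → ℤ) : Rat (cf a γ) := by
  obtain ⟨ι, _, δ, f, hf, h1⟩ := exists_band a
  exact (rat_sum _ fun i _ => hf i).congr (cf_eventuallyEq Finset.univ h1 γ).symm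

theorem rat_of_eventually {a : Jac K n} {δ : Fin n → ℤ} {f : (Fin n → ℤ) → K}
    (h : ∀ᶠ α in atTop, a.1 (zm K α) = f α • zm K (α + δ)) : Rat f :=
  (rat_cf a δ).congr (cf_eventuallyEq_single h)

/-- `S` is the set of shifts which occur in `a` far out. -/
def IsSupp (a : Jac K n) (S : Finset (Fin n → ℤ)) : Prop :=
  (∀ γ, γ ∈ S ↔ ¬ cf a γ =ᶠ[atTop] 0) ∧
    ∀ᶠ α in atTop, a.1 (zm K α) = ∑ γ ∈ S, cf a γ α • zm K (α + γ)

theorem exists_isSupp (a : Jac K n) : ∃ S, IsSupp a S := by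
  classical
  obtain ⟨ι, _, δ, f, hf, h1⟩ := exists_band a
  have h2 := cf_eventuallyEq Finset.univ h1
  refine ⟨(Finset.univ.image δ).filter fun γ => ¬ cf a γ =ᶠ[atTop] 0, ?_, ?_⟩
  · intro γ
    simp only [Finset.mem_filter, and_iff_right_iff_imp]
    intro h
    by_contra h3
    refine h ((h2 γ).trans (Eventually.of_forall fun α => ?_))
    rw [Finset.filter_false_of_mem]
    · simp
    · intro i _ hi
      exact h3 (Finset.mem_image.2 ⟨i, Finset.mem_univ _, hi⟩)
  · have h3 : ∀ᶠ α in atTop, ∀ γ ∈ Finset.univ.image δ, cf a γ α =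
        ∑ i with δ i = γ, f i α := by
      rw [Finset.eventually_all]
      exact fun γ _ => h2 γ
    -- The shifts discarded from the support have coefficients which are zero only eventually; since
    -- there are finitely many, one bound serves for all.
    have h4 : ∀ᶠ α in atTop, ∀ γ ∈ Finset.univ.image δ, cf a γ =ᶠ[atTop] 0 → cf a γ α = 0 := by
      rw [Finset.eventually_all]
      intro γ _
      by_cases h : cf a γ =ᶠ[atTop] 0
      · filter_upwards [h] with α h' _ using h'
      · exact Eventually.of_forall fun α h' => absurd h' h
    filter_upwards [h1, h3, h4] with α h5 h6 h7
    rw [h5, Finset.sum_filter, ← Finset.sum_fiberwise_of_maps_to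
      (fun i _ => Finset.mem_image_of_mem δ (Finset.mem_univ i))]
    refine Finset.sum_congr rfl fun γ hγ => ?_
    have h8 : ∑ i with δ i = γ, f i α • zm K (α + δ i) = cf a γ α • zm K (α + γ) := by
      rw [h6 γ hγ, Finset.sum_smul]
      refine Finset.sum_congr rfl fun i hi => ?_
      rw [(Finset.mem_filter.1 hi).2]
    rw [h8]
    split_ifs with h9
    · rw [h7 γ hγ h9, zero_smul]
    · rfl

/-- Coefficients multiply by a convolution twisted by the shift. Where a sum of shifts arises from
one pair only, the coefficient is a single product. -/
theorem cf_mul {a b : Jac K n} {S T : Finset (Fin n → ℤ)} (hS : IsSupp a S) (hT : IsSupp b T)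
    (γ : Fin n → ℤ) : cf (a * b) γ =ᶠ[atTop] fun α =>
      ∑ p ∈ S ×ˢ T with p.1 + p.2 = γ, cf a p.1 (α + p.2) * cf b p.2 α := by
  refine cf_eventuallyEq (δ := fun p : (Fin n → ℤ) × (Fin n → ℤ) => p.1 + p.2) (S ×ˢ T) ?_ γ
  have h3 : ∀ᶠ α in atTop, ∀ ε ∈ T, a.1 (zm K (α + ε)) =
      ∑ γ ∈ S, cf a γ (α + ε) • zm K (α + ε + γ) := by
    rw [Finset.eventually_all]
    exact fun ε _ => eventually_add hS.2 ε
  filter_upwards [hT.2, h3] with α h4 h5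
  rw [jac_mul_apply, h4, map_sum, Finset.sum_product_right]
  refine Finset.sum_congr rfl fun ε hε => ?_
  rw [map_smul, h5 ε hε, Finset.smul_sum]
  refine Finset.sum_congr rfl fun δ _ => ?_
  rw [smul_smul, mul_comm, add_assoc, add_comm ε]

/-- The elements of `𝔸ₙ` which vanish far out. -/
def farIdeal : TwoSidedIdeal (Jac K n) :=
  TwoSidedIdeal.mk' {a | ∀ᶠ α in atTop, a.1 (zm K α) = 0}
    (Eventually.of_forall fun α => rfl)
    (by
      intro a b ha hb
      filter_upwards [ha, hb] with α h1 h2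
      rw [jac_add_apply, h1, h2, add_zero])
    (by
      intro a ha
      filter_upwards [ha] with α h1
      rw [jac_neg_apply, h1, neg_zero])
    (by
      intro a b hb
      filter_upwards [hb] with α h1
      rw [jac_mul_apply, h1, map_zero])
    -- Closure under right multiplication uses that `b` moves a monomial by finitely many shifts, so
    -- its image is still far out.
    (by
      intro a b ha
      obtain ⟨S, hS⟩ := exists_isSupp b
      have h3 : ∀ᶠ α in atTop, ∀ ε ∈ S, a.1 (zm K (α + ε)) = 0 := by
        rw [Finset.eventually_all]
        exact fun ε _ => eventually_add ha ε
      filter_upwards [hS.2, h3] with α h4 h5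
      rw [jac_mul_apply, h4, map_sum]
      refine Finset.sum_eq_zero fun ε hε => ?_
      rw [map_smul, h5 ε hε, smul_zero])

theorem mem_farIdeal {a : Jac K n} : a ∈ farIdeal ↔ ∀ᶠ α in atTop, a.1 (zm K α) = 0 :=
  TwoSidedIdeal.mem_mk' ..

theorem aIdeal_le_farIdeal : aIdeal K n ≤ farIdeal := by
  refine iSup_le fun i => TwoSidedIdeal.span_le.2 ?_
  rintro _ ⟨⟨s, t⟩, rfl⟩
  refine mem_farIdeal.2 ?_
  filter_upwards [eventually_apply (eventually_gt_atTop (t : ℤ)) i] with α h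
  rw [matUnit_zm, if_neg h.ne']

theorem red_eq_zero_iff' {a : Jac K n} : red K n a = 0 ↔ a ∈ aIdeal K n :=
  Ideal.Quotient.eq_zero_iff_mem.trans TwoSidedIdeal.mem_asIdeal

theorem matUnit_mem_aIdeal (i : Fin n) (s t : ℕ) : matUnit K i s t ∈ aIdeal K n :=
  le_iSup (pIdeal K) i (TwoSidedIdeal.subset_span ⟨(s, t), rfl⟩)

theorem red_yEl_mul_xEl (i : Fin n) : red K n (yEl K i) * red K n (xEl K i) = 1 := by
  rw [← map_mul, yEl_mul_xEl, map_one]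

theorem red_xEl_mul_yEl (i : Fin n) : red K n (xEl K i) * red K n (yEl K i) = 1 := by
  have h := red_eq_zero_iff'.2 (matUnit_mem_aIdeal (K := K) i 0 0)
  simp only [matUnit, pow_zero, mul_one, zero_add, pow_one, map_sub, map_one, map_mul] at h
  exact (sub_eq_zero.1 h).symm

variable (K) in
/-- Multiplication operators as elements of `𝔸ₙ`. -/
def mulEl : MvPolynomial (Fin n) K →ₐ[K] Jac K n :=
  (Algebra.lmul K (MvPolynomial (Fin n) K)).codRestrict (jacobianAlgebra K n) fun p => by
    induction p using MvPolynomial.induction_on with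
    | C a =>
      rw [← MvPolynomial.algebraMap_eq, AlgHom.commutes]
      exact Subalgebra.algebraMap_mem _ _
    | add p q hp hq => rw [map_add]; exact add_mem hp hq
    | mul_X p i hp => rw [map_mul]; exact mul_mem hp (xEl K i).2

theorem mulEl_apply (p q : MvPolynomial (Fin n) K) : (mulEl K p).1 q = p * q := rfl

theorem mulEl_X (i : Fin n) : mulEl K (MvPolynomial.X i) = xEl K i := rfl

theorem mulEl_zm_zm {α β : Fin n → ℤ} (hα : 0 ≤ α) (hβ : 0 ≤ β) :
    (mulEl K (zm K α)).1 (zm K β) = zm K (β + α) := zm_mul hα hβ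

theorem isUnit_red_mulEl (β : Fin n →₀ ℕ) :
    IsUnit (red K n (mulEl K (MvPolynomial.monomial β 1))) := by
  induction β using Finsupp.induction_linear with
  | zero => simp
  | add f g hf hg =>
    rw [← one_mul (1 : K), ← MvPolynomial.monomial_mul, map_mul, map_mul]
    exact hf.mul hg
  | single i m =>
    rw [← MvPolynomial.X_pow_eq_monomial, map_pow, map_pow, mulEl_X]
    exact IsUnit.pow m ⟨⟨_, _, red_xEl_mul_yEl i, red_yEl_mul_xEl i⟩, rfl⟩

/-- An operator killing x^α for all α ≥ d satisfies a · x^d = 0 in 𝔸ₙ, and the class of x^d is a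
unit of 𝒜ₙ because xᵢyᵢ = 1 there. -/
theorem mem_aIdeal_iff {a : Jac K n} :
    a ∈ aIdeal K n ↔ ∀ᶠ α in atTop, a.1 (zm K α) = 0 := by
  refine ⟨fun h => mem_farIdeal.1 (aIdeal_le_farIdeal h), fun h => ?_⟩
  obtain ⟨d, hd⟩ := eventually_atTop.1 (h.and eventually_nonneg)
  have hd0 : 0 ≤ d := (hd d le_rfl).2
  have h1 : a * mulEl K (zm K d) = 0 := jac_ext fun α hα => by
    rw [jac_mul_apply, mulEl_zm_zm hd0 hα, (hd _ (le_add_of_nonneg_left hα)).1]; rfl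
  have h2 := isUnit_red_mulEl (K := K) (natExp d)
  rw [← zm_of_nonneg K hd0] at h2
  have h3 : red K n a * red K n (mulEl K (zm K d)) = 0 := by rw [← map_mul, h1, map_zero]
  exact red_eq_zero_iff'.1 ((h2.mul_left_eq_zero).1 h3)

theorem red_eq_iff {a b : Jac K n} :
    red K n a = red K n b ↔ ∀ᶠ α in atTop, a.1 (zm K α) = b.1 (zm K α) := by
  rw [← sub_eq_zero, ← map_sub, red_eq_zero_iff', mem_aIdeal_iff]
  simp only [jac_sub_apply, sub_eq_zero]

end Band

/-! ### Difference operators on polynomials -/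

section Differences

variable {K : Type*} [Field K] {n : ℕ}

theorem addSubgroup_eq_top (S : AddSubgroup (Fin n → ℤ)) (h : ∀ i, Pi.single i 1 ∈ S) :
    S = ⊤ := by
  refine eq_top_iff.2 fun γ _ => ?_
  have : γ = ∑ i, γ i • (Pi.single i 1 : Fin n → ℤ) := by
    ext j
    simp [Finset.sum_apply, Pi.single_apply]
  rw [this]
  exact sum_mem fun i _ => S.zsmul_mem (h i) _

/-- The two bounds are proved together: the product rule ab - cd = a(b - d) + (a - c)d needs the
degree of the shifted factor as well as those of the differences. -/
theorem totalDegree_difference_monomial (i : Fin n) (s : Fin n →₀ ℕ) :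
    (shiftPoly (K := K) (Pi.single i 1) (MvPolynomial.monomial s 1)).totalDegree ≤ s.degree ∧
    (shiftPoly (K := K) (Pi.single i 1) (MvPolynomial.monomial s 1) -
      MvPolynomial.monomial s 1).totalDegree ≤ s.degree - 1 := by
  have hadd : ∀ s t : Fin n →₀ ℕ,
      ((shiftPoly (K := K) (Pi.single i 1) (MvPolynomial.monomial s 1)).totalDegree ≤ s.degree ∧
      (shiftPoly (K := K) (Pi.single i 1) (MvPolynomial.monomial s 1) -
        MvPolynomial.monomial s 1).totalDegree ≤ s.degree - 1) →
      ((shiftPoly (K := K) (Pi.single i 1) (MvPolynomial.monomial t 1)).totalDegree ≤ t.degree ∧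
      (shiftPoly (K := K) (Pi.single i 1) (MvPolynomial.monomial t 1) -
        MvPolynomial.monomial t 1).totalDegree ≤ t.degree - 1) →
      ((shiftPoly (K := K) (Pi.single i 1) (MvPolynomial.monomial (s + t) 1)).totalDegree
        ≤ (s + t).degree ∧
      (shiftPoly (K := K) (Pi.single i 1) (MvPolynomial.monomial (s + t) 1) -
        MvPolynomial.monomial (s + t) 1).totalDegree ≤ (s + t).degree - 1) := by
    intro s t hs ht
    -- Zero exponents are treated apart because the truncated subtraction `degree - 1` is additive
    -- in the required sense only for positive degrees.
    rcases eq_or_ne s 0 with rfl | hs0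
    · simpa using ht
    rcases eq_or_ne t 0 with rfl | ht0
    · simpa using hs
    have hs1 : 1 ≤ s.degree := by
      rw [Nat.one_le_iff_ne_zero]; exact fun h => hs0 ((Finsupp.degree_eq_zero_iff s).1 h)
    have ht1 : 1 ≤ t.degree := by
      rw [Nat.one_le_iff_ne_zero]; exact fun h => ht0 ((Finsupp.degree_eq_zero_iff t).1 h)
    have hm : (MvPolynomial.monomial (s + t) 1 : MvPolynomial (Fin n) K) =
        MvPolynomial.monomial s 1 * MvPolynomial.monomial t 1 := by
      rw [MvPolynomial.monomial_mul, one_mul]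
    have htd : (MvPolynomial.monomial t 1 : MvPolynomial (Fin n) K).totalDegree ≤ t.degree := by
      rw [MvPolynomial.totalDegree_monomial _ one_ne_zero]; exact le_of_eq rfl
    have hst : (s + t).degree = s.degree + t.degree := map_add _ _ _
    rw [hm, map_mul, hst]
    refine ⟨(MvPolynomial.totalDegree_mul _ _).trans (by omega), ?_⟩
    have : ∀ a b c d : MvPolynomial (Fin n) K, a * b - c * d = a * (b - d) + (a - c) * d := by
      intros; ring
    rw [this]
    refine (MvPolynomial.totalDegree_add _ _).trans (max_le ?_ ?_)
    · exact (MvPolynomial.totalDegree_mul _ _).trans (by omega)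
    · exact (MvPolynomial.totalDegree_mul _ _).trans (by omega)
  induction s using Finsupp.induction_linear with
  | zero => simp
  | add s t hs ht => exact hadd s t hs ht
  | single j m =>
    induction m with
    | zero => simp
    | succ m ih =>
      rw [Finsupp.single_add]
      refine hadd _ _ ih ?_
      change (shiftPoly (K := K) (Pi.single i 1) (MvPolynomial.X j)).totalDegree ≤ _ ∧
        (shiftPoly (K := K) (Pi.single i 1) (MvPolynomial.X j) -
          MvPolynomial.X j).totalDegree ≤ _
      have h1 : shiftPoly (K := K) (Pi.single i 1) (MvPolynomial.X j) =
        MvPolynomial.X j + MvPolynomial.C (((Pi.single i 1 : Fin n → ℤ) j : ℤ) : K) := by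
          simp [shiftPoly]
      rw [h1]
      refine ⟨(MvPolynomial.totalDegree_add _ _).trans ?_, ?_⟩
      · rw [MvPolynomial.totalDegree_X, MvPolynomial.totalDegree_C, Finsupp.degree_single]; simp
      · rw [add_sub_cancel_left, MvPolynomial.totalDegree_C]; simp

theorem totalDegree_difference (i : Fin n) (p : MvPolynomial (Fin n) K) :
    (shiftPoly (Pi.single i 1) p - p).totalDegree ≤ p.totalDegree - 1 := by
  have h : shiftPoly (Pi.single i 1) p - p = ∑ s ∈ p.support, p.coeff s •
      (shiftPoly (K := K) (Pi.single i 1) (MvPolynomial.monomial s 1) -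
        MvPolynomial.monomial s 1) := by
    have hp : p = ∑ s ∈ p.support, p.coeff s • MvPolynomial.monomial s (1 : K) := by
      conv_lhs => rw [p.as_sum]
      simp [MvPolynomial.smul_monomial]
    conv_lhs => rw [hp]
    simp only [map_sum, map_smul, smul_sub, Finset.sum_sub_distrib]
  rw [h]
  refine MvPolynomial.totalDegree_finsetSum_le fun s hs => ?_
  refine (MvPolynomial.totalDegree_smul_le _ _).trans ?_
  refine (totalDegree_difference_monomial i s).2.trans ?_
  exact Nat.sub_le_sub_right (MvPolynomial.le_totalDegree hs) 1

variable [CharZero K]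

/-- The translations fixing the values of `p` form a subgroup of ℤⁿ, here all of it, so `p` takes
its value at 0 at every integer point. -/
theorem eq_C_of_shift_eq {p : MvPolynomial (Fin n) K}
    (h : ∀ i, shiftPoly (Pi.single i 1) p = p) : p = MvPolynomial.C (ev 0 p) := by
  let S : AddSubgroup (Fin n → ℤ) :=
    { carrier := {γ | ∀ α, ev (α + γ) p = ev α p}
      zero_mem' := fun α => by simp
      add_mem' := fun {γ δ} hγ hδ α => by rw [← add_assoc, hδ, hγ]
      neg_mem' := fun {γ} hγ α => by rw [← hγ (α + -γ), neg_add_cancel_right] }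
  have hS : S = ⊤ := addSubgroup_eq_top S fun i α => by rw [← ev_shiftPoly, h i]
  refine sub_eq_zero.1 (eq_zero_of_eventually_ev (Eventually.of_forall fun α => ?_))
  have : α ∈ S := hS ▸ AddSubgroup.mem_top α
  have := this 0
  rw [zero_add] at this
  simp [this]

end Differences

/-! ### Maximality, uniqueness and stability of 𝔞ₙ -/

section Simplicity

variable {K : Type*} [Field K] [CharZero K] {n : ℕ}

theorem exists_shift (γ : Fin n → ℤ) :
    ∃ c : Jac K n, ∀ᶠ α in atTop, c.1 (zm K α) = zm K (α + γ) := by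
  let S : AddSubgroup (Fin n → ℤ) :=
    -- Asking for both `γ` and `-γ` makes closure under negation immediate; far out, xᵢ and yᵢ are
    -- opposite shifts.
    { carrier := {γ | (∃ c : Jac K n, ∀ᶠ α in atTop, c.1 (zm K α) = zm K (α + γ)) ∧
        ∃ c : Jac K n, ∀ᶠ α in atTop, c.1 (zm K α) = zm K (α + -γ)}
      zero_mem' := by
        refine ⟨⟨1, ?_⟩, ⟨1, ?_⟩⟩ <;> exact Eventually.of_forall fun α => by simp
      add_mem' := by
        rintro γ δ ⟨⟨a, ha⟩, ⟨a', ha'⟩⟩ ⟨⟨b, hb⟩, ⟨b', hb'⟩⟩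
        refine ⟨⟨b * a, ?_⟩, ⟨b' * a', ?_⟩⟩
        · filter_upwards [ha, eventually_add hb γ] with α h1 h2
          rw [jac_mul_apply, h1, h2, add_assoc]
        · filter_upwards [ha', eventually_add hb' (-γ)] with α h1 h2
          rw [jac_mul_apply, h1, h2, add_assoc, neg_add]
      neg_mem' := by
        rintro γ ⟨h, h'⟩
        exact ⟨h', by simpa using h⟩ }
  have hS : S = ⊤ := addSubgroup_eq_top S fun i => by
    refine ⟨⟨xEl K i, ?_⟩, ⟨yEl K i, ?_⟩⟩
    · filter_upwards [eventually_nonneg] with α h using xEl_zm i h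
    · exact Eventually.of_forall fun α => by rw [yEl_zm, sub_eq_add_neg]
  exact (hS ▸ AddSubgroup.mem_top γ : γ ∈ S).1

theorem exists_diag (p : MvPolynomial (Fin n) K) :
    ∃ c : Jac K n, ∀ α, c.1 (zm K α) = ev α p • zm K α := by
  induction p using MvPolynomial.induction_on with
  | C a => exact ⟨algebraMap K _ a, fun α => by simp [jac_algebraMap_apply]⟩
  | add p q hp hq =>
    obtain ⟨c, hc⟩ := hp
    obtain ⟨d, hd⟩ := hq
    exact ⟨c + d, fun α => by rw [jac_add_apply, hc, hd, map_add, add_smul]⟩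
  | mul_X p i hp =>
    obtain ⟨c, hc⟩ := hp
    -- The eigenvalue of Hᵢ on x^α is αᵢ + 1, so Hᵢ - 1 represents the variable `X i`.
    refine ⟨c * (hEl K i - 1), fun α => ?_⟩
    rw [jac_mul_apply, jac_sub_apply, hEl_zm, jac_one_apply, map_sub, map_smul, hc, map_mul, ev_X]
    module

theorem exists_leftInverse_mulEl (β : Fin n →₀ ℕ) :
    ∃ c : Jac K n, c * mulEl K (MvPolynomial.monomial β 1) = 1 := by
  induction β using Finsupp.induction_linear with
  | zero => exact ⟨1, by simp⟩
  | add f g hf hg =>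
    obtain ⟨a, ha⟩ := hf
    obtain ⟨b, hb⟩ := hg
    refine ⟨b * a, ?_⟩
    rw [← one_mul (1 : K), ← MvPolynomial.monomial_mul, map_mul, mul_assoc, ← mul_assoc a, ha,
      one_mul, hb]
  | single i m =>
    refine ⟨yEl K i ^ m, ?_⟩
    rw [← MvPolynomial.X_pow_eq_monomial, map_pow, mulEl_X]
    induction m with
    | zero => simp
    | succ m ih => rw [pow_succ, pow_succ', mul_assoc, ← mul_assoc (yEl K i), yEl_mul_xEl, one_mul,
        ih]

/-- The map a ↦ [Hᵢ, a] - γᵢ a multiplies the coefficient at the shift ε by εᵢ - γᵢ. If γᵢ ≠ δᵢ it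
removes γ, keeps δ and adds no shift, so the support shrinks without becoming empty. -/
theorem exists_homogeneous_mem {J : TwoSidedIdeal (Jac K n)} {a : Jac K n} (ha : a ∈ J)
    (h : a ∉ aIdeal K n) : ∃ b ∈ J, ∃ (γ : Fin n → ℤ) (f : (Fin n → ℤ) → K),
      ¬ f =ᶠ[atTop] 0 ∧ ∀ᶠ α in atTop, b.1 (zm K α) = f α • zm K (α + γ) := by
  obtain ⟨S, hS⟩ := exists_isSupp a
  induction hm : S.card using Nat.strong_induction_on generalizing a S with
  | _ m ih =>
  rcases S.eq_empty_or_nonempty with rfl | ⟨γ, hγ⟩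
  · exact absurd (mem_aIdeal_iff.2 (by simpa using hS.2)) h
  by_cases hone : ∃ δ ∈ S, δ ≠ γ
  · obtain ⟨δ, hδ, hne⟩ := hone
    obtain ⟨i, hi⟩ := Function.ne_iff.1 hne
    let b : Jac K n := hEl K i * a - a * hEl K i - (γ i : K) • a
    have hb : b ∈ J := by
      refine J.sub_mem (J.sub_mem (J.mul_mem_left _ _ ha) (J.mul_mem_right _ _ ha)) ?_
      rw [Algebra.smul_def]
      exact J.mul_mem_left _ _ ha
    have hbz : ∀ᶠ α in atTop, b.1 (zm K α) =
        ∑ ε ∈ S, ((ε i - γ i : K) * cf a ε α) • zm K (α + ε) := by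
      filter_upwards [hS.2] with α h1
      simp only [b, jac_sub_apply, jac_mul_apply, jac_smul_apply, hEl_zm, map_smul, h1, map_sum,
        Finset.smul_sum, ← Finset.sum_sub_distrib]
      refine Finset.sum_congr rfl fun ε _ => ?_
      simp only [Pi.add_apply, smul_smul, ← sub_smul]
      congr 1
      push_cast
      ring
    have hcf := cf_eventuallyEq S (δ := fun ε => ε) hbz
    obtain ⟨T, hT⟩ := exists_isSupp b
    have hTS : T ⊆ S.erase γ := by
      intro ε hε
      have h1 := (hT.1 ε).1 hε
      rw [Finset.mem_erase]
      refine ⟨?_, ?_⟩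
      · rintro rfl
        refine h1 ((hcf _).trans (Eventually.of_forall fun α => ?_))
        refine Finset.sum_eq_zero fun ε' hε' => ?_
        rw [(Finset.mem_filter.1 hε').2]; simp
      · by_contra h2
        refine h1 ((hcf _).trans (Eventually.of_forall fun α => ?_))
        refine Finset.sum_eq_zero fun ε' hε' => ?_
        obtain ⟨h3, rfl⟩ := Finset.mem_filter.1 hε'
        exact absurd h3 h2
    have hδT : δ ∈ T := by
      rw [hT.1]
      intro h1
      refine (hS.1 δ).1 hδ ?_
      filter_upwards [h1, hcf δ] with α h2 h3
      rw [h2, Finset.sum_filter, Finset.sum_ite_eq_of_mem' _ _ _ hδ] at h3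
      have h4 : (δ i - γ i : K) ≠ 0 := by
        rw [sub_ne_zero]; exact_mod_cast hi
      simpa [h4] using h3.symm
    have hcard : T.card < m := by
      have h1 := Finset.card_le_card hTS
      have h2 := Finset.card_erase_lt_of_mem hγ
      omega
    refine ih _ hcard hb ?_ T hT rfl
    intro hb'
    have h1 := mem_aIdeal_iff.1 hb'
    refine (hT.1 δ).1 hδT ?_
    filter_upwards [h1] with α h2
    rw [cf, h2]; simp
  · push Not at hone
    have hS1 : S = {γ} := Finset.eq_singleton_iff_unique_mem.2 ⟨hγ, hone⟩
    refine ⟨a, ha, γ, cf a γ, (hS.1 γ).1 hγ, ?_⟩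
    filter_upwards [hS.2] with α h1
    rw [h1, hS1, Finset.sum_singleton]

/-- The element yᵢ(a xᵢ - xᵢ a) acts far out by the difference p(α + eᵢ) - p(α), which has smaller
degree; some such difference is nonzero unless `p` is constant. For a constant c, the element a ·
x^d equals c x^d, and x^d has a left inverse. -/
theorem eq_top_of_diag_mem {J : TwoSidedIdeal (Jac K n)} {p : MvPolynomial (Fin n) K} (hp : p ≠ 0)
    {a : Jac K n} (ha : a ∈ J) (h : ∀ᶠ α in atTop, a.1 (zm K α) = ev α p • zm K α) : J = ⊤ := by
  induction hm : p.totalDegree using Nat.strong_induction_on generalizing p a with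
  | _ m ih =>
  by_cases hall : ∀ i, shiftPoly (Pi.single i 1) p = p
  · obtain ⟨c, hc⟩ : ∃ c : K, p = MvPolynomial.C c := ⟨_, eq_C_of_shift_eq hall⟩
    have hc0 : c ≠ 0 := by rintro rfl; exact hp (by simp [hc])
    obtain ⟨d, hd⟩ := eventually_atTop.1 (h.and eventually_nonneg)
    have hd0 : 0 ≤ d := (hd d le_rfl).2
    have h1 : a * mulEl K (zm K d) = c • mulEl K (zm K d) := jac_ext fun α hα => by
      rw [jac_mul_apply, jac_smul_apply, mulEl_zm_zm hd0 hα, (hd _ (le_add_of_nonneg_left hα)).1,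
        hc, ev_C]
    obtain ⟨e, he⟩ := exists_leftInverse_mulEl (K := K) (natExp d)
    rw [← zm_of_nonneg K hd0] at he
    have h2 : (c⁻¹ • e) * (a * mulEl K (zm K d)) = 1 := by
      rw [h1, smul_mul_smul_comm, inv_mul_cancel₀ hc0, one_smul, he]
    rw [← TwoSidedIdeal.one_mem_iff, ← h2]
    exact J.mul_mem_left _ _ (J.mul_mem_right _ _ ha)
  · push Not at hall
    obtain ⟨i, hi⟩ := hall
    have h0 : p.totalDegree ≠ 0 := by
      intro h0
      rw [MvPolynomial.totalDegree_eq_zero_iff_eq_C] at h0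
      apply hi
      rw [h0, ← MvPolynomial.algebraMap_eq, AlgHom.commutes]
    refine ih _ (lt_of_le_of_lt (totalDegree_difference i p) (by omega))
      (sub_ne_zero.2 hi)
      (J.mul_mem_left (yEl K i) _ (J.sub_mem (J.mul_mem_right _ (xEl K i) ha)
        (J.mul_mem_left (xEl K i) _ ha))) ?_ rfl
    filter_upwards [h, eventually_add h (Pi.single i 1), eventually_nonneg] with α h1 h2 h3
    rw [jac_mul_apply, jac_sub_apply, jac_mul_apply, jac_mul_apply, xEl_zm i h3, h1, h2, map_smul,
      xEl_zm i h3, ← sub_smul, map_smul, yEl_zm, add_sub_cancel_right, map_sub, ev_shiftPoly]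

theorem eq_top_of_not_mem_aIdeal {J : TwoSidedIdeal (Jac K n)} {a : Jac K n} (ha : a ∈ J)
    (h : a ∉ aIdeal K n) : J = ⊤ := by
  obtain ⟨b, hb, γ, f, hf, hbf⟩ := exists_homogeneous_mem ha h
  obtain ⟨D, hD, p, hp⟩ := rat_of_eventually hbf
  -- The shift by `-γ` makes the homogeneous element diagonal, and the diagonal operator of the
  -- denominator `D` clears it.
  obtain ⟨s, hs⟩ := exists_shift (K := K) (-γ)
  obtain ⟨c, hc⟩ := exists_diag D
  refine eq_top_of_diag_mem (p := p) ?_ (J.mul_mem_left (c * s) _ hb) ?_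
  · rintro rfl
    apply hf
    filter_upwards [hp, eventually_ev_ne_zero hD] with α h1 h2
    simpa [h2] using h1
  · filter_upwards [hbf, eventually_add hs γ, hp] with α h1 h2 h3
    rw [jac_mul_apply, h1, jac_mul_apply, map_smul, map_smul, h2, add_neg_cancel_right, hc,
      smul_smul, ← h3, mul_comm]

theorem one_notMem_aIdeal : (1 : Jac K n) ∉ aIdeal K n := by
  intro h
  obtain ⟨α, h1, h2⟩ := ((mem_aIdeal_iff.1 h).and eventually_nonneg).exists
  exact zm_ne_zero K h2 h1

theorem le_aIdeal {J : TwoSidedIdeal (Jac K n)} (h : J ≠ ⊤) : J ≤ aIdeal K n := by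
  intro a ha
  by_contra h'
  exact h (eq_top_of_not_mem_aIdeal ha h')

theorem aIdeal_ne_top : aIdeal K n ≠ ⊤ := fun h =>
  one_notMem_aIdeal (K := K) (n := n) (h ▸ trivial)

theorem isCoatom_aIdeal : IsCoatom (aIdeal K n) :=
  ⟨aIdeal_ne_top, fun J hJ => by
    by_contra h
    exact absurd (le_aIdeal h) (not_le_of_gt hJ)⟩

theorem eq_aIdeal_of_isCoatom {J : TwoSidedIdeal (Jac K n)} (hJ : IsCoatom J) :
    J = aIdeal K n := by
  rcases (le_aIdeal hJ.1).eq_or_lt with h | h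
  · exact h
  · exact absurd (hJ.2 _ h) aIdeal_ne_top

/-- The preimage of 𝔞ₙ under the inverse of σ is a proper ideal, hence contained in 𝔞ₙ. -/
theorem aIdealStable : AIdealStable K n := by
  intro σ a ha
  have h : TwoSidedIdeal.comap (σ.symm : Jac K n →+* Jac K n) (aIdeal K n) ≠ ⊤ := by
    intro h
    have h1 : (1 : Jac K n) ∈ TwoSidedIdeal.comap (σ.symm : Jac K n →+* Jac K n) (aIdeal K n) :=
      h ▸ trivial
    rw [TwoSidedIdeal.mem_comap, map_one] at h1
    exact one_notMem_aIdeal h1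
  refine le_aIdeal h ?_
  rw [TwoSidedIdeal.mem_comap]
  simpa using ha

end Simplicity

/-! ### Products of integer powers of linear forms in one variable -/

section Lam

variable (K : Type*) [Field K]

/-- The value at `z` of the rational function `∏ⱼ (z + j)^(e j)`, where vanishing factors are
replaced by `1`. -/
def lam (e : ℤ →₀ ℤ) (z : ℤ) : K :=
  e.prod fun j k => (if z + j = 0 then 1 else ((z + j : ℤ) : K)) ^ k

@[simp] theorem lam_zero (z : ℤ) : lam K 0 z = 1 := Finsupp.prod_zero_index

variable {K}

theorem lam_single (j k z : ℤ) :
    lam K (Finsupp.single j k) z = (if z + j = 0 then 1 else ((z + j : ℤ) : K)) ^ k :=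
  Finsupp.prod_single_index (zpow_zero _)

theorem lam_shift (e : ℤ →₀ ℤ) (m z : ℤ) :
    lam K e (z + m) = lam K (e.mapDomain (· + m)) z := by
  rw [lam, lam, Finsupp.prod_mapDomain_index_inj (add_left_injective m)]
  refine Finsupp.prod_congr fun j _ => ?_
  rw [show z + m + j = z + (j + m) by ring]

variable [CharZero K]

theorem lam_factor_ne_zero (j z : ℤ) : (if z + j = 0 then 1 else ((z + j : ℤ) : K)) ≠ 0 := by
  split_ifs with h
  · exact one_ne_zero
  · exact_mod_cast h

theorem lam_ne_zero (e : ℤ →₀ ℤ) (z : ℤ) : lam K e z ≠ 0 :=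
  Finset.prod_ne_zero_iff.2 fun j _ => zpow_ne_zero _ (lam_factor_ne_zero j z)

theorem lam_add (e e' : ℤ →₀ ℤ) (z : ℤ) : lam K (e + e') z = lam K e z * lam K e' z :=
  Finsupp.prod_add_index' (fun _ => zpow_zero _)
    fun j k l => zpow_add₀ (lam_factor_ne_zero j z) k l

theorem lam_neg (e : ℤ →₀ ℤ) (z : ℤ) : lam K (-e) z = (lam K e z)⁻¹ := by
  refine eq_inv_of_mul_eq_one_left ?_
  rw [← lam_add, neg_add_cancel, lam_zero]

theorem lam_sub (e e' : ℤ →₀ ℤ) (z : ℤ) : lam K (e - e') z = lam K e z / lam K e' z := by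
  rw [sub_eq_add_neg, lam_add, lam_neg, div_eq_mul_inv]

/-- Numerator and denominator of the rational function have no common root, so they can be
proportional only when both are trivial. -/
theorem eq_zero_of_lam_eventually_const {e : ℤ →₀ ℤ} {c : K}
    (h : ∀ᶠ z in atTop, lam K e z = c) : e = 0 := by
  -- `toNat` discards the negative exponents: `num e` is the numerator and `num (-e)` the
  -- denominator.
  let num (e : ℤ →₀ ℤ) : Polynomial K :=
    ∏ j ∈ e.support, (Polynomial.X + Polynomial.C (j : K)) ^ (e j).toNat
  have hroot : ∀ (e : ℤ →₀ ℤ) (j : ℤ), (num e).eval (-j : K) = 0 ↔ 0 < e j := by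
    intro e j
    simp only [num, Polynomial.eval_prod, Finset.prod_eq_zero_iff, Polynomial.eval_pow,
      Polynomial.eval_add, Polynomial.eval_X, Polynomial.eval_C, pow_eq_zero_iff']
    constructor
    · rintro ⟨j', _, h1, h2⟩
      have : j' = j := by
        have : (j' : K) = j := by linear_combination h1
        exact_mod_cast this
      subst this
      omega
    · intro h1
      exact ⟨j, Finsupp.mem_support_iff.2 h1.ne', by simp, by omega⟩
  have hc : c ≠ 0 := by
    obtain ⟨z, hz⟩ := h.exists
    exact hz ▸ lam_ne_zero e z
  have hval : ∀ᶠ z : ℤ in atTop, (num e).eval (z : K) = lam K e z * (num (-e)).eval (z : K) := by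
    have h1 : ∀ᶠ z : ℤ in atTop, ∀ j ∈ e.support, 0 < z + j := by
      rw [Finset.eventually_all]
      intro j _
      filter_upwards [eventually_gt_atTop (-j)] with z hz
      omega
    filter_upwards [h1] with z hz
    simp only [num, lam, Finsupp.prod, Finsupp.support_neg, Polynomial.eval_prod,
      Polynomial.eval_pow, Polynomial.eval_add, Polynomial.eval_X, Polynomial.eval_C,
      ← Finset.prod_mul_distrib]
    refine Finset.prod_congr rfl fun j hj => ?_
    have h2 : (z + j : K) ≠ 0 := by exact_mod_cast (hz j hj).ne'
    rw [if_neg (hz j hj).ne', Finsupp.neg_apply, ← zpow_natCast, ← zpow_natCast]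
    push_cast
    rw [← zpow_add₀ h2]
    congr 1
    omega
  have hpoly : num e = Polynomial.C c * num (-e) := by
    refine Polynomial.eq_of_infinite_eval_eq _ _ ?_
    obtain ⟨d, hd⟩ := eventually_atTop.1 (h.and hval)
    refine ((Set.Ici_infinite d).image (f := fun z : ℤ => (z : K))
      Int.cast_injective.injOn).mono ?_
    rintro _ ⟨z, hz, rfl⟩
    have := hd z hz
    simp only [Set.mem_setOf_eq, Polynomial.eval_mul, Polynomial.eval_C]
    rw [this.2, this.1]
  ext j
  have h1 := hroot e j
  rw [hpoly, Polynomial.eval_mul, Polynomial.eval_C, mul_eq_zero, or_iff_right hc, hroot,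
    Finsupp.neg_apply] at h1
  simp only [Finsupp.coe_zero, Pi.zero_apply]
  omega

theorem eq_of_lam_eventually_eq {e e' : ℤ →₀ ℤ} {c : K}
    (h : ∀ᶠ z in atTop, lam K e z = c * lam K e' z) : e = e' := by
  refine sub_eq_zero.1 (eq_zero_of_lam_eventually_const (K := K) (c := c) ?_)
  filter_upwards [h] with z hz
  rw [lam_sub, hz, mul_div_cancel_right₀ _ (lam_ne_zero _ _)]

/-- Translating the argument translates the exponents, and a finitely supported function on ℤ
invariant under translation is zero. -/
theorem eq_zero_of_lam_shift {e : ℤ →₀ ℤ} {c : K}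
    (h : ∀ᶠ z in atTop, lam K e (z + 1) = c * lam K e z) : e = 0 := by
  have h1 : e.mapDomain (· + 1) = e := by
    refine eq_of_lam_eventually_eq (K := K) (c := c) ?_
    filter_upwards [h] with z hz
    rw [← lam_shift, hz]
  have h2 : ∀ j, e (j + 1) = e j := fun j => by
    conv_lhs => rw [← h1]
    exact Finsupp.mapDomain_apply (add_left_injective (1 : ℤ)) e j
  obtain ⟨j₀, hj₀⟩ := Infinite.exists_notMem_finset e.support
  have h3 : ∀ m : ℤ, e (j₀ + m) = 0 := by
    intro m
    induction m using Int.induction_on with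
    | zero => simpa using hj₀
    | succ m ih => rw [← add_assoc, h2, ih]
    | pred m ih => rw [← ih, ← h2]; congr 1; ring
  ext j
  have := h3 (j - j₀)
  rwa [add_sub_cancel] at this

end Lam

/-! ### The groups ℋ₁(i) as free abelian groups of exponents -/

section HGroup

variable {K : Type*} [Field K] [CharZero K] {n : ℕ}

theorem jac_inv_diag {v : (Jac K n)ˣ} {α : Fin n → ℤ} {c : K} (hc : c ≠ 0)
    (h : v.1.1 (zm K α) = c • zm K α) : (v⁻¹).1.1 (zm K α) = c⁻¹ • zm K α := by
  have h1 : (v⁻¹).1.1 (v.1.1 (zm K α)) = zm K α := by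
    rw [← jac_mul_apply, Units.inv_mul]; rfl
  rw [h, map_smul] at h1
  rw [← h1, smul_smul, inv_mul_cancel₀ hc, one_smul, h1]

theorem exists_unit_of_diag {a b : Jac K n} {f : (Fin n → ℤ) → K} (hf : ∀ α, 0 ≤ α → f α ≠ 0)
    (ha : ∀ α, 0 ≤ α → a.1 (zm K α) = f α • zm K α)
    (hb : ∀ α, 0 ≤ α → b.1 (zm K α) = (f α)⁻¹ • zm K α) : ∃ v : (Jac K n)ˣ, (v : Jac K n) = a :=
  ⟨⟨a, b, jac_ext fun α h => by
      rw [jac_mul_apply, hb α h, map_smul, ha α h, smul_smul, inv_mul_cancel₀ (hf α h), one_smul]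
      rfl,
    jac_ext fun α h => by
      rw [jac_mul_apply, ha α h, map_smul, hb α h, smul_smul, mul_inv_cancel₀ (hf α h), one_smul]
      rfl⟩, rfl⟩

theorem hEl_add_natCast_zm (i : Fin n) (j : ℕ) (α : Fin n → ℤ) (h : 0 ≤ α) :
    (hEl K i + (j : Jac K n)).1 (zm K α) = lam K (Finsupp.single (j + 1 : ℤ) 1) (α i) • zm K α := by
  rw [jac_add_apply, hEl_zm, jac_natCast_apply, ← add_smul, lam_single, zpow_one]
  have := h i
  simp only [Pi.zero_apply] at this
  rw [if_neg (by omega)]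
  push_cast
  congr 1
  ring

/-- The matrix unit replaces the single vanishing eigenvalue, at αᵢ = j - 1, by 1; this is the
convention built into `lam`. -/
theorem hEl_sub_natCast_zm (i : Fin n) {j : ℕ} (hj : 1 ≤ j) (α : Fin n → ℤ) :
    (hEl K i - (j : Jac K n) + matUnit K i (j - 1) (j - 1)).1 (zm K α) =
      lam K (Finsupp.single (1 - j : ℤ) 1) (α i) • zm K α := by
  rw [jac_add_apply, jac_sub_apply, hEl_zm, jac_natCast_apply, ← sub_smul, lam_single, zpow_one,
    matUnit_zm_self]
  by_cases h : α i = (j - 1 : ℕ)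
  · rw [if_pos h, if_pos (by omega), h, Nat.cast_sub hj]
    simp
  · rw [if_neg h, if_neg (by omega), add_zero]
    push_cast
    congr 1
    ring

theorem exists_unit_hEl_add (i : Fin n) (j : ℕ) :
    ∃ v : (Jac K n)ˣ, (v : Jac K n) = hEl K i + (j : Jac K n) := by
  -- Conjugating Hᵢ⁻¹ by powers of xᵢ and yᵢ raises its argument by `j`.
  refine exists_unit_of_diag (b := yEl K i ^ j * hInvEl K i * xEl K i ^ j)
    (fun _ _ => lam_ne_zero _ _) (hEl_add_natCast_zm i j) fun α h => ?_
  rw [jac_mul_apply, xEl_pow_zm i j h, jac_mul_apply, hInvEl_zm, map_smul, yEl_pow_zm,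
    add_sub_cancel_right, lam_single, zpow_one]
  have := h i
  simp only [Pi.zero_apply] at this
  rw [if_neg (by omega)]
  simp only [Pi.add_apply, Pi.single_eq_same]
  push_cast
  rw [add_assoc]

theorem jac_sum_apply {ι : Type*} (s : Finset ι) (a : ι → Jac K n) (p : MvPolynomial (Fin n) K) :
    (∑ i ∈ s, a i).1 p = ∑ i ∈ s, (a i).1 p := by
  rw [AddSubmonoidClass.coe_finsetSum, LinearMap.sum_apply]

theorem exists_unit_hEl_sub (i : Fin n) {j : ℕ} (hj : 1 ≤ j) :
    ∃ v : (Jac K n)ˣ,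
      (v : Jac K n) = hEl K i - (j : Jac K n) + matUnit K i (j - 1) (j - 1) := by
  -- The first term inverts the operator on exponents αᵢ ≥ j and vanishes on the others, where the
  -- finite sum of matrix units takes over.
  refine exists_unit_of_diag (b := xEl K i ^ j * (hInvEl K i * yEl K i ^ j) +
    ∑ t ∈ Finset.range j, (lam K (Finsupp.single (1 - j : ℤ) 1) t)⁻¹ • matUnit K i t t)
    (fun _ _ => lam_ne_zero _ _) (fun α _ => hEl_sub_natCast_zm i hj α) fun α h => ?_
  have h0 := h i
  simp only [Pi.zero_apply] at h0
  obtain ⟨a, ha⟩ := Int.eq_ofNat_of_zero_le h0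
  rw [jac_add_apply, jac_sum_apply, jac_mul_apply, jac_mul_apply, yEl_pow_zm, hInvEl_zm, map_smul]
  have hs : ∀ t ∈ Finset.range j, ((lam K (Finsupp.single (1 - j : ℤ) 1) t)⁻¹ •
      matUnit K i t t).1 (zm K α) = if t = a then
        (lam K (Finsupp.single (1 - j : ℤ) 1) (α i))⁻¹ • zm K α else 0 := by
    intro t _
    rw [jac_smul_apply, matUnit_zm_self]
    by_cases hta : t = a
    · subst hta; rw [if_pos ha, if_pos rfl, ha]
    · rw [if_neg (by omega), if_neg hta, smul_zero]
  rw [Finset.sum_congr rfl hs, Finset.sum_ite_eq']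
  by_cases hja : a < j
  · have hneg : zm K (α - Pi.single i (j : ℤ)) = 0 := zm_of_neg K (i := i) (by simp; omega)
    rw [hneg, map_zero, smul_zero, zero_add, if_pos (Finset.mem_range.2 hja)]
  · rw [if_neg (by simpa using hja), add_zero, xEl_pow_zm, sub_add_cancel, lam_single, zpow_one,
      if_neg (by omega)]
    · simp only [Pi.sub_apply, Pi.single_eq_same]
      push_cast
      congr 2
      ring
    · intro k
      have := h k
      by_cases hk : k = i
      · subst hk; simp; omega
      · simpa [hk] using this

theorem exists_hGroup_exponent {i : Fin n} {v : (Jac K n)ˣ} (hv : v ∈ hGroup K i) :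
    ∃ e : ℤ →₀ ℤ, ∀ α, 0 ≤ α → v.1.1 (zm K α) = lam K e (α i) • zm K α := by
  induction hv using Subgroup.closure_induction with
  | mem v hv =>
    rcases hv with ⟨j, hj⟩ | ⟨j, h1, hj⟩
    · exact ⟨_, fun α h => by rw [hj, hEl_add_natCast_zm i j α h]⟩
    · exact ⟨_, fun α h => by rw [hj, hEl_sub_natCast_zm i h1 α]⟩
  | one => exact ⟨0, fun α _ => by simp⟩
  | mul v w _ _ hv hw =>
    obtain ⟨e, he⟩ := hv
    obtain ⟨f, hf⟩ := hw
    refine ⟨e + f, fun α h => ?_⟩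
    rw [Units.val_mul, jac_mul_apply, hf α h, map_smul, he α h, lam_add, smul_smul, mul_comm]
  | inv v _ hv =>
    obtain ⟨e, he⟩ := hv
    exact ⟨-e, fun α h => by rw [lam_neg, jac_inv_diag (lam_ne_zero _ _) (he α h)]⟩

/-- The generators Hᵢ + m give the linear forms z + j with j = m + 1 ≥ 1, and the generators built
from Hᵢ - m give those with j = 1 - m ≤ 0. Together they cover every integer j once. -/
theorem exists_hGroup_of_exponent (i : Fin n) (e : ℤ →₀ ℤ) :
    ∃ v ∈ hGroup K i, ∀ α, 0 ≤ α → v.1.1 (zm K α) = lam K e (α i) • zm K α := by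
  have hmul : ∀ {e f : ℤ →₀ ℤ},
      (∃ v ∈ hGroup K i, ∀ α, 0 ≤ α → v.1.1 (zm K α) = lam K e (α i) • zm K α) →
      (∃ v ∈ hGroup K i, ∀ α, 0 ≤ α → v.1.1 (zm K α) = lam K f (α i) • zm K α) →
      ∃ v ∈ hGroup K i, ∀ α, 0 ≤ α → v.1.1 (zm K α) = lam K (e + f) (α i) • zm K α := by
    rintro e f ⟨v, hv, he⟩ ⟨w, hw, hf⟩
    refine ⟨v * w, mul_mem hv hw, fun α h => ?_⟩
    rw [Units.val_mul, jac_mul_apply, hf α h, map_smul, he α h, lam_add, smul_smul, mul_comm]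
  have hinv : ∀ {e : ℤ →₀ ℤ},
      (∃ v ∈ hGroup K i, ∀ α, 0 ≤ α → v.1.1 (zm K α) = lam K e (α i) • zm K α) →
      ∃ v ∈ hGroup K i, ∀ α, 0 ≤ α → v.1.1 (zm K α) = lam K (-e) (α i) • zm K α := by
    rintro e ⟨v, hv, he⟩
    exact ⟨v⁻¹, inv_mem hv, fun α h => by
      rw [lam_neg, jac_inv_diag (lam_ne_zero _ _) (he α h)]⟩
  have hzero : ∃ v ∈ hGroup K i, ∀ α, 0 ≤ α → v.1.1 (zm K α) = lam K 0 (α i) • zm K α :=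
    ⟨1, one_mem _, fun α _ => by simp⟩
  have hgen : ∀ j : ℤ, ∃ v ∈ hGroup K i, ∀ α, 0 ≤ α →
      v.1.1 (zm K α) = lam K (Finsupp.single j 1) (α i) • zm K α := by
    intro j
    rcases le_or_gt j 0 with hj | hj
    · obtain ⟨m, rfl⟩ : ∃ m : ℕ, j = 1 - m := ⟨(1 - j).toNat, by omega⟩
      have hm : 1 ≤ m := by omega
      obtain ⟨v, hv⟩ := exists_unit_hEl_sub (K := K) i hm
      exact ⟨v, Subgroup.subset_closure (Or.inr ⟨m, hm, hv⟩), fun α _ => by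
        rw [hv, hEl_sub_natCast_zm i hm]⟩
    · obtain ⟨m, rfl⟩ : ∃ m : ℕ, j = m + 1 := ⟨(j - 1).toNat, by omega⟩
      obtain ⟨v, hv⟩ := exists_unit_hEl_add (K := K) i m
      exact ⟨v, Subgroup.subset_closure (Or.inl ⟨m, hv⟩), fun α h => by
        rw [hv, hEl_add_natCast_zm i m α h]⟩
  induction e using Finsupp.induction_linear with
  | zero => exact hzero
  | add e f he hf => exact hmul he hf
  | single j k =>
    induction k using Int.induction_on with
    | zero => simpa using hzero
    | succ k ih => rw [Finsupp.single_add]; exact hmul ih (hgen j)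
    | pred k ih =>
      have : Finsupp.single j (-k - 1 : ℤ) = Finsupp.single j (-k : ℤ) + -Finsupp.single j 1 := by
        rw [sub_eq_add_neg, Finsupp.single_add, Finsupp.single_neg j (1 : ℤ)]
      rw [this]
      exact hmul ih (hinv (hgen j))

theorem eq_of_lam_eq {e e' : ℤ →₀ ℤ} {i : Fin n} {a : Jac K n}
    (h : ∀ α, 0 ≤ α → a.1 (zm K α) = lam K e (α i) • zm K α)
    (h' : ∀ α, 0 ≤ α → a.1 (zm K α) = lam K e' (α i) • zm K α) : e = e' := by
  refine eq_of_lam_eventually_eq (K := K) (c := 1) ?_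
  refine eventually_of_eventually_apply (i := i) ?_
  filter_upwards [eventually_nonneg] with α hα
  have := (h α hα).symm.trans (h' α hα)
  rw [one_mul]
  exact smul_left_injective K (zm_ne_zero K hα) this

/-- The exponents of an element of `ℋ₁(i)`. -/
def hExp {i : Fin n} (v : hGroup K i) : ℤ →₀ ℤ := (exists_hGroup_exponent v.2).choose

theorem hGroup_zm {i : Fin n} (v : hGroup K i) {α : Fin n → ℤ} (h : 0 ≤ α) :
    v.1.1.1 (zm K α) = lam K (hExp v) (α i) • zm K α :=
  (exists_hGroup_exponent v.2).choose_spec α h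

theorem hExp_eq {i : Fin n} {v : hGroup K i} {e : ℤ →₀ ℤ}
    (h : ∀ α, 0 ≤ α → v.1.1.1 (zm K α) = lam K e (α i) • zm K α) : hExp v = e :=
  eq_of_lam_eq (fun _ hα => hGroup_zm v hα) h

theorem hExp_one (i : Fin n) : hExp (1 : hGroup K i) = 0 :=
  hExp_eq fun α _ => by simp

theorem hExp_mul {i : Fin n} (v w : hGroup K i) : hExp (v * w) = hExp v + hExp w :=
  hExp_eq fun α h => by
    rw [Subgroup.coe_mul, Units.val_mul, jac_mul_apply, hGroup_zm w h, map_smul, hGroup_zm v h,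
      lam_add, smul_smul, mul_comm]

theorem hExp_injective (i : Fin n) : Function.Injective (hExp : hGroup K i → _) := by
  intro v w h
  refine Subtype.ext (Units.ext (jac_ext fun α hα => ?_))
  rw [hGroup_zm v hα, hGroup_zm w hα, h]

theorem exists_hExp_eq (i : Fin n) (e : ℤ →₀ ℤ) : ∃ v : hGroup K i, hExp v = e := by
  obtain ⟨v, hv, h⟩ := exists_hGroup_of_exponent (K := K) i e
  exact ⟨⟨v, hv⟩, hExp_eq h⟩

theorem hGroup_inv_zm {i : Fin n} (v : hGroup K i) {α : Fin n → ℤ} (h : 0 ≤ α) :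
    (v.1⁻¹).1.1 (zm K α) = (lam K (hExp v) (α i))⁻¹ • zm K α :=
  jac_inv_diag (lam_ne_zero _ _) (hGroup_zm v h)

end HGroup

/-! ### Automorphisms of 𝔸ₙ as conjugations by linear automorphisms of Pₙ -/

section Intertwiner

variable {K : Type*} [Field K] {n : ℕ}

/-- The linear automorphism `φ` of the polynomial algebra induces the automorphism `σ` of `𝔸ₙ`
by conjugation. -/
def Intertwines (φ : MvPolynomial (Fin n) K ≃ₗ[K] MvPolynomial (Fin n) K) (σ : JacAut K n) :
    Prop :=
  ∀ (a : Jac K n) (p : MvPolynomial (Fin n) K), φ (a.1 p) = (σ a).1 (φ p)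

variable {φ ψ : MvPolynomial (Fin n) K ≃ₗ[K] MvPolynomial (Fin n) K} {σ τ : JacAut K n}

theorem Intertwines.apply_eq (h : Intertwines φ σ) {a b : Jac K n}
    (hab : ∀ α : Fin n → ℤ, 0 ≤ α → φ (a.1 (zm K α)) = b.1 (φ (zm K α))) : σ a = b := by
  have h1 : φ.toLinearMap ∘ₗ a.1 = b.1 ∘ₗ φ.toLinearMap := linearMap_ext_zm hab
  refine Subtype.ext (LinearMap.ext fun p => ?_)
  obtain ⟨q, rfl⟩ := φ.surjective p
  rw [← h a q]
  exact LinearMap.congr_fun h1 q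

theorem Intertwines.unique (h : Intertwines φ σ) (h' : Intertwines φ τ) : σ = τ :=
  AlgEquiv.ext fun a => h.apply_eq fun α _ => h' a _

theorem Intertwines.mul (h : Intertwines φ σ) (h' : Intertwines ψ τ) :
    Intertwines (φ * ψ) (σ * τ) := fun a p => by
  rw [LinearEquiv.mul_apply, h' a p, h, LinearEquiv.mul_apply, AlgEquiv.mul_apply]

theorem Intertwines.symm (h : Intertwines φ σ) : Intertwines φ.symm σ.symm := fun a p => by
  apply φ.injective
  rw [LinearEquiv.apply_symm_apply, h, AlgEquiv.apply_symm_apply, LinearEquiv.apply_symm_apply]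

/-- Conjugation by φ and by its inverse must both map 𝔸ₙ into itself. The operators whose conjugate
lies in 𝔸ₙ form a subalgebra, so generators suffice. -/
theorem exists_intertwines_of_generators
    (hx : ∀ i, ∃ b : Jac K n, ∀ α, 0 ≤ α → φ ((xEl K i).1 (zm K α)) = b.1 (φ (zm K α)))
    (hd : ∀ i, ∃ b : Jac K n, ∀ α, 0 ≤ α → φ ((dEl K i).1 (zm K α)) = b.1 (φ (zm K α)))
    (hh : ∀ i, ∃ b : Jac K n, ∀ α, 0 ≤ α → φ ((hInvEl K i).1 (zm K α)) = b.1 (φ (zm K α)))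
    (hx' : ∀ i, ∃ b : Jac K n, ∀ α, 0 ≤ α → φ.symm ((xEl K i).1 (zm K α)) = b.1 (φ.symm (zm K α)))
    (hd' : ∀ i, ∃ b : Jac K n, ∀ α, 0 ≤ α → φ.symm ((dEl K i).1 (zm K α)) = b.1 (φ.symm (zm K α)))
    (hh' : ∀ i, ∃ b : Jac K n, ∀ α, 0 ≤ α →
      φ.symm ((hInvEl K i).1 (zm K α)) = b.1 (φ.symm (zm K α))) :
    ∃ σ : JacAut K n, Intertwines φ σ := by
  have key : ∀ φ : MvPolynomial (Fin n) K ≃ₗ[K] MvPolynomial (Fin n) K,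
      (∀ i, ∃ b : Jac K n, ∀ α, 0 ≤ α → φ ((xEl K i).1 (zm K α)) = b.1 (φ (zm K α))) →
      (∀ i, ∃ b : Jac K n, ∀ α, 0 ≤ α → φ ((dEl K i).1 (zm K α)) = b.1 (φ (zm K α))) →
      (∀ i, ∃ b : Jac K n, ∀ α, 0 ≤ α → φ ((hInvEl K i).1 (zm K α)) = b.1 (φ (zm K α))) →
      ∀ a : Jac K n, ∃ b : Jac K n, ∀ p, φ (a.1 p) = b.1 (φ p) := by
    intro φ hx hd hh a
    have ext : ∀ {a b : Jac K n}, (∀ α, 0 ≤ α → φ (a.1 (zm K α)) = b.1 (φ (zm K α))) →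
        ∀ p, φ (a.1 p) = b.1 (φ p) := fun {a b} h p => by
      have h1 : φ.toLinearMap ∘ₗ a.1 = b.1 ∘ₗ φ.toLinearMap := linearMap_ext_zm h
      exact LinearMap.congr_fun h1 p
    induction a using jac_induction with
    | hx i => obtain ⟨b, hb⟩ := hx i; exact ⟨b, ext hb⟩
    | hd i => obtain ⟨b, hb⟩ := hd i; exact ⟨b, ext hb⟩
    | hh i => obtain ⟨b, hb⟩ := hh i; exact ⟨b, ext hb⟩
    | hc c => exact ⟨algebraMap K _ c, fun p => by simp [jac_algebraMap_apply]⟩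
    | hadd a b ha hb =>
      obtain ⟨a', ha⟩ := ha
      obtain ⟨b', hb⟩ := hb
      exact ⟨a' + b', fun p => by rw [jac_add_apply, map_add, ha, hb, jac_add_apply]⟩
    | hmul a b ha hb =>
      obtain ⟨a', ha⟩ := ha
      obtain ⟨b', hb⟩ := hb
      exact ⟨a' * b', fun p => by rw [jac_mul_apply, ha, hb, jac_mul_apply]⟩
  choose F hF using key φ hx hd hh
  choose G hG using key φ.symm hx' hd' hh'
  have hFu : ∀ {a b : Jac K n}, (∀ p, φ (a.1 p) = b.1 (φ p)) → F a = b := fun {a b} h => by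
    refine Subtype.ext (LinearMap.ext fun p => ?_)
    obtain ⟨q, rfl⟩ := φ.surjective p
    rw [← hF a q, h q]
  have hGF : ∀ a, G (F a) = a := fun a => by
    refine Subtype.ext (LinearMap.ext fun p => ?_)
    have := hG (F a) (φ p)
    rw [LinearEquiv.symm_apply_apply] at this
    rw [← this, ← hF, LinearEquiv.symm_apply_apply]
  have hFG : ∀ a, F (G a) = a := fun a => hFu fun p => by
    have := hG a (φ p)
    rw [LinearEquiv.symm_apply_apply] at this
    rw [← this, LinearEquiv.apply_symm_apply]
  refine ⟨{ toFun := F, invFun := G, left_inv := hGF, right_inv := hFG, map_mul' := ?_,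
            map_add' := ?_, commutes' := ?_ }, hF⟩
  · exact fun a b => hFu fun p => by rw [jac_mul_apply, hF, hF, jac_mul_apply]
  · exact fun a b => hFu fun p => by rw [jac_add_apply, map_add, hF, hF, jac_add_apply]
  · exact fun c => hFu fun p => by rw [jac_algebraMap_apply, map_smul, jac_algebraMap_apply]

/-- A linear automorphism intertwines at most one automorphism of 𝔸ₙ, so the chosen ones are
automatically multiplicative. -/
theorem exists_monoidHom_intertwines {G : Type*} [Group G]
    (Φ : G →* (MvPolynomial (Fin n) K ≃ₗ[K] MvPolynomial (Fin n) K))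
    (h : ∀ g, ∃ σ : JacAut K n, Intertwines (Φ g) σ) :
    ∃ F : G →* JacAut K n, ∀ g, Intertwines (Φ g) (F g) := by
  choose F hF using h
  exact ⟨MonoidHom.mk' F fun g g' => (hF (g * g')).unique (by
    rw [map_mul]; exact (hF g).mul (hF g')), hF⟩

variable [CharZero K]

/-- The projection onto the constants along the other monomials. -/
theorem exists_constant_projection : ∃ e : Jac K n, ∀ α : Fin n → ℤ,
    e.1 (zm K α) = if α = 0 then zm K α else 0 := by
  have key : ∀ s : Finset (Fin n), ∃ e : Jac K n, ∀ α : Fin n → ℤ,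
      e.1 (zm K α) = if ∀ i ∈ s, α i = 0 then zm K α else 0 := by
    intro s
    classical
    induction s using Finset.induction_on with
    | empty => exact ⟨1, fun α => by simp⟩
    | insert i s _ ih =>
      obtain ⟨e, he⟩ := ih
      refine ⟨e * matUnit K i 0 0, fun α => ?_⟩
      rw [jac_mul_apply, matUnit_zm_self]
      by_cases h : α i = 0
      · rw [if_pos (by simpa using h), he]
        simp [h]
      · rw [if_neg (by simpa using h)]
        simp [h]
  obtain ⟨e, he⟩ := key Finset.univ
  refine ⟨e, fun α => ?_⟩
  rw [he]
  simp [funext_iff]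

/-- This is simplicity of Pₙ as an 𝔸ₙ-module: for β in the support, y^β moves x^β to 1, and the
projection onto constants kills the images of all other monomials. -/
theorem exists_apply_eq_one {p : MvPolynomial (Fin n) K} (hp : p ≠ 0) :
    ∃ a : Jac K n, a.1 p = 1 := by
  obtain ⟨e, he⟩ := exists_constant_projection (K := K) (n := n)
  obtain ⟨β, hβ⟩ := MvPolynomial.ne_zero_iff.1 hp
  have hy : ∀ γ : Fin n →₀ ℕ, ∃ y : Jac K n, ∀ α, y.1 (zm K α) = zm K (α - intExp γ) := by
    intro γ
    induction γ using Finsupp.induction_linear with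
    | zero =>
      refine ⟨1, fun α => ?_⟩
      have : intExp (0 : Fin n →₀ ℕ) = 0 := by ext; simp
      rw [this, sub_zero]; rfl
    | add f g hf hg =>
      obtain ⟨a, ha⟩ := hf
      obtain ⟨b, hb⟩ := hg
      refine ⟨b * a, fun α => ?_⟩
      rw [jac_mul_apply, ha, hb, sub_sub]
      congr 2
    | single i m =>
      refine ⟨yEl K i ^ m, fun α => ?_⟩
      rw [yEl_pow_zm]
      congr 2
      ext j
      by_cases h : j = i
      · subst h; simp
      · simp [h, Ne.symm h]
  obtain ⟨y, hy⟩ := hy β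
  have hval : e.1 (y.1 p) = p.coeff β • (1 : MvPolynomial (Fin n) K) := by
    calc e.1 (y.1 p) = e.1 (y.1 (∑ γ ∈ p.support, p.coeff γ • zm K (intExp γ))) := by
          rw [← eq_sum_zm p]
      _ = ∑ γ ∈ p.support, p.coeff γ • e.1 (zm K (intExp γ - intExp β)) := by
          simp only [map_sum, map_smul, hy]
      _ = _ := by
          rw [Finset.sum_eq_single β]
          · rw [sub_self, he, if_pos rfl, zm_zero]
          · intro γ _ hγ
            rw [he, if_neg, smul_zero]
            rw [sub_eq_zero]
            intro h
            exact hγ (by rw [← natExp_intExp γ, h, natExp_intExp])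
          · intro h
            exact absurd (MvPolynomial.mem_support_iff.2 hβ) h
  refine ⟨(p.coeff β)⁻¹ • (e * y), ?_⟩
  rw [jac_smul_apply, jac_mul_apply, hval, smul_smul, inv_mul_cancel₀ hβ, one_smul]

/-- Every automorphism of `𝔸ₙ` is induced by a linear automorphism of the polynomial algebra. -/
theorem exists_intertwines (σ : JacAut K n) :
    ∃ φ : MvPolynomial (Fin n) K ≃ₗ[K] MvPolynomial (Fin n) K, Intertwines φ σ := by
  obtain ⟨e, he⟩ := exists_constant_projection (K := K) (n := n)
  have he1 : e.1 1 = 1 := by rw [← zm_zero, he, if_pos rfl]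
  have hee : e * e = e := jac_ext fun α _ => by
    rw [jac_mul_apply, he]
    split_ifs with h
    · rw [he, if_pos h]
    · rw [map_zero]
  have he0 : σ e ≠ 0 := by
    intro h
    have : e = 0 := σ.injective (by rw [h, map_zero])
    rw [this] at he1
    exact zero_ne_one he1
  -- Any nonzero value of the nonzero idempotent σ(e) is fixed by it.
  obtain ⟨v, hv, hev⟩ : ∃ v, v ≠ 0 ∧ (σ e).1 v = v := by
    by_contra! h
    refine he0 (Subtype.ext (LinearMap.ext fun p => ?_))
    by_contra h'
    refine h _ h' ?_
    rw [← jac_mul_apply, ← map_mul, hee]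
  -- The map p ↦ p·e is 𝔸ₙ-linear from Pₙ into the left ideal 𝔸ₙe. This makes p ↦ σ(p)v, which
  -- equals σ(p·e)v, an intertwiner.
  have hmul : ∀ (a : Jac K n) (p : MvPolynomial (Fin n) K),
      a * (mulEl K p * e) = mulEl K (a.1 p) * e := fun a p => jac_ext fun α _ => by
    rw [jac_mul_apply, jac_mul_apply, jac_mul_apply, he]
    split_ifs with h
    · rw [h, zm_zero, mulEl_apply, mulEl_apply, mul_one, mul_one]
    · rw [map_zero, map_zero, map_zero]
  let f : MvPolynomial (Fin n) K →ₗ[K] MvPolynomial (Fin n) K :=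
    { toFun := fun p => (σ (mulEl K p)).1 v
      map_add' := fun p q => by rw [map_add, map_add, jac_add_apply]
      map_smul' := fun c p => by rw [map_smul, map_smul, jac_smul_apply]; rfl }
  have hf : ∀ p, f p = (σ (mulEl K p * e)).1 v := fun p => by
    rw [map_mul, jac_mul_apply, hev]; rfl
  have hfa : ∀ (a : Jac K n) p, f (a.1 p) = (σ a).1 (f p) := fun a p => by
    rw [hf, ← hmul, map_mul, jac_mul_apply, ← hf]
  have hf1 : f 1 = v := by
    change (σ (mulEl K 1)).1 v = v
    rw [map_one, map_one]; rfl
  have hinj : Function.Injective f := by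
    rw [← LinearMap.ker_eq_bot, LinearMap.ker_eq_bot']
    intro p hp
    by_contra h
    obtain ⟨a, ha⟩ := exists_apply_eq_one h
    apply hv
    rw [← hf1, ← ha, hfa, hp, map_zero]
  have hsurj : Function.Surjective f := by
    obtain ⟨a, ha⟩ := exists_apply_eq_one hv
    intro q
    refine ⟨(σ.symm (mulEl K q * a)).1 1, ?_⟩
    rw [hfa, hf1, AlgEquiv.apply_symm_apply, jac_mul_apply, ha, mulEl_apply, mul_one]
  exact ⟨LinearEquiv.ofBijective f ⟨hinj, hsurj⟩, hfa⟩

end Intertwiner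

/-! ### Diagonal operators with prescribed successive ratios -/

section Diagonal

variable {K : Type*} [Field K] {n : ℕ}

/-- The diagonal operator with entries `c` in the monomial basis. -/
def diagMap (c : (Fin n →₀ ℕ) → Kˣ) : Module.End K (MvPolynomial (Fin n) K) :=
  (MvPolynomial.basisMonomials (Fin n) K).constr K fun β => MvPolynomial.monomial β (c β : K)

theorem diagMap_zm (c : (Fin n →₀ ℕ) → Kˣ) (α : Fin n → ℤ) :
    diagMap c (zm K α) = (c (natExp α) : K) • zm K α := by
  by_cases h : 0 ≤ α
  · rw [zm_of_nonneg K h]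
    have : MvPolynomial.monomial (natExp α) (1 : K) =
      MvPolynomial.basisMonomials (Fin n) K (natExp α) := rfl
    rw [this, diagMap, Module.Basis.constr_basis, ← this, MvPolynomial.smul_monomial, smul_eq_mul,
      mul_one]
  · rw [zm_of_not_nonneg K h, map_zero, smul_zero]

theorem diagMap_mul (c d : (Fin n →₀ ℕ) → Kˣ) : diagMap (c * d) = diagMap c * diagMap d :=
  linearMap_ext_zm fun α _ => by
    rw [Module.End.mul_apply, diagMap_zm, diagMap_zm, map_smul, diagMap_zm, smul_smul,
      Pi.mul_apply, Units.val_mul, mul_comm]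

theorem diagMap_one : diagMap (1 : (Fin n →₀ ℕ) → Kˣ) = 1 :=
  linearMap_ext_zm fun α _ => by
    rw [diagMap_zm, Pi.one_apply, Units.val_one, one_smul]; rfl

/-- The diagonal operator with entries `c` as a linear automorphism. -/
def diagEquiv (c : (Fin n →₀ ℕ) → Kˣ) :
    MvPolynomial (Fin n) K ≃ₗ[K] MvPolynomial (Fin n) K :=
  LinearEquiv.ofLinear (diagMap c) (diagMap c⁻¹)
    (by rw [← Module.End.mul_eq_comp, ← diagMap_mul, mul_inv_cancel, diagMap_one]; rfl)
    (by rw [← Module.End.mul_eq_comp, ← diagMap_mul, inv_mul_cancel, diagMap_one]; rfl)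

theorem diagEquiv_zm (c : (Fin n →₀ ℕ) → Kˣ) (α : Fin n → ℤ) :
    diagEquiv c (zm K α) = (c (natExp α) : K) • zm K α := diagMap_zm c α

theorem diagEquiv_symm_zm (c : (Fin n →₀ ℕ) → Kˣ) (α : Fin n → ℤ) :
    (diagEquiv c).symm (zm K α) = ((c (natExp α) : K))⁻¹ • zm K α :=
  (diagMap_zm c⁻¹ α).trans (by simp)

theorem diagEquiv_mul (c d : (Fin n →₀ ℕ) → Kˣ) :
    diagEquiv (c * d) = diagEquiv c * diagEquiv d :=
  LinearEquiv.toLinearMap_injective (diagMap_mul c d)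

/-- The diagonal operators `x^α ↦ ∏ᵢ ∏_{j < αᵢ} r i j x^α`. -/
def rampHom : (Fin n → ℕ → Kˣ) →* (MvPolynomial (Fin n) K ≃ₗ[K] MvPolynomial (Fin n) K) :=
  MonoidHom.mk' (fun r => diagEquiv fun β => ∏ i, ∏ j ∈ Finset.range (β i), r i j) fun r s => by
    rw [← diagEquiv_mul]
    congr 1
    ext β
    simp [Finset.prod_mul_distrib]

/-- The entries of `rampHom r`. -/
def ramp (r : Fin n → ℕ → Kˣ) (α : Fin n → ℤ) : K :=
  ((∏ i, ∏ j ∈ Finset.range (natExp α i), r i j : Kˣ) : K)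

theorem rampHom_zm (r : Fin n → ℕ → Kˣ) (α : Fin n → ℤ) :
    rampHom r (zm K α) = ramp r α • zm K α := diagEquiv_zm _ α

theorem rampHom_symm_zm (r : Fin n → ℕ → Kˣ) (α : Fin n → ℤ) :
    (rampHom r).symm (zm K α) = (ramp r α)⁻¹ • zm K α := diagEquiv_symm_zm _ α

theorem ramp_ne_zero (r : Fin n → ℕ → Kˣ) (α : Fin n → ℤ) : ramp r α ≠ 0 := Units.ne_zero _

theorem ramp_add_single (r : Fin n → ℕ → Kˣ) {α : Fin n → ℤ} (h : 0 ≤ α) (i : Fin n) :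
    ramp r (α + Pi.single i 1) = ramp r α * (r i (α i).toNat : K) := by
  rw [ramp, ramp, ← Units.val_mul]
  congr 1
  have : ∀ k, ∏ j ∈ Finset.range (natExp (α + Pi.single i 1) k), r k j =
      (∏ j ∈ Finset.range (natExp α k), r k j) * if k = i then r i (α i).toNat else 1 := by
    intro k
    by_cases hk : k = i
    · subst hk
      have h1 : natExp (α + Pi.single k 1) k = natExp α k + 1 := by
        have := h k
        simp only [Pi.zero_apply] at this
        simp only [natExp_apply, Pi.add_apply, Pi.single_eq_same]
        omega
      rw [h1, Finset.prod_range_succ, if_pos rfl, natExp_apply]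
    · rw [if_neg hk, mul_one]
      simp [hk]
  rw [Finset.prod_congr rfl fun k _ => this k, Finset.prod_mul_distrib, Finset.prod_ite_eq']
  simp

theorem eq_add_single_or (i : Fin n) {α : Fin n → ℤ} (h : 0 ≤ α) :
    (∃ β : Fin n → ℤ, 0 ≤ β ∧ α = β + Pi.single i 1) ∨ α i = 0 := by
  rcases (h i).eq_or_lt with h0 | h0
  · exact Or.inr h0.symm
  · exact Or.inl ⟨_, nonneg_sub_single h h0, by simp⟩

theorem zm_sub_single_eq_zero {i : Fin n} {α : Fin n → ℤ} (h : α i = 0) :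
    zm K (α - Pi.single i 1) = 0 := zm_of_neg K (i := i) (by simp [h])

variable [CharZero K]

/-- The ratio of the entries at α + eᵢ and α is r i αᵢ. Conjugation thus sends xᵢ to xᵢRᵢ and ∂ᵢ to
HᵢRᵢ⁻¹yᵢ and fixes Hᵢ, and it stays in 𝔸ₙ once the ratios are the eigenvalues of units Rᵢ of 𝔸ₙ. The
inverse diagonal operator replaces Rᵢ by Rᵢ⁻¹. -/
theorem exists_intertwines_rampHom (r : Fin n → ℕ → Kˣ) (R : Fin n → (Jac K n)ˣ)
    (hR : ∀ i α, 0 ≤ α → (R i).1.1 (zm K α) = (r i (α i).toNat : K) • zm K α) :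
    ∃ σ : JacAut K n, Intertwines (rampHom r) σ := by
  have hR' : ∀ i α, 0 ≤ α →
      ((R i)⁻¹).1.1 (zm K α) = (r i (α i).toNat : K)⁻¹ • zm K α := fun i α h =>
    jac_inv_diag (Units.ne_zero _) (hR i α h)
  refine exists_intertwines_of_generators ?_ ?_ ?_ ?_ ?_ ?_ <;> intro i
  · refine ⟨xEl K i * (R i : Jac K n), fun α h => ?_⟩
    rw [xEl_zm i h, rampHom_zm, rampHom_zm, map_smul, jac_mul_apply, hR i α h, map_smul, xEl_zm i h,
      smul_smul, ramp_add_single r h]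
  · refine ⟨hEl K i * (((R i)⁻¹ : (Jac K n)ˣ) : Jac K n) * yEl K i, fun α h => ?_⟩
    rw [dEl_zm, rampHom_zm, map_smul, rampHom_zm, map_smul, jac_mul_apply, yEl_zm, jac_mul_apply]
    rcases eq_add_single_or i h with ⟨β, hβ, rfl⟩ | h0
    · rw [add_sub_cancel_right, hR' i β hβ, map_smul, hEl_zm, ramp_add_single r hβ, smul_smul,
        smul_smul, smul_smul]
      congr 1
      have := Units.ne_zero (r i (β i).toNat)
      field_simp
      simp [mul_comm]
    · simp [zm_sub_single_eq_zero h0]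
  · refine ⟨hInvEl K i, fun α h => ?_⟩
    rw [hInvEl_zm, map_smul, rampHom_zm, map_smul, hInvEl_zm, smul_comm]
  · refine ⟨xEl K i * (((R i)⁻¹ : (Jac K n)ˣ) : Jac K n), fun α h => ?_⟩
    rw [xEl_zm i h, rampHom_symm_zm, rampHom_symm_zm, map_smul, jac_mul_apply, hR' i α h, map_smul,
      xEl_zm i h, smul_smul, ramp_add_single r h, mul_inv]
  · refine ⟨hEl K i * (R i : Jac K n) * yEl K i, fun α h => ?_⟩
    rw [dEl_zm, rampHom_symm_zm, map_smul, rampHom_symm_zm, map_smul, jac_mul_apply, yEl_zm,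
      jac_mul_apply]
    rcases eq_add_single_or i h with ⟨β, hβ, rfl⟩ | h0
    · rw [add_sub_cancel_right, hR i β hβ, map_smul, hEl_zm, ramp_add_single r hβ, smul_smul,
        smul_smul, smul_smul]
      congr 1
      have := Units.ne_zero (r i (β i).toNat)
      have := ramp_ne_zero r β
      field_simp
      simp
    · simp [zm_sub_single_eq_zero h0]
  · refine ⟨hInvEl K i, fun α h => ?_⟩
    rw [hInvEl_zm, map_smul, rampHom_symm_zm, map_smul, hInvEl_zm, smul_comm]

end Diagonal

/-! ### Construction of Sₙ, 𝕋ⁿ and 𝕌ₙ -/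

section Actions

variable {K : Type*} [Field K] [CharZero K] {n : ℕ}

theorem zm_comp_perm (τ : Equiv.Perm (Fin n)) (α : Fin n → ℤ) :
    MvPolynomial.rename τ (zm K α) = zm K (α ∘ τ.symm) := by
  by_cases h : 0 ≤ α
  · have h' : 0 ≤ α ∘ τ.symm := fun i => h _
    rw [zm_of_nonneg K h, zm_of_nonneg K h', MvPolynomial.rename_monomial]
    have : Finsupp.mapDomain τ (natExp α) = natExp (α ∘ τ.symm) := by
      ext i
      conv_lhs => rw [← τ.apply_symm_apply i]
      rw [Finsupp.mapDomain_apply τ.injective]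
      simp
    rw [this]
  · have h' : ¬ 0 ≤ α ∘ τ.symm := fun h' => h fun i => by simpa using h' (τ i)
    rw [zm_of_not_nonneg K h, zm_of_not_nonneg K h', map_zero]

theorem single_comp_symm (τ : Equiv.Perm (Fin n)) (i : Fin n) :
    (Pi.single i 1 : Fin n → ℤ) ∘ τ.symm = Pi.single (τ i) 1 := by
  ext j
  by_cases h : j = τ i
  · subst h; simp
  · have : τ.symm j ≠ i := fun h' => h (by rw [← h', τ.apply_symm_apply])
    simp [h, this]

variable (K n) in
/-- The symmetric group acting on the polynomial algebra. -/
def permHom : Equiv.Perm (Fin n) →* (MvPolynomial (Fin n) K ≃ₗ[K] MvPolynomial (Fin n) K) :=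
  MonoidHom.mk' (fun τ => (MvPolynomial.renameEquiv K τ).toLinearEquiv) fun τ τ' =>
    LinearEquiv.ext fun p => (MvPolynomial.rename_rename τ' τ p).symm

theorem permHom_zm (τ : Equiv.Perm (Fin n)) (α : Fin n → ℤ) :
    permHom K n τ (zm K α) = zm K (α ∘ τ.symm) := zm_comp_perm τ α

theorem permHom_symm (τ : Equiv.Perm (Fin n)) : (permHom K n τ).symm = permHom K n τ⁻¹ := by
  rw [map_inv]; rfl

theorem permHom_xEl (τ : Equiv.Perm (Fin n)) (i : Fin n) (α : Fin n → ℤ) (h : 0 ≤ α) :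
    permHom K n τ ((xEl K i).1 (zm K α)) = (xEl K (τ i)).1 (permHom K n τ (zm K α)) := by
  have h' : 0 ≤ α ∘ τ.symm := fun i => h _
  rw [xEl_zm i h, permHom_zm, permHom_zm, xEl_zm _ h', Pi.add_comp, single_comp_symm]

theorem permHom_yEl (τ : Equiv.Perm (Fin n)) (i : Fin n) (α : Fin n → ℤ) :
    permHom K n τ ((yEl K i).1 (zm K α)) = (yEl K (τ i)).1 (permHom K n τ (zm K α)) := by
  rw [yEl_zm i, permHom_zm, permHom_zm, yEl_zm, Pi.sub_comp, single_comp_symm]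

theorem permHom_dEl (τ : Equiv.Perm (Fin n)) (i : Fin n) (α : Fin n → ℤ) :
    permHom K n τ ((dEl K i).1 (zm K α)) = (dEl K (τ i)).1 (permHom K n τ (zm K α)) := by
  rw [dEl_zm i, map_smul, permHom_zm, permHom_zm, dEl_zm, Pi.sub_comp, single_comp_symm]
  simp

theorem permHom_hEl (τ : Equiv.Perm (Fin n)) (i : Fin n) (α : Fin n → ℤ) :
    permHom K n τ ((hEl K i).1 (zm K α)) = (hEl K (τ i)).1 (permHom K n τ (zm K α)) := by
  rw [hEl_zm i, map_smul, permHom_zm, hEl_zm]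
  simp

theorem permHom_hInvEl (τ : Equiv.Perm (Fin n)) (i : Fin n) (α : Fin n → ℤ) :
    permHom K n τ ((hInvEl K i).1 (zm K α)) = (hInvEl K (τ i)).1 (permHom K n τ (zm K α)) := by
  rw [hInvEl_zm i, map_smul, permHom_zm, hInvEl_zm]
  simp

variable (K n) in
theorem exists_isPermAction : ∃ s : Equiv.Perm (Fin n) →* JacAut K n, IsPermAction s := by
  obtain ⟨s, hs⟩ := exists_monoidHom_intertwines (permHom K n) fun τ =>
    exists_intertwines_of_generators
      (fun i => ⟨_, permHom_xEl τ i⟩) (fun i => ⟨_, fun α _ => permHom_dEl τ i α⟩)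
      (fun i => ⟨_, fun α _ => permHom_hInvEl τ i α⟩)
      (fun i => ⟨_, by rw [permHom_symm]; exact permHom_xEl τ⁻¹ i⟩)
      (fun i => ⟨_, by rw [permHom_symm]; exact fun α _ => permHom_dEl τ⁻¹ i α⟩)
      (fun i => ⟨_, by rw [permHom_symm]; exact fun α _ => permHom_hInvEl τ⁻¹ i α⟩)
  exact ⟨s, fun τ i => ⟨(hs τ).apply_eq (permHom_xEl τ i),
    (hs τ).apply_eq fun α _ => permHom_yEl τ i α, (hs τ).apply_eq fun α _ => permHom_hEl τ i α⟩⟩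

/-- The value of `lam` as a unit. -/
def lamUnit (e : ℤ →₀ ℤ) (z : ℤ) : Kˣ := Units.mk0 (lam K e z) (lam_ne_zero e z)

/-- The homomorphism `(K*)ⁿ → GL(Pₙ)`, `λ ↦ (x^α ↦ λ^α x^α)`. -/
def torusRamp : (Fin n → Kˣ) →* (Fin n → ℕ → Kˣ) where
  toFun l i _ := l i
  map_one' := rfl
  map_mul' _ _ := rfl

/-- The ramps of the elements of `∏ ℋ₁(i)`. -/
def muRamp : (∀ i : Fin n, hGroup K i) →* (Fin n → ℕ → Kˣ) where
  toFun u i j := lamUnit (hExp (u i)) j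
  map_one' := by
    ext i j
    simp [lamUnit, hExp_one]
  map_mul' u v := by
    ext i j
    simp [lamUnit, hExp_mul, lam_add]

theorem rampHom_hEl (r : Fin n → ℕ → Kˣ) (i : Fin n) (α : Fin n → ℤ) :
    rampHom r ((hEl K i).1 (zm K α)) = (hEl K i).1 (rampHom r (zm K α)) := by
  rw [hEl_zm, map_smul, rampHom_zm, map_smul, hEl_zm, smul_comm]

variable (K n) in
theorem exists_isTorusAction : ∃ t : (Fin n → Kˣ) →* JacAut K n, IsTorusAction t ∧
    ∀ l, Intertwines (rampHom (torusRamp l)) (t l) := by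
  obtain ⟨t, ht⟩ := exists_monoidHom_intertwines (G := Fin n → Kˣ)
    ((rampHom (K := K) (n := n)).comp torusRamp) fun l =>
      exists_intertwines_rampHom (torusRamp l)
        (fun i => Units.map (algebraMap K (Jac K n)).toMonoidHom (l i)) fun i α _ => rfl
  refine ⟨t, fun l i => ⟨(ht l).apply_eq fun α h => ?_, (ht l).apply_eq fun α h => ?_,
    (ht l).apply_eq fun α _ => rampHom_hEl _ i α⟩, ht⟩
  · simp only [MonoidHom.comp_apply]
    rw [xEl_zm i h, rampHom_zm, rampHom_zm, map_smul, jac_smul_apply, xEl_zm i h,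
      ramp_add_single _ h, smul_smul]
    rfl
  · simp only [MonoidHom.comp_apply]
    rw [yEl_zm, rampHom_zm, rampHom_zm, map_smul, jac_smul_apply, yEl_zm]
    rcases eq_add_single_or i h with ⟨β, hβ, rfl⟩ | h0
    · rw [add_sub_cancel_right, ramp_add_single _ hβ, smul_smul, mul_assoc]
      simp [torusRamp]
    · simp [zm_sub_single_eq_zero h0]

theorem muRamp_apply (u : ∀ i : Fin n, hGroup K i) (i : Fin n) {α : Fin n → ℤ} (h : 0 ≤ α) :
    (muRamp u i (α i).toNat : K) = lam K (hExp (u i)) (α i) := by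
  simp only [muRamp, lamUnit, MonoidHom.coe_mk, OneHom.coe_mk, Units.val_mk0]
  rw [Int.toNat_of_nonneg (h i)]

variable (K n) in
theorem exists_isMuAction : ∃ μ : (∀ i : Fin n, hGroup K i) →* JacAut K n, IsMuAction μ ∧
    ∀ u, Intertwines (rampHom (muRamp u)) (μ u) := by
  obtain ⟨m, hm⟩ := exists_monoidHom_intertwines ((rampHom (K := K) (n := n)).comp muRamp)
    fun u => exists_intertwines_rampHom (muRamp u) (fun i => (u i).1) fun i α h => by
      rw [muRamp_apply u i h, hGroup_zm (u i) h]
  refine ⟨m, fun u i => ⟨(hm u).apply_eq fun α h => ?_, (hm u).apply_eq fun α h => ?_,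
    (hm u).apply_eq fun α _ => rampHom_hEl _ i α⟩, hm⟩
  · simp only [MonoidHom.comp_apply]
    rw [xEl_zm i h, rampHom_zm, rampHom_zm, map_smul, jac_mul_apply, hGroup_zm (u i) h, map_smul,
      xEl_zm i h, ramp_add_single _ h, smul_smul, muRamp_apply u i h]
  · simp only [MonoidHom.comp_apply]
    rw [yEl_zm, rampHom_zm, rampHom_zm, map_smul, jac_mul_apply, yEl_zm]
    rcases eq_add_single_or i h with ⟨β, hβ, rfl⟩ | h0
    · rw [add_sub_cancel_right, ramp_add_single _ hβ, hGroup_inv_zm (u i) hβ, muRamp_apply u i hβ,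
        smul_smul, mul_assoc, mul_inv_cancel₀ (lam_ne_zero _ _), mul_one]
    · simp [zm_sub_single_eq_zero h0]

theorem jacAut_ext {σ τ : JacAut K n} (hx : ∀ i, σ (xEl K i) = τ (xEl K i))
    (hy : ∀ i, σ (yEl K i) = τ (yEl K i)) (hh : ∀ i, σ (hEl K i) = τ (hEl K i)) : σ = τ := by
  have h : AlgHom.equalizer (σ : Jac K n →ₐ[K] Jac K n) (τ : Jac K n →ₐ[K] Jac K n) = ⊤ := by
    refine subalgebra_eq_top _ hx (fun i => ?_) fun i => ?_
    · change σ _ = τ _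
      rw [dEl_eq, map_mul, map_mul, hy, hh]
    · change σ _ = τ _
      have h1 : σ (hInvEl K i) * σ (hEl K i) = 1 := by rw [← map_mul, hInvEl_mul_hEl, map_one]
      have h2 : σ (hEl K i) * τ (hInvEl K i) = 1 := by
        rw [hh, ← map_mul, hEl_mul_hInvEl, map_one]
      exact left_inv_eq_right_inv h1 h2
  refine AlgEquiv.ext fun a => ?_
  have ha : a ∈ AlgHom.equalizer (σ : Jac K n →ₐ[K] Jac K n) (τ : Jac K n →ₐ[K] Jac K n) :=
    h ▸ Algebra.mem_top
  exact ha

theorem red_hInv_mul (i : Fin n) : red K n (hInvEl K i) * red K n (hEl K i) = 1 := by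
  rw [← map_mul, hInvEl_mul_hEl, map_one]

theorem red_hEl_mul_hInvEl (i : Fin n) : red K n (hEl K i) * red K n (hInvEl K i) = 1 := by
  rw [← map_mul, hEl_mul_hInvEl, map_one]

/-- In 𝒜ₙ the classes of yᵢ and Hᵢ⁻¹ are two-sided inverses of those of xᵢ and Hᵢ, so the images of
xᵢ and Hᵢ determine everything. -/
theorem quotAut_ext {σ τ : QuotAut K n}
    (hx : ∀ i, σ (red K n (xEl K i)) = τ (red K n (xEl K i)))
    (hh : ∀ i, σ (red K n (hEl K i)) = τ (red K n (hEl K i))) : σ = τ := by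
  have hinv : ∀ {a b : JacQuot K n}, a * b = 1 → b * a = 1 → σ a = τ a → σ b = τ b := by
    intro a b h1 h2 h
    have h3 : σ b * σ a = 1 := by rw [← map_mul, h2, map_one]
    have h4 : σ a * τ b = 1 := by rw [h, ← map_mul, h1, map_one]
    exact left_inv_eq_right_inv h3 h4
  have h : AlgHom.equalizer ((σ : JacQuot K n →ₐ[K] JacQuot K n).comp (red K n))
      ((τ : JacQuot K n →ₐ[K] JacQuot K n).comp (red K n)) = ⊤ := by
    refine subalgebra_eq_top _ hx (fun i => ?_) fun i => ?_
    · change σ (red K n _) = τ (red K n _)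
      rw [dEl_eq, map_mul, map_mul, map_mul, hh,
        hinv (red_xEl_mul_yEl i) (red_yEl_mul_xEl i) (hx i)]
    · exact hinv (red_hEl_mul_hInvEl i) (red_hInv_mul i) (hh i)
  refine AlgEquiv.ext fun a => ?_
  obtain ⟨a, rfl⟩ := Ideal.Quotient.mk_surjective a
  have ha : a ∈ AlgHom.equalizer ((σ : JacQuot K n →ₐ[K] JacQuot K n).comp (red K n))
      ((τ : JacQuot K n →ₐ[K] JacQuot K n).comp (red K n)) := h ▸ Algebra.mem_top
  exact ha

end Actions

/-! ### Factorization in a product of subgroups -/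

section GroupTheory

theorem exists_mul_of_mem_sup {G : Type*} [Group G] {A B : Subgroup G}
    (h : ∀ a ∈ A, ∀ b ∈ B, a * b * a⁻¹ ∈ B) {g : G} (hg : g ∈ A ⊔ B) :
    ∃ a ∈ A, ∃ b ∈ B, g = a * b := by
  let C : Subgroup G :=
    { carrier := {g | ∃ a ∈ A, ∃ b ∈ B, g = a * b}
      one_mem' := ⟨1, one_mem _, 1, one_mem _, by simp⟩
      mul_mem' := by
        rintro _ _ ⟨a, ha, b, hb, rfl⟩ ⟨a', ha', b', hb', rfl⟩
        refine ⟨a * a', mul_mem ha ha', a'⁻¹ * b * a' * b', mul_mem ?_ hb', by group⟩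
        simpa using h a'⁻¹ (inv_mem ha') b hb
      inv_mem' := by
        rintro _ ⟨a, ha, b, hb, rfl⟩
        exact ⟨a⁻¹, inv_mem ha, a * b⁻¹ * a⁻¹, h a ha _ (inv_mem hb), by group⟩ }
  have : A ⊔ B ≤ C := sup_le (fun a ha => ⟨a, ha, 1, one_mem _, by simp⟩)
    fun b hb => ⟨1, one_mem _, b, hb, by simp⟩
  exact this hg

end GroupTheory

/-! ### Product decompositions among Sₙ, 𝕋ⁿ, 𝕌ₙ and ker ξ -/

section Products

variable {K : Type*} [Field K] [CharZero K] {n : ℕ}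

theorem xEl_injective : Function.Injective (xEl K : Fin n → Jac K n) := by
  intro i j h
  have h1 := congrArg (fun a : Jac K n => a.1 (zm K 0)) h
  simp only [xEl_zm i le_rfl, xEl_zm j le_rfl, zero_add] at h1
  rw [← X_eq_zm, ← X_eq_zm] at h1
  exact MvPolynomial.X_injective h1

/-- For i ≠ j the equality αᵢ = αⱼ would hold for some far α and also for α + eᵢ. -/
theorem hEl_red_injective {i j : Fin n} (h : red K n (hEl K i) = red K n (hEl K j)) : i = j := by
  by_contra hij
  have h1 := red_eq_iff.1 h
  obtain ⟨α, h2, h3, h4⟩ := (h1.and ((eventually_add h1 (Pi.single i 1)).and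
    eventually_nonneg)).exists
  rw [hEl_zm, hEl_zm] at h2 h3
  have h5 := smul_left_injective K (zm_ne_zero K h4) h2
  have h6 := smul_left_injective K (zm_ne_zero K (add_nonneg h4 (single_nonneg i))) h3
  simp [Ne.symm hij] at h5 h6
  rw [h5] at h6
  simp at h6

variable {s : Equiv.Perm (Fin n) →* JacAut K n} {t : (Fin n → Kˣ) →* JacAut K n}
  {μ : (∀ i : Fin n, hGroup K i) →* JacAut K n}

theorem IsPermAction.injective (hs : IsPermAction s) : Function.Injective s := by
  intro τ τ' h
  ext1 i
  exact xEl_injective (K := K) (by rw [← (hs τ i).1, h, (hs τ' i).1])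

theorem jacAut_sub (σ : JacAut K n) (a b : Jac K n) : σ (a - b) = σ a - σ b :=
  map_sub (σ : Jac K n →+* Jac K n) a b

theorem IsTorusAction.injective (ht : IsTorusAction t) : Function.Injective t := by
  intro l l' h
  ext i
  have h1 : (l i : K) • xEl K i = (l' i : K) • xEl K i := by rw [← (ht l i).1, h, (ht l' i).1]
  have h2 := congrArg (fun a : Jac K n => a.1 (zm K 0)) h1
  simp only [jac_smul_apply, xEl_zm i le_rfl] at h2
  exact smul_left_injective K (zm_ne_zero K (add_nonneg le_rfl (single_nonneg i))) h2

theorem IsMuAction.injective (hμ : IsMuAction μ) : Function.Injective μ := by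
  intro u u' h
  ext i : 3
  have h1 : xEl K i * ((u i : (Jac K n)ˣ) : Jac K n) = xEl K i * ((u' i : (Jac K n)ˣ) : Jac K n) := by
    rw [← (hμ u i).1, h, (hμ u' i).1]
  have h2 := congrArg (yEl K i * ·) h1
  simpa only [← mul_assoc, yEl_mul_xEl, one_mul] using h2

/-- The automorphism `t_λ μ_u` moves `xᵢ` to an element whose class determines `λ` and `u`. -/
theorem eq_one_of_red_eq {l : K} {i : Fin n} {u : hGroup K i}
    (h : red K n (l • (xEl K i * ((u : (Jac K n)ˣ) : Jac K n))) = red K n (xEl K i)) :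
    l = 1 ∧ u = 1 := by
  have h1 : ∀ᶠ α : Fin n → ℤ in atTop, l * lam K (hExp u) (α i) = 1 := by
    filter_upwards [red_eq_iff.1 h, eventually_nonneg] with α h2 h3
    rw [jac_smul_apply, jac_mul_apply, hGroup_zm u h3, map_smul, xEl_zm i h3, smul_smul] at h2
    refine smul_left_injective K (zm_ne_zero K (add_nonneg h3 (single_nonneg i))) ?_
    simpa using h2
  have h2 := eventually_of_eventually_apply (p := fun z => l * lam K (hExp u) z = 1) h1
  have hl : l ≠ 0 := by
    rintro rfl
    obtain ⟨z, hz⟩ := h2.exists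
    simp at hz
  have h3 : hExp u = 0 := by
    refine eq_zero_of_lam_eventually_const (K := K) (c := l⁻¹) ?_
    filter_upwards [h2] with z hz
    exact eq_inv_of_mul_eq_one_right hz
  refine ⟨?_, hExp_injective i (h3.trans (hExp_one i).symm)⟩
  obtain ⟨z, hz⟩ := h2.exists
  simpa [h3] using hz

/-- Both automorphisms are conjugations by diagonal operators, which commute. -/
theorem commute_torus_mu (ht : ∀ l, Intertwines (rampHom (torusRamp l)) (t l))
    (hμ : ∀ u, Intertwines (rampHom (muRamp u)) (μ u)) (l : Fin n → Kˣ)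
    (u : ∀ i : Fin n, hGroup K i) : t l * μ u = μ u * t l := by
  refine ((ht l).mul (hμ u)).unique ?_
  rw [← map_mul, mul_comm, map_mul]
  exact (hμ u).mul (ht l)

theorem isDirect_torus_mu (ht : ∀ l, Intertwines (rampHom (torusRamp l)) (t l))
    (hμ : ∀ u, Intertwines (rampHom (muRamp u)) (μ u)) (ht' : IsTorusAction t)
    (hμ' : IsMuAction μ) : IsDirect t.range μ.range (t.range ⊔ μ.range) := by
  refine ⟨?_, ?_, rfl⟩
  · rintro _ ⟨l, rfl⟩ _ ⟨u, rfl⟩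
    exact commute_torus_mu ht hμ l u
  · refine eq_bot_iff.2 ?_
    rintro _ ⟨⟨l, rfl⟩, ⟨u, hu⟩⟩
    have h1 : ∀ i, u i = 1 := fun i => by
      have h2 : (((l i)⁻¹ : Kˣ) : K) • (xEl K i * ((u i : (Jac K n)ˣ) : Jac K n)) = xEl K i := by
        rw [← (hμ' u i).1, hu, (ht' l i).1, smul_smul, ← Units.val_mul, inv_mul_cancel,
          Units.val_one, one_smul]
      exact (eq_one_of_red_eq (congrArg (red K n) h2)).2
    rw [Subgroup.mem_bot, ← hu, show u = 1 from funext h1, map_one]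

theorem exists_torus_mul_mu (ht : ∀ l, Intertwines (rampHom (torusRamp l)) (t l))
    (hμ : ∀ u, Intertwines (rampHom (muRamp u)) (μ u)) {σ : JacAut K n}
    (hσ : σ ∈ t.range ⊔ μ.range) : ∃ l u, σ = t l * μ u := by
  obtain ⟨_, ⟨l, rfl⟩, _, ⟨u, rfl⟩, h⟩ := exists_mul_of_mem_sup (by
    rintro _ ⟨l, rfl⟩ _ ⟨u, rfl⟩
    rw [commute_torus_mu ht hμ, mul_inv_cancel_right]
    exact ⟨u, rfl⟩) hσ
  exact ⟨l, u, h⟩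

theorem torus_mul_mu_xEl (ht : ∀ l, Intertwines (rampHom (torusRamp l)) (t l))
    (hμ : ∀ u, Intertwines (rampHom (muRamp u)) (μ u)) (ht' : IsTorusAction t)
    (hμ' : IsMuAction μ) (l : Fin n → Kˣ) (u : ∀ i : Fin n, hGroup K i) (i : Fin n) :
    (t l * μ u) (xEl K i) = (l i : K) • (xEl K i * ((u i : (Jac K n)ˣ) : Jac K n)) := by
  rw [commute_torus_mu ht hμ, AlgEquiv.mul_apply, (ht' l i).1, map_smul, (hμ' u i).1]

theorem torus_mul_mu_hEl (ht' : IsTorusAction t)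
    (hμ' : IsMuAction μ) (l : Fin n → Kˣ) (u : ∀ i : Fin n, hGroup K i) (i : Fin n) :
    (t l * μ u) (hEl K i) = hEl K i := by
  rw [AlgEquiv.mul_apply, (hμ' u i).2.2, (ht' l i).2.2]

theorem IsPermAction.matUnit (hs : IsPermAction s) (τ : Equiv.Perm (Fin n)) (i : Fin n)
    (a b : ℕ) : s τ (matUnit K i a b) = BavulaJacobian.matUnit K (τ i) a b := by
  simp only [BavulaJacobian.matUnit, jacAut_sub, map_mul, map_pow, (hs τ i).1, (hs τ i).2.1]

theorem IsPermAction.map_hGroup (hs : IsPermAction s) (τ : Equiv.Perm (Fin n)) {i : Fin n}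
    {v : (Jac K n)ˣ} (hv : v ∈ hGroup K i) :
    Units.map ((s τ : Jac K n →* Jac K n)) v ∈ hGroup K (τ i) := by
  have : hGroup K i ≤ (hGroup K (τ i)).comap (Units.map ((s τ : Jac K n →* Jac K n))) := by
    refine (Subgroup.closure_le _).2 ?_
    rintro v (⟨j, hj⟩ | ⟨j, h1, hj⟩)
    · refine Subgroup.subset_closure (Or.inl ⟨j, ?_⟩)
      change s τ v = _
      rw [hj, map_add, (hs τ i).2.2, map_natCast]
    · refine Subgroup.subset_closure (Or.inr ⟨j, h1, ?_⟩)
      change s τ v = _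
      rw [hj, map_add, jacAut_sub, (hs τ i).2.2, map_natCast, hs.matUnit]
  exact this hv

theorem isSemidirect_perm (hs : IsPermAction s)
    (ht : IsTorusAction t) (hμ : IsMuAction μ) :
    IsSemidirect s.range (t.range ⊔ μ.range) (s.range ⊔ (t.range ⊔ μ.range)) := by
  refine ⟨?_, ?_, rfl⟩
  · rintro _ ⟨τ, rfl⟩ b hb
    have : t.range ⊔ μ.range ≤
        (t.range ⊔ μ.range).comap (MulAut.conj (s τ)).toMonoidHom := by
      refine sup_le ?_ ?_
      · rintro _ ⟨l, rfl⟩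
        refine Subgroup.mem_sup_left ⟨fun i => l (τ⁻¹ i), ?_⟩
        change _ = s τ * t l * (s τ)⁻¹
        rw [← map_inv]
        refine jacAut_ext (fun i => ?_) (fun i => ?_) fun i => ?_
        · rw [AlgEquiv.mul_apply, AlgEquiv.mul_apply, (hs _ _).1, (ht _ _).1, (ht _ _).1, map_smul,
            (hs _ _).1]
          simp
        · rw [AlgEquiv.mul_apply, AlgEquiv.mul_apply, (hs _ _).2.1, (ht _ _).2.1, (ht _ _).2.1,
            map_smul, (hs _ _).2.1]
          simp
        · rw [AlgEquiv.mul_apply, AlgEquiv.mul_apply, (hs _ _).2.2, (ht _ _).2.2, (ht _ _).2.2,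
            (hs _ _).2.2]
          simp
      · rintro _ ⟨u, rfl⟩
        refine Subgroup.mem_sup_right ⟨fun i => ⟨Units.map ((s τ : Jac K n →* Jac K n))
          (u (τ⁻¹ i)).1, by simpa using hs.map_hGroup τ (u (τ⁻¹ i)).2⟩, ?_⟩
        change _ = s τ * μ u * (s τ)⁻¹
        rw [← map_inv]
        refine jacAut_ext (fun i => ?_) (fun i => ?_) fun i => ?_
        · rw [AlgEquiv.mul_apply, AlgEquiv.mul_apply, (hs _ _).1, (hμ _ _).1, (hμ _ _).1, map_mul,
            (hs _ _).1]
          simp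
        · rw [AlgEquiv.mul_apply, AlgEquiv.mul_apply, (hs _ _).2.1, (hμ _ _).2.1, (hμ _ _).2.1,
            map_mul, (hs _ _).2.1, ← map_inv]
          simp
        · rw [AlgEquiv.mul_apply, AlgEquiv.mul_apply, (hs _ _).2.2, (hμ _ _).2.2, (hμ _ _).2.2,
            (hs _ _).2.2]
          simp
    exact this hb
  · refine eq_bot_iff.2 ?_
    rintro _ ⟨⟨τ, rfl⟩, h⟩
    -- The elements of 𝕋ⁿ and 𝕌ₙ fix every Hᵢ, while a permutation is visible on the Hᵢ.
    let F : Subgroup (JacAut K n) :=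
      { carrier := {σ | ∀ i, σ (hEl K i) = hEl K i}
        one_mem' := fun i => rfl
        mul_mem' := fun {σ σ'} h h' i => by rw [AlgEquiv.mul_apply, h', h]
        inv_mem' := fun {σ} h i => by
          apply σ.injective
          rw [h i]
          exact σ.apply_symm_apply _ }
    have hF : t.range ⊔ μ.range ≤ F := by
      refine sup_le ?_ ?_
      · rintro _ ⟨l, rfl⟩ i
        exact (ht l i).2.2
      · rintro _ ⟨u, rfl⟩ i
        exact (hμ u i).2.2
    have : τ = 1 := by
      ext1 i
      refine hEl_red_injective (K := K) ?_
      rw [← (hs τ i).2.2, hF h i]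
      rfl
    rw [Subgroup.mem_bot, this, map_one]

theorem mem_ker_xi (hs : AIdealStable K n) {σ : JacAut K n} :
    σ ∈ (xi hs).ker ↔ ∀ a, red K n (σ a) = red K n a := by
  rw [MonoidHom.mem_ker]
  constructor
  · intro h a
    rw [← xi_red hs, h]
    rfl
  · intro h
    refine quotAut_ext (fun i => ?_) fun i => ?_ <;> rw [xi_red, h] <;> rfl

/-- The classes of σ(Hᵢ) modulo 𝔞ₙ determine the permutation, and those of σ(xᵢ) then determine λ
and u. -/
theorem perm_inf_ker (hst : AIdealStable K n) (hs : IsPermAction s)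
    (ht : ∀ l, Intertwines (rampHom (torusRamp l)) (t l))
    (hμ : ∀ u, Intertwines (rampHom (muRamp u)) (μ u)) (ht' : IsTorusAction t)
    (hμ' : IsMuAction μ) : (s.range ⊔ (t.range ⊔ μ.range)) ⊓ (xi hst).ker = ⊥ := by
  refine eq_bot_iff.2 ?_
  rintro σ ⟨h1, h2⟩
  have h2 := (mem_ker_xi hst).1 h2
  obtain ⟨_, ⟨τ, rfl⟩, b, hb, rfl⟩ := exists_mul_of_mem_sup (isSemidirect_perm hs ht' hμ').1 h1
  obtain ⟨l, u, rfl⟩ := exists_torus_mul_mu ht hμ hb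
  have hτ : τ = 1 := by
    ext1 i
    refine hEl_red_injective (K := K) ?_
    have := h2 (hEl K i)
    rwa [AlgEquiv.mul_apply, torus_mul_mu_hEl ht' hμ', (hs τ i).2.2] at this
  rw [hτ, map_one, one_mul] at h2 ⊢
  have h3 : ∀ i, (l i : K) = 1 ∧ u i = 1 := fun i => by
    have := h2 (xEl K i)
    rw [torus_mul_mu_xEl ht hμ ht' hμ'] at this
    exact eq_one_of_red_eq this
  have hl : l = 1 := funext fun i => Units.ext (h3 i).1
  have hu : u = 1 := funext fun i => (h3 i).2
  rw [Subgroup.mem_bot, hl, hu, map_one, map_one, one_mul]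

end Products

/-! ### Units of 𝒜ₙ -/

section RationalUnits

variable {K : Type*} [Field K] [CharZero K] {n : ℕ}

/-- The linear form is the image of a variable under the automorphism translating all variables by
`j`. -/
theorem prime_X_add_C (i : Fin n) (j : ℤ) :
    Prime (MvPolynomial.X i + MvPolynomial.C (j : K) : MvPolynomial (Fin n) K) := by
  have h : ∀ γ : Fin n → ℤ, (shiftPoly γ).comp (shiftPoly (-γ)) =
      AlgHom.id K (MvPolynomial (Fin n) K) := fun γ => MvPolynomial.algHom_ext fun k => by
    simp [shiftPoly]
  have h' : ∀ γ : Fin n → ℤ, (shiftPoly (-γ)).comp (shiftPoly γ) =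
      AlgHom.id K (MvPolynomial (Fin n) K) := fun γ => by
    have := h (-γ)
    rwa [neg_neg] at this
  let γ : Fin n → ℤ := fun _ => j
  let E : MvPolynomial (Fin n) K ≃ₐ[K] MvPolynomial (Fin n) K :=
    AlgEquiv.ofAlgHom (shiftPoly γ) (shiftPoly (-γ)) (h γ) (h' γ)
  have h1 : E (MvPolynomial.X i) = MvPolynomial.X i + MvPolynomial.C (j : K) := by
    change shiftPoly γ (MvPolynomial.X i) = _
    simp [shiftPoly, γ]
  rw [← h1]
  exact (MulEquiv.prime_iff E).2 MvPolynomial.X_prime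

/-- Each prime linear factor of the product divides one of the two factors; cancelling them one at a
time leaves a constant. -/
theorem exists_of_mul_mem_linSub {D : MvPolynomial (Fin n) K} (hD : D ∈ linSub K n) :
    ∀ a b : MvPolynomial (Fin n) K, a * b = D →
      ∃ (l : K), l ≠ 0 ∧ ∃ A ∈ linSub K n, a = MvPolynomial.C l * A := by
  induction hD using Submonoid.closure_induction_left with
  | one =>
    intro a b hab
    have ha : IsUnit a := IsUnit.of_mul_eq_one b hab
    rw [MvPolynomial.isUnit_iff_eq_C_of_isReduced] at ha
    obtain ⟨l, hl, rfl⟩ := ha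
    exact ⟨l, hl.ne_zero, 1, one_mem _, by simp⟩
  | mul_left x hx y hy ih =>
    intro a b hab
    obtain ⟨⟨i, j⟩, rfl⟩ := hx
    have hp := prime_X_add_C (K := K) i j
    rcases hp.dvd_or_dvd (Dvd.intro _ hab.symm) with ⟨a', rfl⟩ | ⟨b', rfl⟩
    · obtain ⟨l, hl, A, hA, rfl⟩ := ih a' b (mul_left_cancel₀ hp.ne_zero (by
        rw [← hab]; ring))
      exact ⟨l, hl, _, mul_mem (X_add_C_mem_linSub i j) hA, by ring⟩
    · exact ih a b' (mul_left_cancel₀ hp.ne_zero (by rw [← hab]; ring))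

/-- The product of rational functions of one variable attached to exponents. -/
def lamProd (e : Fin n → ℤ →₀ ℤ) (α : Fin n → ℤ) : K := ∏ k, lam K (e k) (α k)

theorem lamProd_ne_zero (e : Fin n → ℤ →₀ ℤ) (α : Fin n → ℤ) : lamProd (K := K) e α ≠ 0 :=
  Finset.prod_ne_zero_iff.2 fun _ _ => lam_ne_zero _ _

theorem exists_ev_eq_lamProd {D : MvPolynomial (Fin n) K} (hD : D ∈ linSub K n) :
    ∃ e, ∀ᶠ α in atTop, ev α D = lamProd e α := by
  induction hD using Submonoid.closure_induction with
  | mem x hx =>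
    obtain ⟨⟨i, j⟩, rfl⟩ := hx
    refine ⟨Pi.single i (Finsupp.single j 1), ?_⟩
    filter_upwards [eventually_apply (eventually_gt_atTop (-j)) i] with α h
    rw [lamProd, Finset.prod_eq_single i]
    · rw [Pi.single_eq_same, lam_single, if_neg (by omega)]
      simp
    · intro k _ hk
      rw [Pi.single_eq_of_ne hk, lam_zero]
    · simp
  | one => exact ⟨0, by simp [lamProd]⟩
  | mul x y _ _ hx hy =>
    obtain ⟨e, he⟩ := hx
    obtain ⟨f, hf⟩ := hy
    refine ⟨e + f, ?_⟩
    filter_upwards [he, hf] with α h1 h2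
    rw [map_mul, h1, h2, lamProd, lamProd, lamProd, ← Finset.prod_mul_distrib]
    exact Finset.prod_congr rfl fun k _ => (lam_add _ _ _).symm

/-- With f = p/D and g = q/E, the relation fg = 1 gives pq = DE, so the numerator `p` is itself a
scalar times a product of linear forms. -/
theorem Rat.exists_eq_lamProd {f g : (Fin n → ℤ) → K} (hf : Rat f) (hg : Rat g)
    (h : ∀ᶠ α in atTop, f α * g α = 1) :
    ∃ l : K, l ≠ 0 ∧ ∃ e, f =ᶠ[atTop] fun α => l * lamProd e α := by
  obtain ⟨D, hD, p, hp⟩ := hf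
  obtain ⟨E, hE, q, hq⟩ := hg
  have hpq : p * q = D * E := by
    refine sub_eq_zero.1 (eq_zero_of_eventually_ev ?_)
    filter_upwards [hp, hq, h] with α h1 h2 h3
    rw [map_sub, map_mul, map_mul, ← h1, ← h2]
    linear_combination ev α D * ev α E * h3
  obtain ⟨l, hl, A, hA, rfl⟩ := exists_of_mul_mem_linSub (mul_mem hD hE) p q hpq
  obtain ⟨e, he⟩ := exists_ev_eq_lamProd hA
  obtain ⟨d, hd⟩ := exists_ev_eq_lamProd hD
  refine ⟨l, hl, e - d, ?_⟩
  filter_upwards [hp, he, hd] with α h1 h2 h3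
  have h4 : lamProd (K := K) (e - d) α = lamProd e α / lamProd d α := by
    rw [lamProd, lamProd, lamProd, ← Finset.prod_div_distrib]
    exact Finset.prod_congr rfl fun k _ => lam_sub _ _ _
  rw [h4]
  rw [map_mul, ev_C, h2, h3] at h1
  have := lamProd_ne_zero (K := K) d α
  field_simp
  rw [← h1, mul_comm]

theorem not_eventually_zero_add {f : (Fin n → ℤ) → K} (h : ¬ f =ᶠ[atTop] 0) (γ : Fin n → ℤ) :
    ¬ (fun α => f (α + γ)) =ᶠ[atTop] 0 := by
  intro h'
  refine h ?_
  filter_upwards [eventually_add h' (-γ)] with α h1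
  simpa using h1

/-- A shift obtained from exactly one pair of shifts of `a` and `b` has as coefficient a product of
two nonzero rational germs, so it must be the shift 0 of ab = 1. If more than one pair existed, the
two unique sums property of ℤⁿ would give two distinct pairs with unique sum, both equal to 0, a
contradiction. Hence both supports are singletons, and the coefficient is rational with rational
inverse. -/
theorem isUnit_red_form {a b : Jac K n} (h : red K n a * red K n b = 1) :
    ∃ (γ : Fin n → ℤ) (l : K), l ≠ 0 ∧ ∃ e, ∀ᶠ α in atTop,
      a.1 (zm K α) = (l * lamProd e α) • zm K (α + γ) := by
  have hab : ∀ᶠ α in atTop, (a * b).1 (zm K α) = (1 : K) • zm K (α + 0) := by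
    rw [← map_mul, ← map_one (red K n), red_eq_iff] at h
    filter_upwards [h] with α h1
    rw [h1, add_zero, one_smul]; rfl
  obtain ⟨S, hS⟩ := exists_isSupp a
  obtain ⟨T, hT⟩ := exists_isSupp b
  have hunique : ∀ p ∈ S ×ˢ T, UniqueAdd S T p.1 p.2 → p.1 + p.2 = 0 := by
    intro p hp hu
    obtain ⟨hp1, hp2⟩ := Finset.mem_product.1 hp
    by_contra hne
    have h1 := cf_mul hS hT (p.1 + p.2)
    have h2 := cf_eventuallyEq_zero hab (Ne.symm hne)
    have hzero : ∀ᶠ α in atTop, cf a p.1 (α + p.2) * cf b p.2 α = 0 := by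
      filter_upwards [h1, h2] with α h3 h4
      rw [h4, Finset.sum_eq_single p] at h3
      · exact h3.symm
      · intro q hq hqp
        obtain ⟨hq1, hq2⟩ := Finset.mem_filter.1 hq
        obtain ⟨hq3, hq4⟩ := Finset.mem_product.1 hq1
        obtain ⟨h5, h6⟩ := hu hq3 hq4 hq2
        exact absurd (Prod.ext h5 h6) hqp
      · intro h5
        rw [Finset.mem_filter, not_and] at h5
        exact absurd rfl (h5 hp)
    have ha0 : ¬ cf a p.1 =ᶠ[atTop] 0 := (hS.1 p.1).1 hp1
    have hb0 : ¬ cf b p.2 =ᶠ[atTop] 0 := (hT.1 p.2).1 hp2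
    have hor := ((rat_cf a p.1).shift p.2).eventually_eq_zero_or (rat_cf b p.2) hzero
    exact hor.elim (not_eventually_zero_add ha0 p.2) hb0
  have hcard : ¬ 1 < S.card * T.card := by
    intro hc
    obtain ⟨p, hp, q, hq, hne, hup, huq⟩ := TwoUniqueSums.uniqueAdd_of_one_lt_card hc
    have h1 := hunique p hp hup
    have h2 := hunique q hq huq
    obtain ⟨hq1, hq2⟩ := Finset.mem_product.1 hq
    obtain ⟨h3, h4⟩ := hup hq1 hq2 (by rw [h1, h2])
    exact hne (Prod.ext h3.symm h4.symm)
  obtain ⟨α₀, hα₀, hα₁, hα₂⟩ := ((hab.and (hT.2.and eventually_nonneg))).exists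
  have hα₃ : (a * b).1 (zm K α₀) ≠ 0 := by
    rw [hα₀, one_smul, add_zero]; exact zm_ne_zero K hα₂
  have hTne : T.Nonempty := by
    rw [Finset.nonempty_iff_ne_empty]
    rintro rfl
    rw [jac_mul_apply, hα₁] at hα₃
    simp at hα₃
  have hSne : S.Nonempty := by
    rw [Finset.nonempty_iff_ne_empty]
    rintro rfl
    have h1 := (mem_aIdeal_iff (a := a)).2 (by simpa using hS.2)
    have h2 := red_eq_zero_iff'.2 h1
    rw [h2, zero_mul, ← map_zero (red K n), ← map_one (red K n), eq_comm, map_zero,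
      red_eq_zero_iff'] at h
    exact one_notMem_aIdeal h
  have hS1 := hSne.card_pos
  have hT1 := hTne.card_pos
  obtain ⟨γ, hγ⟩ := Finset.card_eq_one.1 (show S.card = 1 by nlinarith)
  obtain ⟨δ, hδ⟩ := Finset.card_eq_one.1 (show T.card = 1 by nlinarith)
  have ha : ∀ᶠ α in atTop, a.1 (zm K α) = cf a γ α • zm K (α + γ) := by
    filter_upwards [hS.2] with α h1
    rw [h1, hγ, Finset.sum_singleton]
  have hγδ : γ + δ = 0 := hunique (γ, δ) (by simp [hγ, hδ]) (by
    intro x y hx hy _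
    rw [hγ, Finset.mem_singleton] at hx
    rw [hδ, Finset.mem_singleton] at hy
    exact ⟨hx, hy⟩)
  have h1 := cf_mul hS hT 0
  have h2 := cf_eventuallyEq_single hab
  have h3 : ∀ᶠ α in atTop, cf a γ (α + δ) * cf b δ α = 1 := by
    filter_upwards [h1, h2] with α h3 h4
    rw [h4, hγ, hδ, Finset.singleton_product_singleton, Finset.filter_singleton, if_pos hγδ,
      Finset.sum_singleton] at h3
    exact h3.symm
  have h4 : ∀ᶠ α in atTop, cf a γ α * cf b δ (α + γ) = 1 := by
    filter_upwards [eventually_add h3 γ] with α h5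
    rwa [add_assoc, hγδ, add_zero] at h5
  obtain ⟨l, hl, e, he⟩ := (rat_cf a γ).exists_eq_lamProd ((rat_cf b δ).shift γ) h4
  refine ⟨γ, l, hl, e, ?_⟩
  filter_upwards [ha, he] with α h5 h6
  rw [h5, h6]

end RationalUnits

/-! ### Periodic rational functions -/

section Periodic

variable {K : Type*} [Field K] [CharZero K] {n : ℕ}

/-- On the grid d + Nℕⁿ the function has the value w(d), so the polynomial identity p = w(d)·D holds
there. The grid is Zariski dense, hence the identity holds everywhere. -/
theorem Rat.eventually_const_of_periodic {w : (Fin n → ℤ) → K} (hw : Rat w) {N : ℕ} (hN : N ≠ 0)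
    (h : ∀ k, ∀ᶠ α in atTop, w (α + Pi.single k (N : ℤ)) = w α) :
    ∃ c, ∀ᶠ α in atTop, w α = c := by
  obtain ⟨D, hD, p, hp⟩ := hw
  obtain ⟨d, hd⟩ := eventually_atTop.1 ((eventually_all.2 h).and hp)
  have hper : ∀ m : Fin n →₀ ℕ, ∀ α, d ≤ α → w (α + (N : ℤ) • intExp m) = w α := by
    intro m
    induction m using Finsupp.induction_linear with
    | zero =>
      intro α _
      congr 1
      ext i; simp
    | add f g hf hg =>
      intro α hα
      have h1 : α + (N : ℤ) • intExp (f + g) = (α + (N : ℤ) • intExp f) + (N : ℤ) • intExp g := by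
        ext i; simp; ring
      rw [h1, hg _ (hα.trans (le_add_of_nonneg_right (smul_nonneg (by positivity)
        (intExp_nonneg f)))), hf _ hα]
    | single k m =>
      have hsing : ∀ m : ℕ, (N : ℤ) • intExp (Finsupp.single k m) =
          (Pi.single k ((N : ℤ) * m) : Fin n → ℤ) := fun m => by
        ext i
        by_cases hi : i = k
        · subst hi; simp
        · simp [hi]
      rw [hsing]
      induction m with
      | zero => intro α _; simp
      | succ m ih =>
        intro α hα
        have h1 : α + Pi.single k ((N : ℤ) * (m + 1 : ℕ)) =
            (α + Pi.single k ((N : ℤ) * m)) + Pi.single k (N : ℤ) := by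
          rw [add_assoc, ← Pi.single_add]; push_cast; ring_nf
        rw [h1, (hd _ (hα.trans (le_add_of_nonneg_right ?_))).1 k, ih _ hα]
        rw [← hsing]
        exact smul_nonneg (by positivity) (intExp_nonneg _)
  refine ⟨w d, ?_⟩
  have hpD : p = MvPolynomial.C (w d) * D := by
    refine MvPolynomial.funext_set
      (fun i => (fun m : ℕ => ((d i + N * m : ℤ) : K)) '' Set.univ)
      (fun i => Set.infinite_univ.image ?_) fun x hx => ?_
    · refine Function.Injective.injOn fun m m' hmm => ?_
      have h1 := Int.cast_injective (α := K) hmm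
      have h2 : (N : ℤ) * m = N * m' := by linarith
      exact_mod_cast mul_left_cancel₀ (by exact_mod_cast hN) h2
    · choose m _ hm using fun i => hx i (Set.mem_univ i)
      have h1 : x = fun i => (((d + (N : ℤ) • intExp (Finsupp.equivFunOnFinite.symm m)) i : ℤ) : K) :=
        funext fun i => by rw [← hm i]; simp
      rw [h1]
      change ev _ p = ev _ _
      rw [map_mul, ev_C, ← (hd _ (le_add_of_nonneg_right (smul_nonneg (by positivity)
        (intExp_nonneg _)))).2, hper _ d le_rfl, mul_comm]
  filter_upwards [hp, eventually_ev_ne_zero hD] with α h1 h2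
  rw [hpD, map_mul, ev_C, mul_comm] at h1
  exact mul_right_cancel₀ h2 h1

end Periodic

/-! ### Images of xᵢ and Hᵢ modulo 𝔞ₙ -/

section ImagesOfGenerators

variable {K : Type*} [Field K] [CharZero K] {n : ℕ}

theorem red_map_eq_red_map (σ : JacAut K n) {a b : Jac K n} (h : red K n a = red K n b) :
    red K n (σ a) = red K n (σ b) := by
  rw [← xi_red aIdealStable, ← xi_red aIdealStable, h]

theorem red_map_xEl_mul_yEl (σ : JacAut K n) (i : Fin n) :
    red K n (σ (xEl K i)) * red K n (σ (yEl K i)) = 1 := by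
  rw [← map_mul, ← map_mul, ← map_one (red K n), ← map_one σ]
  refine red_map_eq_red_map σ ?_
  rw [map_mul, map_one, red_xEl_mul_yEl]

theorem exists_map_xEl_form (σ : JacAut K n) (i : Fin n) :
    ∃ (γ : Fin n → ℤ) (l : K), l ≠ 0 ∧ ∃ e, ∀ᶠ α in atTop,
      (σ (xEl K i)).1 (zm K α) = (l * lamProd e α) • zm K (α + γ) :=
  isUnit_red_form (red_map_xEl_mul_yEl σ i)

/-- Both Hᵢ and Hᵢ + 1 are units, so their images are each a single shift far out. A nonzero shift
in σ(Hᵢ) would leave σ(Hᵢ) + 1 with two different shifts. -/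
theorem exists_map_hEl_form (σ : JacAut K n) (i : Fin n) :
    ∃ l : K, l ≠ 0 ∧ ∃ e, ∀ᶠ α in atTop,
      (σ (hEl K i)).1 (zm K α) = (l * lamProd e α) • zm K α := by
  obtain ⟨γ, l, hl, e, h⟩ := isUnit_red_form (a := σ (hEl K i)) (b := σ (hInvEl K i))
    (by rw [← map_mul, ← map_mul, hEl_mul_hInvEl, map_one, map_one])
  obtain ⟨v, hv⟩ := exists_unit_hEl_add (K := K) i 1
  obtain ⟨γ', l', hl', e', h'⟩ := isUnit_red_form (a := σ (hEl K i + 1))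
    (b := σ ((v⁻¹ : (Jac K n)ˣ) : Jac K n)) (by
      have : hEl K i + 1 = (v : Jac K n) := by rw [hv]; simp
      rw [this, ← map_mul, ← map_mul, Units.mul_inv, map_one, map_one])
  obtain ⟨α, h1, h2, h3, h4, h5⟩ := (h.and (h'.and (eventually_nonneg.and
    ((eventually_nonneg_add γ).and (eventually_nonneg_add γ'))))).exists
  have hγ : γ = 0 := by
    by_contra hne
    rw [map_add, map_one, jac_add_apply, jac_one_apply, h1] at h2
    have hc := fun β : Fin n → ℤ => congrArg (MvPolynomial.coeff (natExp β)) h2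
    simp only [MvPolynomial.coeff_add, MvPolynomial.coeff_smul, smul_eq_mul] at hc
    have hl1 : l * lamProd e α ≠ 0 := mul_ne_zero hl (lamProd_ne_zero e α)
    have hcγ := hc (α + γ)
    have hc0 := hc α
    rw [coeff_zm K h4, coeff_zm K h4, coeff_zm K h4] at hcγ
    rw [coeff_zm K h3, coeff_zm K h3, coeff_zm K h3] at hc0
    rw [if_pos rfl, if_neg (by simpa using hne)] at hcγ
    rw [if_neg (by simpa using hne), if_pos rfl] at hc0
    by_cases hγ' : γ' = 0
    · rw [hγ', if_neg (by simpa using hne)] at hcγ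
      simp [hl, lamProd_ne_zero e α] at hcγ
    · rw [if_neg (by simpa using hγ')] at hc0
      simp at hc0
  refine ⟨l, hl, e, ?_⟩
  filter_upwards [h] with α h1
  rw [h1, hγ, add_zero]

/-- The operator σ(Hᵢ) is conjugate to Hᵢ by φ, so it has the same eigenvalues. -/
theorem map_hEl_eigenvalue (σ : JacAut K n) (i : Fin n) {c : K} {p : MvPolynomial (Fin n) K}
    (hp : p ≠ 0) (h : (σ (hEl K i)).1 p = c • p) : ∃ m : ℕ, c = m + 1 := by
  obtain ⟨φ, hφ⟩ := exists_intertwines σ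
  obtain ⟨q, rfl⟩ := φ.surjective p
  rw [← hφ, ← map_smul] at h
  have h1 := φ.injective h
  have hq : q ≠ 0 := by rintro rfl; simp at hp
  obtain ⟨β, hβ⟩ := MvPolynomial.ne_zero_iff.1 hq
  refine ⟨β i, ?_⟩
  have h2 : (hEl K i).1 q = ∑ γ ∈ q.support, (q.coeff γ * (γ i + 1 : K)) • zm K (intExp γ) := by
    conv_lhs => rw [eq_sum_zm q]
    rw [map_sum]
    refine Finset.sum_congr rfl fun γ _ => ?_
    rw [map_smul, hEl_zm, smul_smul]
    simp
  have h3 := congrArg (MvPolynomial.coeff β) (h2.symm.trans h1)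
  rw [MvPolynomial.coeff_sum, Finset.sum_eq_single β] at h3
  · rw [zm_intExp, MvPolynomial.coeff_smul, MvPolynomial.coeff_smul, MvPolynomial.coeff_monomial,
      if_pos rfl, smul_eq_mul, smul_eq_mul, mul_one, mul_comm c] at h3
    exact (mul_left_cancel₀ hβ h3).symm
  · intro γ _ hγ
    rw [zm_intExp, MvPolynomial.coeff_smul, MvPolynomial.coeff_monomial, if_neg hγ, smul_zero]
  · intro h4
    exact absurd (MvPolynomial.mem_support_iff.2 hβ) h4

theorem hEl_mul_xEl_sub (i j : Fin n) :
    hEl K i * xEl K j - xEl K j * hEl K i = (if i = j then (1 : K) else 0) • xEl K j :=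
  jac_ext fun α h => by
    rw [jac_sub_apply, jac_mul_apply, jac_mul_apply, jac_smul_apply, xEl_zm j h, hEl_zm, hEl_zm,
      map_smul, xEl_zm j h, ← sub_smul]
    congr 1
    by_cases hij : i = j
    · subst hij; simp
    · simp [hij]

/-- The exponents of the classes of `σ(xⱼ)` and the eigenvalues of `σ(Hᵢ)`. -/
theorem eigenvalue_shift (σ : JacAut K n) {i j : Fin n} {γ : Fin n → ℤ}
    {u v : (Fin n → ℤ) → K} (hv : ∀ᶠ α in atTop, v α ≠ 0)
    (hx : ∀ᶠ α in atTop, (σ (xEl K j)).1 (zm K α) = v α • zm K (α + γ))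
    (hu : ∀ᶠ α in atTop, (σ (hEl K i)).1 (zm K α) = u α • zm K α) :
    ∀ᶠ α in atTop, u (α + γ) = u α + if i = j then 1 else 0 := by
  have h := congrArg σ (hEl_mul_xEl_sub (K := K) i j)
  rw [jacAut_sub, map_mul, map_mul, map_smul] at h
  filter_upwards [hx, hu, eventually_add hu γ, hv, eventually_nonneg_add γ] with α h1 h2 h3 h4 h5
  have h6 := congrArg (fun a : Jac K n => a.1 (zm K α)) h
  simp only [jac_sub_apply, jac_mul_apply, jac_smul_apply, h1, h2, map_smul, h3, smul_smul,
    ← sub_smul] at h6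
  have h7 := smul_left_injective K (zm_ne_zero K h5) h6
  refine mul_left_cancel₀ h4 ?_
  linear_combination h7

/-- A rational function which is additive along a lattice of full rank is affine. -/
theorem exists_affine {u : Fin n → (Fin n → ℤ) → K} (hu : ∀ i, Rat (u i)) {A : Fin n → Fin n → ℤ}
    (h : ∀ i j, ∀ᶠ α in atTop, u i (α + A j) = u i α + if i = j then 1 else 0) (i : Fin n) :
    ∃ (N : ℕ) (c : Fin n → ℤ) (w : K), N ≠ 0 ∧
      ∀ᶠ α in atTop, (N : K) * u i α = ∑ k, (c k : K) * (α k : K) + w := by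
  have hlin : ∀ (i : Fin n) (b : Fin n → ℤ),
      ∀ᶠ α in atTop, u i (α + ∑ j, b j • A j) = u i α + (b i : K) := by
    intro i
    let S : AddSubgroup (Fin n → ℤ) :=
      { carrier := {b | ∀ᶠ α in atTop, u i (α + ∑ j, b j • A j) = u i α + (b i : K)}
        zero_mem' := by simp
        add_mem' := by
          intro b c hb hc
          filter_upwards [hb, eventually_add hc (∑ j, b j • A j)] with α h1 h2
          simp only [Pi.add_apply, add_smul, Finset.sum_add_distrib]
          rw [← add_assoc, h2, h1]
          push_cast; ring
        neg_mem' := by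
          intro b hb
          filter_upwards [eventually_add hb (-∑ j, b j • A j)] with α h1
          simp only [Pi.neg_apply, neg_smul, Finset.sum_neg_distrib]
          rw [neg_add_cancel_right] at h1
          rw [h1]
          push_cast; ring }
    have hS : S = ⊤ := addSubgroup_eq_top S fun j => by
      change ∀ᶠ α in atTop, _
      filter_upwards [h i j] with α h1
      have h2 : ∑ k, (Pi.single j 1 : Fin n → ℤ) k • A k = A j := by
        rw [Finset.sum_eq_single j] <;> simp +contextual
      rw [h2, h1]
      by_cases hij : i = j
      · subst hij; simp
      · simp [hij]
    exact fun b => (hS ▸ AddSubgroup.mem_top b : b ∈ S)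
  -- A linear relation among the shifts would force each of its coefficients to vanish by additivity
  -- of the corresponding `u i`.
  have hdet : (Matrix.of A).det ≠ 0 := by
    intro h0
    obtain ⟨b, hb, hbA⟩ := Matrix.exists_vecMul_eq_zero_iff.2 h0
    refine hb (funext fun i => ?_)
    have h1 : ∑ j, b j • A j = 0 := by
      rw [← hbA]
      ext k
      simp [Matrix.vecMul, dotProduct]
    obtain ⟨α, h2⟩ := (hlin i b).exists
    rw [h1, add_zero, left_eq_add] at h2
    exact_mod_cast h2
  set d := (Matrix.of A).det
  -- The adjugate expresses |det A| times each basis vector as an integral combination of the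
  -- shifts; the sign makes the multiple a natural number.
  have hadj : ∀ k, ∑ j, (d.sign * (Matrix.of A).adjugate k j) • A j =
      Pi.single k (d.natAbs : ℤ) := by
    intro k
    have h1 := Matrix.adjugate_mul (Matrix.of A)
    ext m
    have h2 := congrFun (congrFun h1 k) m
    rw [Matrix.mul_apply] at h2
    simp only [Finset.sum_apply, Pi.smul_apply, smul_eq_mul, mul_assoc]
    rw [← Finset.mul_sum]
    simp only [Matrix.of_apply] at h2
    rw [h2, Matrix.smul_apply, Matrix.one_apply]
    by_cases hkm : k = m
    · subst hkm
      simp only [if_true, smul_eq_mul, mul_one, Pi.single_eq_same]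
      exact Int.sign_mul_self d
    · simp [hkm, Ne.symm hkm]
  let c : Fin n → ℤ := fun k => d.sign * (Matrix.of A).adjugate k i
  have hc : ∀ k, ∀ᶠ α in atTop, u i (α + Pi.single k (d.natAbs : ℤ)) = u i α + (c k : K) := by
    intro k
    have := hlin i fun j => d.sign * (Matrix.of A).adjugate k j
    rwa [hadj] at this
  -- Subtracting the linear part leaves a rational function periodic under |det A|·ℤⁿ, hence
  -- eventually constant.
  have hrat : Rat fun α => (d.natAbs : K) * u i α - ∑ k, (c k : K) * (α k : K) :=
    ((hu i).const_mul _).sub (rat_sum _ fun k _ => (rat_apply k).const_mul _)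
  obtain ⟨w, hw⟩ := hrat.eventually_const_of_periodic (N := d.natAbs) (by simpa using hdet)
    fun k => by
      filter_upwards [hc k] with α h1
      rw [h1]
      simp only [Pi.add_apply, Int.cast_add, mul_add, Finset.sum_add_distrib]
      have h2 : ∑ m, (c m : K) * (((Pi.single k (d.natAbs : ℤ) : Fin n → ℤ) m : ℤ) : K) =
          c k * (d.natAbs : K) := by
        rw [Finset.sum_eq_single k]
        · simp
        · intro m _ hm
          simp [hm]
        · simp
      rw [h2]
      ring
  refine ⟨d.natAbs, c, w, by simpa using hdet, ?_⟩
  filter_upwards [hw] with α h1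
  rw [← h1]; ring

theorem lamProd_add_single (e : Fin n → ℤ →₀ ℤ) (α : Fin n → ℤ) (k : Fin n) :
    lamProd (K := K) e (α + Pi.single k 1) * lam K (e k) (α k) =
      lamProd e α * lam K (e k) (α k + 1) := by
  rw [lamProd, lamProd, ← Finset.mul_prod_erase _ _ (Finset.mem_univ k),
    ← Finset.mul_prod_erase (a := k) _ (fun k => lam K (e k) (α k)) (Finset.mem_univ k)]
  have : ∏ x ∈ Finset.univ.erase k, lam K (e x) ((α + Pi.single k 1 : Fin n → ℤ) x) =
      ∏ x ∈ Finset.univ.erase k, lam K (e x) (α x) := by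
    refine Finset.prod_congr rfl fun m hm => ?_
    simp [Finset.ne_of_mem_erase hm]
  rw [this]
  simp only [Pi.add_apply, Pi.single_eq_same]
  ring

/-- An affine function which is a product of powers of linear forms `αₖ + j` depends on one variable
only. -/
theorem affine_lamProd {l : K} (hl : l ≠ 0) {e : Fin n → ℤ →₀ ℤ} {N : ℕ} (hN : N ≠ 0)
    {c : Fin n → ℤ} {w : K}
    (h : ∀ᶠ α in atTop, (N : K) * (l * lamProd e α) = ∑ k, (c k : K) * (α k : K) + w)
    {a b : Fin n} (hab : a ≠ b) (ha : c a ≠ 0) : c b = 0 := by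
  have hN' : (N : K) ≠ 0 := by exact_mod_cast hN
  have hsum : ∀ (α : Fin n → ℤ) (k : Fin n),
      ∑ m, (c m : K) * (((α + Pi.single k 1 : Fin n → ℤ) m : ℤ) : K) = ∑ m, (c m : K) * (α m : K) + c k := by
    intro α k
    simp only [Pi.add_apply, Int.cast_add, mul_add, Finset.sum_add_distrib]
    congr 1
    rw [Finset.sum_eq_single k]
    · simp
    · intro m _ hm
      simp [hm]
    · simp
  have hstep : ∀ k, ∀ᶠ α in atTop,
      (N : K) * (l * lamProd e (α + Pi.single k 1)) = N * (l * lamProd e α) + c k := by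
    intro k
    filter_upwards [h, eventually_add h (Pi.single k 1)] with α h1 h2
    rw [h1, h2, hsum]
    ring
  have hzero : ∀ k, e k = 0 → c k = 0 := by
    intro k hk
    obtain ⟨α, h1⟩ := (hstep k).exists
    have h2 := lamProd_add_single (K := K) e α k
    rw [hk, lam_zero, lam_zero, mul_one, mul_one] at h2
    rw [h2, left_eq_add] at h1
    exact_mod_cast h1
  -- The mixed second difference in directions a and b vanishes for an affine function. For a
  -- product of functions of single variables it is a nonzero multiple of the product of the two
  -- one-variable differences.
  have hor : ∀ᶠ α : Fin n → ℤ in atTop, lam K (e a) (α a + 1) = lam K (e a) (α a) ∨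
      lam K (e b) (α b + 1) = lam K (e b) (α b) := by
    filter_upwards [hstep a, eventually_add (hstep a) (Pi.single b 1)] with α h1 h2
    have h3 := lamProd_add_single (K := K) e α a
    have h4 := lamProd_add_single (K := K) e α b
    have h5 := lamProd_add_single (K := K) e (α + Pi.single b 1) a
    have h6 : (α + Pi.single b 1 : Fin n → ℤ) a = α a := by simp [hab]
    rw [h6] at h5
    have h7 := lamProd_ne_zero (K := K) e α
    have h8 := lam_ne_zero (K := K) (e a) (α a)
    have h9 := lam_ne_zero (K := K) (e b) (α b)
    generalize lamProd (K := K) e (α + Pi.single b 1 + Pi.single a 1) = P₁ at *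
    generalize lamProd (K := K) e (α + Pi.single b 1) = P₂ at *
    generalize lamProd (K := K) e (α + Pi.single a 1) = P₃ at *
    generalize lamProd (K := K) e α = P₄ at *
    generalize lam K (e a) (α a + 1) = A' at *
    generalize lam K (e a) (α a) = A₀ at *
    generalize lam K (e b) (α b + 1) = B' at *
    generalize lam K (e b) (α b) = B₀ at *
    have h10 : P₁ - P₂ = P₃ - P₄ := by
      have : (N : K) * l * (P₁ - P₂ - (P₃ - P₄)) = 0 := by linear_combination h2 - h1
      rcases mul_eq_zero.1 this with h11 | h11
      · exact absurd h11 (mul_ne_zero hN' hl)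
      · exact sub_eq_zero.1 h11
    have h11 : P₄ * ((A' - A₀) * (B' - B₀)) = 0 := by
      linear_combination A₀ * B₀ * h10 - B₀ * h5 - (A' - A₀) * h4 + B₀ * h3
    rcases mul_eq_zero.1 h11 with h12 | h12
    · exact absurd h12 h7
    · rcases mul_eq_zero.1 h12 with h13 | h13
      · exact Or.inl (sub_eq_zero.1 h13)
      · exact Or.inr (sub_eq_zero.1 h13)
  by_cases hea : e a = 0
  · exact absurd (hzero a hea) ha
  · refine hzero b ?_
    -- Since `e a` is nonzero, its factor changes at some far point z. Freezing the coordinate a at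
    -- z forces the factor of b to be 1-periodic far out, hence trivial.
    have hfreq : ¬ ∀ᶠ z in atTop, lam K (e a) (z + 1) = lam K (e a) z := fun h' =>
      hea (eq_zero_of_lam_shift (K := K) (c := 1) (by simpa using h'))
    obtain ⟨d, hd⟩ := eventually_atTop.1 hor
    rw [not_eventually] at hfreq
    obtain ⟨z, hz, hz'⟩ := (hfreq.and_eventually (eventually_ge_atTop (d a))).exists
    refine eq_zero_of_lam_shift (K := K) (c := 1) ?_
    filter_upwards [eventually_ge_atTop (d b)] with y hy
    rcases hd (Function.update (Function.update d a z) b y) (by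
      intro k
      by_cases hk : k = b
      · subst hk; simpa using hy
      · by_cases hk' : k = a
        · subst hk'; simpa [hk] using hz'
        · simp [hk, hk']) with h1 | h1
    · rw [Function.update_of_ne hab, Function.update_self] at h1
      exact absurd h1 hz
    · rw [Function.update_self] at h1
      rw [h1, one_mul]

end ImagesOfGenerators

/-! ### The permutation attached to an automorphism -/

section Permutation

variable {K : Type*} [Field K] [CharZero K] {n : ℕ}

/-- A product of powers of linear forms which is affine, integral, positive and additive along a
lattice of full rank is a translated coordinate. -/
theorem exists_eq_coordinate {l : K} (hl : l ≠ 0) {e : Fin n → ℤ →₀ ℤ} {N : ℕ} (hN : N ≠ 0)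
    {c : Fin n → ℤ} {w : K}
    (haff : ∀ᶠ α in atTop, (N : K) * (l * lamProd e α) = ∑ k, (c k : K) * (α k : K) + w)
    (hnat : ∀ᶠ α in atTop, ∃ m : ℕ, l * lamProd e α = (m + 1 : K))
    {A : Fin n → Fin n → ℤ} {i : Fin n}
    (hA : ∀ j, ∀ᶠ α in atTop, l * lamProd (K := K) e (α + A j) =
      l * lamProd e α + if i = j then 1 else 0) :
    ∃ (k : Fin n) (q : ℤ), (∀ᶠ α in atTop, l * lamProd e α = (α k + q : K)) ∧
      ∀ j, A j k = if i = j then 1 else 0 := by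
  have hN' : (N : K) ≠ 0 := by exact_mod_cast hN
  have hcA : ∀ j, ∑ k, c k * A j k = N * if i = j then 1 else 0 := by
    intro j
    obtain ⟨α, h1, h2, h3⟩ := (haff.and ((eventually_add haff (A j)).and (hA j))).exists
    rw [h3, mul_add, h1] at h2
    simp only [Pi.add_apply, Int.cast_add, mul_add, Finset.sum_add_distrib] at h2
    have h4 : ((∑ k, c k * A j k : ℤ) : K) = ((N * if i = j then 1 else 0 : ℤ) : K) := by
      push_cast
      linear_combination -h2
    exact_mod_cast h4
  obtain ⟨k, hk⟩ : ∃ k, c k ≠ 0 := by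
    by_contra! h
    have := hcA i
    simp [h, hN, eq_comm] at this
  have hother : ∀ b, b ≠ k → c b = 0 := fun b hb => affine_lamProd hl hN haff (Ne.symm hb) hk
  have hcA' : ∀ j, c k * A j k = N * if i = j then 1 else 0 := fun j => by
    rw [← hcA, Finset.sum_eq_single k]
    · intro b _ hb; rw [hother b hb, zero_mul]
    · simp
  have haff' : ∀ᶠ α in atTop, (N : K) * (l * lamProd e α) = (c k : K) * (α k : K) + w := by
    filter_upwards [haff] with α h1
    rw [h1, Finset.sum_eq_single k]
    · intro b _ hb; simp [hother b hb]
    · simp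
  obtain ⟨d, hd⟩ := eventually_atTop.1 (haff'.and hnat)
  have hge : ∀ z : ℤ, 0 ≤ z → d ≤ d + Pi.single k z := fun z hz =>
    le_add_of_nonneg_right (Pi.single_nonneg.2 hz)
  obtain ⟨h1, m₀, hm₀⟩ := hd d le_rfl
  obtain ⟨h2, m₁, hm₁⟩ := hd _ (hge 1 zero_le_one)
  -- Two neighbouring values are integers and differ by c k / N, so N divides c k.
  obtain ⟨c', hc'⟩ : ∃ c' : ℤ, c k = N * c' := by
    refine ⟨m₁ - m₀, ?_⟩
    have h3 : ((c k : ℤ) : K) = ((N * (m₁ - m₀) : ℤ) : K) := by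
      rw [hm₁] at h2
      rw [hm₀] at h1
      simp only [Pi.add_apply, Pi.single_eq_same] at h2
      push_cast at h2 ⊢
      linear_combination h1 - h2
    exact_mod_cast h3
  have hval : ∀ α, d ≤ α → l * lamProd e α = (m₀ + 1 + c' * (α k - d k) : K) := by
    intro α hα
    have h3 := (hd α hα).1
    rw [hm₀] at h1
    rw [hc'] at h1 h3
    push_cast at h1 h3
    refine mul_left_cancel₀ hN' ?_
    linear_combination h3 - h1
  have hc'A : ∀ j, c' * A j k = if i = j then 1 else 0 := fun j => by
    have h3 := hcA' j
    rw [hc', mul_assoc] at h3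
    exact mul_left_cancel₀ (by exact_mod_cast hN) h3
  have hc1 : c' = 1 := by
    have h3 := hc'A i
    rw [if_pos rfl] at h3
    rcases Int.eq_one_or_neg_one_of_mul_eq_one h3 with h4 | h4
    · exact h4
    · exfalso
      -- With slope -1 the value drops from m₀ + 1 to 0 after m₀ + 1 steps, contradicting
      -- positivity.
      have h5 := hge (m₀ + 1) (by positivity)
      obtain ⟨m, hm⟩ := (hd _ h5).2
      rw [hval _ h5, h4] at hm
      simp only [Pi.add_apply, Pi.single_eq_same] at hm
      push_cast at hm
      have h6 : ((m + 1 : ℕ) : K) = 0 := by push_cast; linear_combination -hm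
      exact absurd h6 (by exact_mod_cast Nat.succ_ne_zero m)
  refine ⟨k, m₀ + 1 - d k, ?_, fun j => by rw [← hc'A, hc1, one_mul]⟩
  filter_upwards [eventually_ge_atTop d] with α hα
  rw [hval α hα, hc1]
  push_cast
  ring

/-- Write Aⱼ for the shift of σ(xⱼ). If σ(Hᵢ) reads the coordinate τ(i), then Aⱼ has entry δᵢⱼ at
τ(i). This makes τ injective, hence a permutation, and Aⱼ is the basis vector at τ(j). -/
theorem exists_perm_form (σ : JacAut K n) :
    ∃ (τ : Equiv.Perm (Fin n)) (m : Fin n → ℤ) (l : Fin n → K) (e : Fin n → Fin n → ℤ →₀ ℤ),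
      (∀ i, l i ≠ 0) ∧
      (∀ i, ∀ᶠ α in atTop, (σ (hEl K i)).1 (zm K α) = (α (τ i) + 1 + m i : K) • zm K α) ∧
      ∀ i, ∀ᶠ α in atTop,
        (σ (xEl K i)).1 (zm K α) = (l i * lamProd (e i) α) • zm K (α + Pi.single (τ i) 1) := by
  choose A lx hlx ex hx using exists_map_xEl_form σ
  choose lh hlh eh hh using exists_map_hEl_form σ
  have hA : ∀ i j, ∀ᶠ α in atTop, lh i * lamProd (K := K) (eh i) (α + A j) =
      lh i * lamProd (eh i) α + if i = j then 1 else 0 := fun i j =>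
    eigenvalue_shift σ (Eventually.of_forall fun α => mul_ne_zero (hlx j) (lamProd_ne_zero _ α))
      (hx j) (hh i)
  have hrat : ∀ i, Rat fun α => lh i * lamProd (K := K) (eh i) α := fun i =>
    rat_of_eventually (a := σ (hEl K i)) (δ := 0) (by simpa using hh i)
  have hk : ∀ i, ∃ (k : Fin n) (q : ℤ), (∀ᶠ α in atTop,
      lh i * lamProd (eh i) α = (α k + q : K)) ∧ ∀ j, A j k = if i = j then 1 else 0 := by
    intro i
    obtain ⟨N, c, w, hN, hw⟩ := exists_affine hrat hA i
    refine exists_eq_coordinate (hlh i) hN hw ?_ (hA i)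
    filter_upwards [hh i, eventually_nonneg] with α h1 h2
    exact map_hEl_eigenvalue σ i (zm_ne_zero K h2) h1
  choose τ₀ q hq hAτ using hk
  have hinj : Function.Injective τ₀ := by
    intro i i' h
    have h1 := hAτ i i
    rw [h, hAτ i' i, if_pos rfl] at h1
    by_contra h2
    rw [if_neg (Ne.symm h2)] at h1
    exact zero_ne_one h1
  let τ : Equiv.Perm (Fin n) := Equiv.ofBijective τ₀ (Finite.injective_iff_bijective.1 hinj)
  have hAs : ∀ i, A i = Pi.single (τ i) 1 := by
    intro i
    ext k
    obtain ⟨j, rfl⟩ := τ.surjective k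
    have h1 : A i (τ j) = if j = i then 1 else 0 := hAτ j i
    rw [h1]
    by_cases hij : j = i
    · subst hij; simp
    · rw [if_neg hij, Pi.single_eq_of_ne (τ.injective.ne hij)]
  refine ⟨τ, fun i => q i - 1, lx, ex, hlx, fun i => ?_, fun i => ?_⟩
  · filter_upwards [hh i, hq i] with α h1 h2
    rw [h1, h2]
    congr 1
    change _ = ((α (τ₀ i) : ℤ) : K) + 1 + _
    push_cast
    ring
  · rw [← hAs]; exact hx i

end Permutation

/-! ### Dimension counts in boxes of monomials -/

section Counting

variable {K : Type*} [Field K] {n : ℕ}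

variable (K) in
/-- The span of the monomials with exponents bounded by `c`. -/
def boxSpan (c : Fin n → ℤ) : Submodule K (MvPolynomial (Fin n) K) :=
  Submodule.span K (zm K '' Set.Iic c)

theorem zm_mem_boxSpan {α c : Fin n → ℤ} (h : α ≤ c) : zm K α ∈ boxSpan K c :=
  Submodule.subset_span ⟨α, h, rfl⟩

theorem boxSpan_mono {c c' : Fin n → ℤ} (h : c ≤ c') : boxSpan K c ≤ boxSpan K c' :=
  Submodule.span_mono (Set.image_mono (Set.Iic_subset_Iic.2 h))

/-- An element of 𝔸ₙ raises every exponent by at most a constant, uniformly over all monomials and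
not only far out. -/
theorem exists_degree_bound [CharZero K] (a : Jac K n) :
    ∃ R : ℕ, ∀ c p, p ∈ boxSpan K c → a.1 p ∈ boxSpan K (c + fun _ => (R : ℤ)) := by
  have hspan : ∀ (a : Jac K n) (R : ℕ),
      (∀ α, a.1 (zm K α) ∈ boxSpan K (α + fun _ => (R : ℤ))) →
      ∀ c p, p ∈ boxSpan K c → a.1 p ∈ boxSpan K (c + fun _ => (R : ℤ)) := by
    intro a R h c p hp
    induction hp using Submodule.span_induction with
    | mem x hx =>
      obtain ⟨α, hα, rfl⟩ := hx
      exact boxSpan_mono (add_le_add_left hα _) (h α)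
    | zero => rw [map_zero]; exact zero_mem _
    | add x y _ _ hx hy => rw [map_add]; exact add_mem hx hy
    | smul c x _ hx => rw [map_smul]; exact Submodule.smul_mem _ _ hx
  induction a using jac_induction with
  | hx i =>
    refine ⟨1, hspan _ _ fun α => ?_⟩
    by_cases h : 0 ≤ α
    · rw [xEl_zm i h]
      refine zm_mem_boxSpan (add_le_add_right (fun j => ?_) _)
      by_cases hj : j = i
      · subst hj; simp
      · simp [hj]
    · rw [zm_of_not_nonneg K h, map_zero]; exact zero_mem _
  | hd i =>
    refine ⟨0, hspan _ _ fun α => ?_⟩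
    rw [dEl_zm]
    refine Submodule.smul_mem _ _ (zm_mem_boxSpan ?_)
    exact (sub_le_self _ (single_nonneg i)).trans (le_add_of_nonneg_right fun _ => by simp)
  | hh i =>
    refine ⟨0, hspan _ _ fun α => ?_⟩
    rw [hInvEl_zm]
    exact Submodule.smul_mem _ _ (zm_mem_boxSpan (le_add_of_nonneg_right fun _ => by simp))
  | hc c =>
    refine ⟨0, hspan _ _ fun α => ?_⟩
    rw [jac_algebraMap_apply]
    exact Submodule.smul_mem _ _ (zm_mem_boxSpan (le_add_of_nonneg_right fun _ => by simp))
  | hadd a b ha hb =>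
    obtain ⟨R, hR⟩ := ha
    obtain ⟨S, hS⟩ := hb
    refine ⟨R + S, fun c p hp => ?_⟩
    rw [jac_add_apply]
    refine add_mem (boxSpan_mono (fun j => ?_) (hR c p hp)) (boxSpan_mono (fun j => ?_) (hS c p hp))
    · simp
    · simp
  | hmul a b ha hb =>
    obtain ⟨R, hR⟩ := ha
    obtain ⟨S, hS⟩ := hb
    refine ⟨S + R, fun c p hp => ?_⟩
    have := hR _ _ (hS c p hp)
    rw [jac_mul_apply]
    convert this using 2
    ext j
    simp [add_assoc]

theorem linearIndependent_zm (s : Finset (Fin n → ℤ)) (hs : ∀ α ∈ s, 0 ≤ α) :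
    LinearIndependent K fun α : s => zm K α.1 := by
  have h : (fun α : s => zm K α.1) =
      (MvPolynomial.basisMonomials (Fin n) K) ∘ fun α : s => natExp α.1 := by
    ext1 α
    rw [zm_of_nonneg K (hs _ α.2)]
    rfl
  rw [h]
  refine (MvPolynomial.basisMonomials (Fin n) K).linearIndependent.comp _ fun α β hαβ => ?_
  exact Subtype.ext (natExp_injOn (hs _ α.2) (hs _ β.2) hαβ)

theorem card_le_of_map_boxSpan (φ : MvPolynomial (Fin n) K ≃ₗ[K] MvPolynomial (Fin n) K)
    {a b c : Fin n → ℤ} (ha : 0 ≤ a)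
    (h : ∀ α ∈ Finset.Icc a b, φ (zm K α) ∈ boxSpan K c) :
    (Finset.Icc a b).card ≤ (Finset.Icc 0 c).card := by
  classical
  have hli : LinearIndependent K fun α : Finset.Icc a b => φ (zm K α.1) :=
    (linearIndependent_zm (Finset.Icc a b) fun α hα => ha.trans (Finset.mem_Icc.1 hα).1).map'
      φ.toLinearMap φ.ker
  have hspan : boxSpan K c ≤
      Submodule.span K ((Finset.Icc 0 c).image (zm K) : Set (MvPolynomial (Fin n) K)) := by
    refine Submodule.span_le.2 ?_
    rintro _ ⟨α, hα, rfl⟩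
    by_cases h0 : 0 ≤ α
    · exact Submodule.subset_span (Finset.mem_image_of_mem _ (Finset.mem_Icc.2 ⟨h0, hα⟩))
    · rw [zm_of_not_nonneg K h0]; exact zero_mem _
  have h1 := linearIndependent_le_span_aux' _ hli
    (((Finset.Icc 0 c).image (zm K) : Finset _) : Set (MvPolynomial (Fin n) K)) (by
      rintro _ ⟨α, rfl⟩
      exact hspan (h _ α.2))
  simp only [Fintype.card_coe] at h1
  refine h1.trans ?_
  simpa using Finset.card_image_le

end Counting

/-! ### Vanishing of the integer shifts mᵢ -/

section Shift

variable {K : Type*} [Field K] [CharZero K] {n : ℕ}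

/-- A joint eigenvector of the operators `Hᵢ` is a multiple of a monomial. -/
theorem exists_eq_smul_zm {p : MvPolynomial (Fin n) K} {β : Fin n → ℤ} (hβ : 0 ≤ β)
    (h : ∀ i, (hEl K i).1 p = (β i + 1 : K) • p) : ∃ c : K, p = c • zm K β := by
  have hcoeff : ∀ (i : Fin n) (γ : Fin n →₀ ℕ),
      MvPolynomial.coeff γ ((hEl K i).1 p) = (γ i + 1 : K) * MvPolynomial.coeff γ p := by
    intro i γ
    have hlin : (MvPolynomial.lcoeff K γ).comp (hEl K i).1 =
        (γ i + 1 : K) • MvPolynomial.lcoeff K γ := by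
      refine (MvPolynomial.basisMonomials (Fin n) K).ext fun δ => ?_
      have h1 : (hEl K i).1 (MvPolynomial.monomial δ 1) =
          MvPolynomial.monomial δ ((δ i + 1 : K) * 1) := hOp_monomial K i δ 1
      simp only [MvPolynomial.coe_basisMonomials, LinearMap.comp_apply, LinearMap.smul_apply, h1,
        MvPolynomial.lcoeff_apply, MvPolynomial.coeff_monomial]
      split_ifs with hd
      · rw [hd]; simp
      · simp
    exact LinearMap.congr_fun hlin p
  refine ⟨MvPolynomial.coeff (natExp β) p, ?_⟩
  ext γ
  rw [MvPolynomial.coeff_smul, zm_of_nonneg K hβ, MvPolynomial.coeff_monomial]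
  split_ifs with hγ
  · rw [hγ]; simp
  · rw [smul_zero]
    by_contra hne
    apply hγ
    ext i
    have h1 := hcoeff i γ
    rw [h i, MvPolynomial.coeff_smul, smul_eq_mul] at h1
    have h2 := mul_right_cancel₀ hne h1
    have h3 : (β i : K) = ((γ i : ℤ) : K) := by push_cast; linear_combination h2
    have h4 : β i = γ i := by exact_mod_cast h3
    have : natExp β i = (β i).toNat := rfl
    rw [this, h4, Int.toNat_natCast]

/-- Pulling x^α back by φ gives a joint eigenvector of the Hᵢ with the eigenvalues of x^(α+m), hence
a multiple of that monomial. -/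
theorem eventually_map_zm_add {σ : JacAut K n}
    {φ : MvPolynomial (Fin n) K ≃ₗ[K] MvPolynomial (Fin n) K} (hφ : Intertwines φ σ)
    {m : Fin n → ℤ}
    (hm : ∀ i, ∀ᶠ α in atTop, (σ (hEl K i)).1 (zm K α) = (α i + 1 + m i : K) • zm K α) :
    ∀ᶠ α in atTop, ∃ c : K, φ (zm K (α + m)) = c • zm K α := by
  filter_upwards [eventually_all.2 hm, eventually_nonneg, eventually_nonneg_add m] with α h1 h0 h2
  obtain ⟨c, hc⟩ := exists_eq_smul_zm (p := φ.symm (zm K α)) h2 fun i => by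
    apply φ.injective
    rw [hφ, map_smul, φ.apply_symm_apply, h1 i]
    congr 1
    simp only [Pi.add_apply]
    push_cast
    ring
  have hc0 : c ≠ 0 := by
    rintro rfl
    rw [zero_smul, LinearEquiv.map_eq_zero_iff] at hc
    exact zm_ne_zero K h0 hc
  refine ⟨c⁻¹, ?_⟩
  have h3 := congrArg φ hc
  rw [φ.apply_symm_apply, map_smul] at h3
  rw [h3, smul_smul, inv_mul_cancel₀ hc0, one_smul]

theorem card_Icc_update (i : Fin n) (a b c d : ℤ) :
    (Finset.Icc (Function.update (fun _ => a) i b) (Function.update (fun _ => c) i d)).card =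
      (d + 1 - b).toNat * (c + 1 - a).toNat ^ (n - 1) := by
  rw [Pi.card_Icc, ← Finset.mul_prod_erase _ _ (Finset.mem_univ i)]
  simp only [Function.update_self, Int.card_Icc]
  congr 1
  rw [Finset.prod_congr rfl (g := fun _ => (c + 1 - a).toNat), Finset.prod_const,
    Finset.card_erase_of_mem (Finset.mem_univ i), Finset.card_univ, Fintype.card_fin]
  intro j hj
  rw [Function.update_of_ne (Finset.ne_of_mem_erase hj),
    Function.update_of_ne (Finset.ne_of_mem_erase hj)]

theorem exists_mul_pow_lt (C E k : ℕ) :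
    ∃ N : ℕ, C * (N + E + 1) ^ k < (C + 1) * (N + 1) ^ k := by
  -- By Bernoulli, ((N + 1)/(N + E + 1))^k is at least 1 - kE/(N + E + 1), which exceeds C/(C + 1)
  -- for this N.
  refine ⟨k * E * (C + 1), ?_⟩
  set N := k * E * (C + 1) with hN
  set S : ℚ := N + E + 1 with hS
  have hS0 : 0 < S := by positivity
  have hb := one_add_mul_le_pow (a := -(E / S : ℚ)) (by
    have : (E : ℚ) / S ≤ 1 := by
      rw [div_le_one hS0, hS]
      have : (0 : ℚ) ≤ N := by positivity
      linarith
    linarith) k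
  have h1 : (1 + -(E / S) : ℚ) = (N + 1) / S := by
    field_simp
    rw [hS]; ring
  have h2 : (C : ℚ) < (C + 1) * (1 + k * -(E / S)) := by
    have : ((k * E * (C + 1) : ℕ) : ℚ) < S := by
      rw [← hN, hS]
      have : (0 : ℚ) ≤ E := by positivity
      linarith
    push_cast at this
    have h3 : (k * E * (C + 1) : ℚ) / S < 1 := (div_lt_one hS0).2 this
    have h4 : ((C : ℚ) + 1) * (1 + k * -(E / S)) = C + 1 - (k * E * (C + 1) : ℚ) / S := by ring
    rw [h4]
    linarith
  have h5 : (C : ℚ) < (C + 1) * ((N + 1) / S) ^ k := by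
    rw [← h1]
    exact h2.trans_le (mul_le_mul_of_nonneg_left hb (by positivity))
  rw [div_pow, ← mul_div_assoc, lt_div_iff₀ (by positivity), hS] at h5
  exact_mod_cast h5

/-- If mᵢ > 0, the injective map φ compresses a long slab: its bounded i-th side loses mᵢ layers,
while the other n - 1 sides grow only by a constant independent of their length N. For large N the
image lies in a space of smaller dimension. -/
theorem shift_le_zero {σ : JacAut K n} {m : Fin n → ℤ}
    (hm : ∀ i, ∀ᶠ α in atTop, (σ (hEl K i)).1 (zm K α) = (α i + 1 + m i : K) • zm K α)
    (i : Fin n) : m i ≤ 0 := by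
  by_contra! hi
  obtain ⟨φ, hφ⟩ := exists_intertwines σ
  obtain ⟨d, hd⟩ := eventually_atTop.1 (eventually_map_zm_add hφ hm)
  obtain ⟨M, hM⟩ : ∃ M : ℕ, ∀ j, d j ≤ M ∧ m j ≤ M ∧ -m j ≤ M := by
    refine ⟨∑ j, ((d j).natAbs + (m j).natAbs), fun j => ?_⟩
    have := Finset.single_le_sum (f := fun j => (d j).natAbs + (m j).natAbs)
      (fun _ _ => Nat.zero_le _) (Finset.mem_univ j)
    omega
  have hlarge : ∀ β : Fin n → ℤ, (∀ j, 2 * (M : ℤ) ≤ β j) → φ (zm K β) ∈ boxSpan K (β - m) := by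
    intro β hβ
    obtain ⟨c, hc⟩ := hd (β - m) fun j => by
      have := hM j; have := hβ j
      simp only [Pi.sub_apply]
      omega
    rw [sub_add_cancel] at hc
    rw [hc]
    exact Submodule.smul_mem _ _ (zm_mem_boxSpan le_rfl)
  obtain ⟨R, hR⟩ := exists_degree_bound (σ (yEl K i ^ (2 * M)))
  -- Monomials with small i-th exponent are reached from far ones by yᵢ^(2M), and σ of this operator
  -- raises degrees by at most R.
  have hsmall : ∀ β : Fin n → ℤ, 0 ≤ β → (∀ j, j ≠ i → 2 * (M : ℤ) ≤ β j) →
      φ (zm K β) ∈ boxSpan K (β + Pi.single i (2 * M : ℤ) - m + fun _ => (R : ℤ)) := by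
    intro β h0 hβ
    have h1 : (yEl K i ^ (2 * M)).1 (zm K (β + Pi.single i (2 * M : ℤ))) = zm K β := by
      rw [yEl_pow_zm]
      congr 1
      push_cast
      rw [add_sub_cancel_right]
    rw [← h1, hφ]
    refine hR _ _ (hlarge _ fun j => ?_)
    by_cases hj : j = i
    · subst hj
      have := h0 j
      simpa using this
    · simpa [hj] using hβ j hj
  obtain ⟨N, hN⟩ := exists_mul_pow_lt (4 * M + R) (3 * M + R) (n - 1)
  -- The i-th side ends at 4M + R: the images of monomials with βᵢ < 2M have i-th exponent below 4M
  -- - mᵢ + R, within the target box. The other sides start at 2M and end at 2M + N; the bound M ≥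
  -- -mⱼ gives the target end N + 3M + R.
  have hcard := card_le_of_map_boxSpan φ
    (a := Function.update (fun _ => 2 * (M : ℤ)) i 0)
    (b := Function.update (fun _ => 2 * (M : ℤ) + N) i (4 * M + R))
    (c := Function.update (fun _ => (N : ℤ) + (3 * M + R)) i (4 * M + R - m i))
    (fun j => by
      by_cases hj : j = i
      · subst hj; simp
      · simp [hj]) fun β hβ => by
    obtain ⟨h1, h2⟩ := Finset.mem_Icc.1 hβ
    have hi1 : 0 ≤ β i := by simpa using h1 i
    have hi2 : β i ≤ 4 * M + R := by simpa using h2 i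
    have hj1 : ∀ j, j ≠ i → 2 * (M : ℤ) ≤ β j := fun j hj => by simpa [hj] using h1 j
    have hj2 : ∀ j, j ≠ i → β j ≤ 2 * (M : ℤ) + N := fun j hj => by simpa [hj] using h2 j
    by_cases hbig : 2 * (M : ℤ) ≤ β i
    · refine boxSpan_mono (fun j => ?_) (hlarge β fun j => ?_)
      · by_cases hj : j = i
        · subst hj
          simp only [Pi.sub_apply, Function.update_self]
          omega
        · have := hj2 j hj; have := hM j
          simp only [Pi.sub_apply, Function.update_of_ne hj]
          omega
      · by_cases hj : j = i
        · subst hj; exact hbig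
        · exact hj1 j hj
    · refine boxSpan_mono (fun j => ?_) (hsmall β (fun j => ?_) hj1)
      · by_cases hj : j = i
        · subst hj
          simp only [Pi.sub_apply, Pi.add_apply, Pi.single_eq_same, Function.update_self]
          omega
        · have := hj2 j hj; have := hM j
          simp only [Pi.sub_apply, Pi.add_apply, Pi.single_eq_of_ne hj, Function.update_of_ne hj]
          omega
      · by_cases hj : j = i
        · subst hj; exact hi1
        · have := hj1 j hj
          simp only [Pi.zero_apply]
          omega
  have hzero : (0 : Fin n → ℤ) = Function.update (fun _ => (0 : ℤ)) i 0 := by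
    ext j; by_cases hj : j = i <;> simp [Function.update_apply]
  rw [hzero, card_Icc_update, card_Icc_update] at hcard
  have e1 : (4 * (M : ℤ) + R + 1 - 0).toNat = 4 * M + R + 1 := by omega
  have e2 : (2 * (M : ℤ) + N + 1 - 2 * M).toNat = N + 1 := by omega
  have e3 : (4 * (M : ℤ) + R - m i + 1 - 0).toNat ≤ 4 * M + R := by omega
  have e4 : ((N : ℤ) + (3 * M + R) + 1 - 0).toNat = N + (3 * M + R) + 1 := by omega
  rw [e1, e2, e4] at hcard
  exact absurd (hN.trans_le hcard) (not_lt.2 (Nat.mul_le_mul_right _ e3))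

theorem map_hEl_symm_form {σ : JacAut K n} {τ : Equiv.Perm (Fin n)} {m : Fin n → ℤ}
    (hm : ∀ i, ∀ᶠ α in atTop, (σ (hEl K i)).1 (zm K α) = (α (τ i) + 1 + m i : K) • zm K α)
    (i : Fin n) :
    ∀ᶠ α in atTop, (σ.symm (hEl K i)).1 (zm K α) =
      (α (τ.symm i) + 1 + (-m (τ.symm i) : ℤ) : K) • zm K α := by
  have h1 : red K n (σ (hEl K (τ.symm i))) =
      red K n (hEl K i + algebraMap K _ (m (τ.symm i) : K)) := by
    rw [red_eq_iff]
    filter_upwards [hm (τ.symm i)] with α h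
    rw [h, jac_add_apply, hEl_zm, jac_algebraMap_apply, ← add_smul, Equiv.apply_symm_apply]
  have h2 := red_map_eq_red_map σ.symm h1
  rw [AlgEquiv.symm_apply_apply, red_eq_iff] at h2
  filter_upwards [h2] with α h
  rw [hEl_zm, map_add, AlgEquiv.commutes, jac_add_apply, jac_algebraMap_apply] at h
  rw [← sub_eq_iff_eq_add] at h
  rw [← h, ← sub_smul]
  congr 1
  push_cast
  ring

theorem shift_eq_zero {σ : JacAut K n} {m : Fin n → ℤ}
    (hm : ∀ i, ∀ᶠ α in atTop, (σ (hEl K i)).1 (zm K α) = (α i + 1 + m i : K) • zm K α)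
    (i : Fin n) : m i = 0 := by
  refine le_antisymm (shift_le_zero hm i) ?_
  have h := shift_le_zero (σ := σ.symm) (m := fun i => -m i) (fun j => ?_) i
  · simpa using h
  · exact map_hEl_symm_form (τ := 1) hm j

end Shift

/-! ### Generation of 𝔾ₙ by Sₙ, 𝕋ⁿ, 𝕌ₙ and ker ξ -/

section Generation

variable {K : Type*} [Field K] {n : ℕ}

theorem lamProd_eq_lam {e : Fin n → ℤ →₀ ℤ} {i : Fin n} (h : ∀ k, k ≠ i → e k = 0)
    (α : Fin n → ℤ) : lamProd e α = lam K (e i) (α i) := by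
  rw [lamProd, Finset.prod_eq_single i]
  · intro k _ hk; rw [h k hk, lam_zero]
  · simp

theorem xEl_commute (i k : Fin n) : xEl K i * xEl K k = xEl K k * xEl K i := by
  refine jac_ext fun α h => ?_
  rw [jac_mul_apply, jac_mul_apply, xEl_zm i h, xEl_zm k h, xEl_zm i, xEl_zm k, add_right_comm]
  · exact add_nonneg h (single_nonneg i)
  · exact add_nonneg h (single_nonneg k)

variable [CharZero K]

/-- A product of powers of linear forms which satisfies the commutation relation of two different
variables does not involve the other variable. -/
theorem lamProd_cocycle {e e' : Fin n → ℤ →₀ ℤ} {i k : Fin n} (hik : i ≠ k)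
    (h : ∀ᶠ α in atTop, lamProd (K := K) e (α + Pi.single k 1) * lamProd e' α =
      lamProd e' (α + Pi.single i 1) * lamProd e α) : e k = 0 := by
  obtain ⟨d, hd⟩ := eventually_atTop.1 h
  refine eq_zero_of_lam_shift (K := K) (c := lam K (e' i) (d i + 1) / lam K (e' i) (d i)) ?_
  filter_upwards [eventually_ge_atTop (d k)] with z hz
  -- Only the coordinate k varies, so the factors of e' at i are constants and the relation becomes
  -- a shift equation for `e k`.
  set α := Function.update d k z with hα
  have hαk : α k = z := Function.update_self ..
  have hαi : α i = d i := Function.update_of_ne hik ..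
  have h1 := hd α (le_update_self_iff.2 hz)
  have h2 := lamProd_add_single (K := K) e α k
  have h3 := lamProd_add_single (K := K) e' α i
  rw [hαk] at h2
  rw [hαi] at h3
  have h4 := lamProd_ne_zero (K := K) e α
  have h5 := lamProd_ne_zero (K := K) e' α
  rw [div_mul_eq_mul_div, eq_div_iff (lam_ne_zero _ _)]
  refine mul_left_cancel₀ (mul_ne_zero h4 h5) ?_
  linear_combination (-(lamProd e' α) * lam K (e' i) (d i)) * h2 +
    (lamProd e α * lam K (e k) z) * h3 + (lam K (e k) z * lam K (e' i) (d i)) * h1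

variable {s : Equiv.Perm (Fin n) →* JacAut K n} {t : (Fin n → Kˣ) →* JacAut K n}
  {μ : (∀ i : Fin n, hGroup K i) →* JacAut K n}

/-- After the permutation is undone, xᵢxₖ = xₖxᵢ removes the dependence of the i-th coefficient on
αₖ, and the counting argument removes the shifts of the eigenvalues. -/
theorem exists_perm_mul_form (hs : IsPermAction s) (σ : JacAut K n) :
    ∃ (τ : Equiv.Perm (Fin n)) (l : Fin n → Kˣ) (e : Fin n → ℤ →₀ ℤ),
      (∀ i, red K n ((σ * s τ) (hEl K i)) = red K n (hEl K i)) ∧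
      ∀ i, ∀ᶠ α in atTop, ((σ * s τ) (xEl K i)).1 (zm K α) =
        ((l i : K) * lam K (e i) (α i)) • zm K (α + Pi.single i 1) := by
  obtain ⟨τ, m, l, e, hl, hH, hX⟩ := exists_perm_form σ
  have hτ : ∀ i, τ (τ⁻¹ i) = i := τ.apply_symm_apply
  set ρ := σ * s τ⁻¹ with hρ
  have hH' : ∀ i, ∀ᶠ α in atTop,
      (ρ (hEl K i)).1 (zm K α) = (α i + 1 + m (τ⁻¹ i) : K) • zm K α := fun i => by
    rw [hρ, AlgEquiv.mul_apply, (hs _ i).2.2]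
    filter_upwards [hH (τ⁻¹ i)] with α h
    rw [h, hτ]
  have hX' : ∀ i, ∀ᶠ α in atTop, (ρ (xEl K i)).1 (zm K α) =
      (l (τ⁻¹ i) * lamProd (e (τ⁻¹ i)) α) • zm K (α + Pi.single i 1) := fun i => by
    rw [hρ, AlgEquiv.mul_apply, (hs _ i).1]
    filter_upwards [hX (τ⁻¹ i)] with α h
    rw [h, hτ]
  have he : ∀ i k, k ≠ i → e (τ⁻¹ i) k = 0 := by
    intro i k hki
    refine lamProd_cocycle (K := K) (e' := e (τ⁻¹ k)) hki.symm ?_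
    filter_upwards [hX' i, hX' k, eventually_add (hX' i) (Pi.single k 1),
      eventually_add (hX' k) (Pi.single i 1), eventually_nonneg] with α h1 h2 h3 h4 h0
    have h5 := congrArg (fun a : Jac K n => a.1 (zm K α)) (congrArg ρ (xEl_commute (K := K) i k))
    simp only [map_mul, jac_mul_apply, h1, h2, map_smul, h3, h4] at h5
    rw [add_right_comm, smul_smul, smul_smul] at h5
    have h6 := smul_left_injective K
      (zm_ne_zero K (add_nonneg (add_nonneg h0 (single_nonneg i)) (single_nonneg k))) h5
    refine mul_left_cancel₀ (mul_ne_zero (hl (τ⁻¹ i)) (hl (τ⁻¹ k))) ?_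
    linear_combination h6
  refine ⟨τ⁻¹, fun i => Units.mk0 _ (hl (τ⁻¹ i)), fun i => e (τ⁻¹ i) i, fun i => ?_, fun i => ?_⟩
  · rw [red_eq_iff]
    filter_upwards [hH' i] with α h
    rw [h, hEl_zm, shift_eq_zero (m := fun i => m (τ⁻¹ i)) hH' i, Int.cast_zero, add_zero]
  · filter_upwards [hX' i] with α h
    rw [h, lamProd_eq_lam (he i), Units.val_mk0]

theorem exists_perm_mul_eq_torus_mul_mu (hst : AIdealStable K n) (hs : IsPermAction s)
    (ht : ∀ l, Intertwines (rampHom (torusRamp l)) (t l))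
    (hμ : ∀ u, Intertwines (rampHom (muRamp u)) (μ u)) (ht' : IsTorusAction t)
    (hμ' : IsMuAction μ) (σ : JacAut K n) :
    ∃ τ l u, xi hst (σ * s τ) = xi hst (t l * μ u) := by
  obtain ⟨τ, l, e, hH, hX⟩ := exists_perm_mul_form hs σ
  choose u hu using fun i => exists_hExp_eq (K := K) i (e i)
  refine ⟨τ, l, u, quotAut_ext (fun i => ?_) fun i => ?_⟩
  · rw [xi_red, xi_red, torus_mul_mu_xEl ht hμ ht' hμ', red_eq_iff]
    filter_upwards [hX i, eventually_nonneg] with α h h0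
    rw [h, jac_smul_apply, jac_mul_apply, hGroup_zm _ h0, map_smul, xEl_zm i h0, hu, smul_smul]
  · rw [xi_red, xi_red, torus_mul_mu_hEl ht' hμ', hH]

/-- Modulo ker ξ every automorphism, multiplied by a permutation, becomes a product of elements of
𝕋ⁿ and 𝕌ₙ. -/
theorem isSemidirect_ker (hst : AIdealStable K n) (hs : IsPermAction s)
    (ht : ∀ l, Intertwines (rampHom (torusRamp l)) (t l))
    (hμ : ∀ u, Intertwines (rampHom (muRamp u)) (μ u)) (ht' : IsTorusAction t)
    (hμ' : IsMuAction μ) :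
    IsSemidirect (s.range ⊔ (t.range ⊔ μ.range)) (xi hst).ker ⊤ := by
  refine ⟨fun a _ b hb => (xi hst).normal_ker.conj_mem b hb a,
    perm_inf_ker hst hs ht hμ ht' hμ', eq_top_iff.2 fun σ _ => ?_⟩
  obtain ⟨τ, l, u, h⟩ := exists_perm_mul_eq_torus_mul_mu hst hs ht hμ ht' hμ' σ
  have hker : (t l * μ u)⁻¹ * (σ * s τ) ∈ (xi hst).ker := by
    rw [MonoidHom.mem_ker, map_mul, map_inv, h, inv_mul_cancel]
  have hsmem : s τ ∈ s.range ⊔ (t.range ⊔ μ.range) ⊔ (xi hst).ker :=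
    (le_sup_left.trans le_sup_left : s.range ≤ _) ⟨τ, rfl⟩
  have htmem : t l * μ u ∈ s.range ⊔ (t.range ⊔ μ.range) ⊔ (xi hst).ker :=
    (le_sup_right.trans le_sup_left : t.range ⊔ μ.range ≤ _)
      (mul_mem (Subgroup.mem_sup_left ⟨l, rfl⟩) (Subgroup.mem_sup_right ⟨u, rfl⟩))
  have h1 := mul_mem (mul_mem htmem (Subgroup.mem_sup_right hker)) (inv_mem hsmem)
  simpa [mul_assoc] using h1

end Generation

/-! ### The image of ξ and the units of ℒ₁(i) -/

section Quotient

variable {K : Type*} [Field K] [CharZero K] {n : ℕ}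

theorem hGroup_single_zm {i : Fin n} {w : hGroup K i} {j : ℤ}
    (hw : hExp w = Finsupp.single (j + 1) 1) :
    red K n ((w : (Jac K n)ˣ) : Jac K n) = red K n (hEl K i) + (j : JacQuot K n) := by
  rw [show (j : JacQuot K n) = red K n (j : Jac K n) from rfl, ← map_add, red_eq_iff]
  have h1 : ∀ᶠ α : Fin n → ℤ in atTop, α i ≠ -(j + 1) :=
    eventually_apply (p := fun z => z ≠ -(j + 1)) (eventually_ne_atTop _) i
  filter_upwards [eventually_nonneg, h1] with α h0 h1
  rw [hGroup_zm _ h0, hw, lam_single, if_neg (by omega), zpow_one, jac_add_apply, hEl_zm]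
  have h2 : ((j : Jac K n)).1 (zm K α) = (j : K) • zm K α := by
    rw [← jac_algebraMap_apply, map_intCast]
  rw [h2, ← add_smul]
  congr 1
  push_cast
  ring

/-- The elements of `ℒ₁(i)` are represented by operators which are eventually diagonal, with
eigenvalues depending on the `i`-th exponent only. -/
theorem exists_lift_of_mem_lAlg {i : Fin n} {b : JacQuot K n} (hb : b ∈ lAlg K i) :
    ∃ (a : Jac K n) (f : ℤ → K), red K n a = b ∧
      ∀ᶠ α in atTop, a.1 (zm K α) = f (α i) • zm K α := by
  induction hb using Algebra.adjoin_induction with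
  | mem x hx =>
    rcases hx with hx | ⟨j, h1, h2⟩
    · rw [Set.mem_singleton_iff] at hx
      exact ⟨hEl K i, fun z => z + 1, hx.symm, Eventually.of_forall fun α => hEl_zm i α⟩
    · obtain ⟨w, hw⟩ := exists_hExp_eq (K := K) i (Finsupp.single (j + 1) 1)
      refine ⟨((w⁻¹ : hGroup K i) : (Jac K n)ˣ), fun z => (lam K (hExp w) z)⁻¹, ?_, ?_⟩
      · rw [← hGroup_single_zm hw] at h1
        refine (left_inv_eq_right_inv h1 ?_).symm
        rw [← map_mul, ← map_one (red K n)]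
        congr 1
        rw [InvMemClass.coe_inv, Units.mul_inv]
      · filter_upwards [eventually_nonneg] with α h0
        exact hGroup_inv_zm w h0
  | algebraMap c =>
    exact ⟨algebraMap K _ c, fun _ => c, rfl, Eventually.of_forall fun α =>
      jac_algebraMap_apply c _⟩
  | add x y _ _ hx hy =>
    obtain ⟨a, f, rfl, ha⟩ := hx
    obtain ⟨b, g, rfl, hb⟩ := hy
    refine ⟨a + b, f + g, map_add _ _ _, ?_⟩
    filter_upwards [ha, hb] with α h1 h2
    rw [jac_add_apply, h1, h2, Pi.add_apply, add_smul]
  | mul x y _ _ hx hy =>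
    obtain ⟨a, f, rfl, ha⟩ := hx
    obtain ⟨b, g, rfl, hb⟩ := hy
    refine ⟨a * b, f * g, map_mul _ _ _, ?_⟩
    filter_upwards [ha, hb] with α h1 h2
    rw [jac_mul_apply, h2, map_smul, h1, Pi.mul_apply, mul_comm, mul_smul]

theorem lAlg_commute {i : Fin n} {b c : JacQuot K n} (hb : b ∈ lAlg K i) (hc : c ∈ lAlg K i) :
    b * c = c * b := by
  obtain ⟨a, f, rfl, ha⟩ := exists_lift_of_mem_lAlg hb
  obtain ⟨b, g, rfl, hb⟩ := exists_lift_of_mem_lAlg hc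
  rw [← map_mul, ← map_mul, red_eq_iff]
  filter_upwards [ha, hb] with α h1 h2
  rw [jac_mul_apply, jac_mul_apply, h1, h2, map_smul, map_smul, h1, h2, smul_comm]

/-- A unit is far out a scalar times a product of linear forms by unique factorization. Its
eigenvalues depend on αᵢ alone, so only forms in αᵢ occur, and these are realized in ℋ₁(i). -/
theorem exists_lAlg_unit_eq {i : Fin n} (u : (lAlg K i)ˣ) :
    ∃ (l : Kˣ) (w : hGroup K i), ((u : lAlg K i) : JacQuot K n) =
      (l : K) • red K n ((w : (Jac K n)ˣ) : Jac K n) := by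
  obtain ⟨a, f, ha, hf⟩ := exists_lift_of_mem_lAlg (u : lAlg K i).2
  obtain ⟨b, g, hb, hg⟩ := exists_lift_of_mem_lAlg (u⁻¹.1 : lAlg K i).2
  have hfg : (fun α : Fin n → ℤ => f (α i)) * (fun α => g (α i)) =ᶠ[atTop] 1 := by
    have h1 : red K n (a * b) = red K n 1 := by
      rw [map_mul, ha, hb, map_one]
      exact congrArg Subtype.val u.mul_inv
    filter_upwards [red_eq_iff.1 h1, hf, hg, eventually_nonneg] with α h1 h2 h3 h0
    rw [jac_mul_apply, h3, map_smul, h2, jac_one_apply, smul_smul] at h1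
    have h4 := smul_left_injective K (zm_ne_zero K h0) (h1.trans (one_smul K _).symm)
    rw [Pi.mul_apply, Pi.one_apply, mul_comm]
    exact h4
  have hrf : Rat fun α : Fin n → ℤ => f (α i) :=
    rat_of_eventually (a := a) (δ := 0) (by simpa using hf)
  have hrg : Rat fun α : Fin n → ℤ => g (α i) :=
    rat_of_eventually (a := b) (δ := 0) (by simpa using hg)
  obtain ⟨l, hl, e, he⟩ := Rat.exists_eq_lamProd hrf hrg hfg
  have he0 : ∀ k, k ≠ i → e k = 0 := fun k hk => by
    -- With the trivial second factor the cocycle condition is invariance in direction k.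
    refine lamProd_cocycle (K := K) (e' := 0) (Ne.symm hk) ?_
    filter_upwards [he, eventually_add he (Pi.single k 1)] with α h1 h2
    rw [Pi.add_apply, Pi.single_eq_of_ne hk.symm, add_zero, h1] at h2
    have h3 := mul_left_cancel₀ hl h2
    simp [lamProd] at h3 ⊢
    exact h3.symm
  obtain ⟨w, hw⟩ := exists_hExp_eq (K := K) i (e i)
  refine ⟨Units.mk0 l hl, w, ?_⟩
  rw [← ha, ← map_smul, red_eq_iff]
  filter_upwards [hf, he, eventually_nonneg] with α h1 h2 h0
  rw [h1, h2, jac_smul_apply, hGroup_zm w h0, hw, smul_smul, lamProd_eq_lam he0, Units.val_mk0]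

theorem red_hGroup_mem {i : Fin n} {w : (Jac K n)ˣ} (hw : w ∈ hGroup K i) :
    red K n (w : Jac K n) ∈ lAlg K i ∧ red K n ((w⁻¹ : (Jac K n)ˣ) : Jac K n) ∈ lAlg K i := by
  have hmem : ∀ (w : (Jac K n)ˣ) (j : ℤ),
      red K n (w : Jac K n) = red K n (hEl K i) + (j : JacQuot K n) →
      red K n (w : Jac K n) ∈ lAlg K i ∧ red K n ((w⁻¹ : (Jac K n)ˣ) : Jac K n) ∈ lAlg K i := by
    intro w j h
    constructor
    · rw [h]
      exact add_mem (Algebra.subset_adjoin (Or.inl rfl)) (intCast_mem _ j)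
    · refine Algebra.subset_adjoin (Or.inr ⟨j, ?_, ?_⟩)
      · rw [← h, ← map_mul, Units.inv_mul, map_one]
      · rw [← h, ← map_mul, Units.mul_inv, map_one]
  induction hw using Subgroup.closure_induction with
  | mem x hx =>
    rcases hx with ⟨j, hj⟩ | ⟨j, h1, hj⟩
    · refine hmem x j ?_
      rw [hj, map_add, map_natCast, Int.cast_natCast]
    · refine hmem x (-j) ?_
      rw [hj, map_add, map_sub (red K n) (hEl K i), map_natCast, red_eq_zero_iff'.2 (matUnit_mem_aIdeal i _ _)]
      push_cast
      rw [add_zero, sub_eq_add_neg]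
  | one => simp only [inv_one, Units.val_one, map_one]; exact ⟨one_mem _, one_mem _⟩
  | mul x y _ _ hx hy =>
    rw [mul_inv_rev, Units.val_mul, Units.val_mul, map_mul, map_mul]
    exact ⟨mul_mem hx.1 hy.1, mul_mem hy.2 hx.2⟩
  | inv x _ hx => rw [inv_inv]; exact hx.symm

/-- The unit of `ℒ₁(i)` given by a scalar and an element of `ℋ₁(i)`. -/
def lUnit {i : Fin n} (l : Kˣ) (w : hGroup K i) : (lAlg K i)ˣ where
  val := ⟨(l : K) • red K n ((w : (Jac K n)ˣ) : Jac K n),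
    Subalgebra.smul_mem _ (red_hGroup_mem w.2).1 _⟩
  inv := ⟨((l⁻¹ : Kˣ) : K) • red K n (((w : (Jac K n)ˣ)⁻¹ : (Jac K n)ˣ) : Jac K n),
    Subalgebra.smul_mem _ (red_hGroup_mem w.2).2 _⟩
  val_inv := Subtype.ext <| by
    change (_ • _) * (_ • _) = (1 : JacQuot K n)
    rw [smul_mul_smul_comm, ← map_mul, Units.mul_inv, Units.mul_inv, one_smul, map_one]
  inv_val := Subtype.ext <| by
    change (_ • _) * (_ • _) = (1 : JacQuot K n)
    rw [smul_mul_smul_comm, ← map_mul, Units.inv_mul, Units.inv_mul, one_smul, map_one]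

theorem lAlg_fixed {ρ : QuotAut K n} {i : Fin n} (h : ρ (red K n (hEl K i)) = red K n (hEl K i))
    {b : JacQuot K n} (hb : b ∈ lAlg K i) : ρ b = b := by
  induction hb using Algebra.adjoin_induction with
  | mem x hx =>
    rcases hx with hx | ⟨j, h1, h2⟩
    · rw [Set.mem_singleton_iff] at hx
      rw [hx, h]
    · refine left_inv_eq_right_inv ?_ h2
      have h3 : ρ (red K n (hEl K i) + (j : JacQuot K n)) = red K n (hEl K i) + j := by
        rw [← map_intCast (algebraMap K (JacQuot K n)) j]
        exact (ρ.map_add' _ _).trans (congrArg₂ _ h (ρ.commutes _))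
      rw [← h3, ← map_mul, h1, map_one]
  | algebraMap c => exact ρ.commutes c
  | add x y _ _ hx hy => rw [map_add, hx, hy]
  | mul x y _ _ hx hy => rw [map_mul, hx, hy]

/-- Elements of `ℋ₁(i)` can be moved across `xᵢ`. -/
theorem hGroup_mul_xEl {i : Fin n} {w w' : hGroup K i}
    (h : ∀ z, lam K (hExp w) (z + 1) = lam K (hExp w') z) :
    ((w : (Jac K n)ˣ) : Jac K n) * xEl K i = xEl K i * ((w' : (Jac K n)ˣ) : Jac K n) := by
  refine jac_ext fun α h0 => ?_
  rw [jac_mul_apply, jac_mul_apply, hGroup_zm _ h0, map_smul, xEl_zm i h0,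
    hGroup_zm _ (add_nonneg h0 (single_nonneg i)), Pi.add_apply, Pi.single_eq_same, h]

theorem exists_hGroup_mul_xEl {i : Fin n} (w : hGroup K i) : ∃ w' : hGroup K i,
    ((w : (Jac K n)ˣ) : Jac K n) * xEl K i = xEl K i * ((w' : (Jac K n)ˣ) : Jac K n) := by
  obtain ⟨w', hw'⟩ := exists_hExp_eq (K := K) i ((hExp w).mapDomain (· + 1))
  exact ⟨w', hGroup_mul_xEl fun z => by rw [hw', lam_shift]⟩

theorem exists_xEl_mul_hGroup {i : Fin n} (w' : hGroup K i) : ∃ w : hGroup K i,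
    ((w : (Jac K n)ˣ) : Jac K n) * xEl K i = xEl K i * ((w' : (Jac K n)ˣ) : Jac K n) := by
  obtain ⟨w, hw⟩ := exists_hExp_eq (K := K) i ((hExp w').mapDomain (· + -1))
  exact ⟨w, hGroup_mul_xEl fun z => by rw [hw, ← lam_shift, add_neg_cancel_right]⟩

variable {s : Equiv.Perm (Fin n) →* JacAut K n} {t : (Fin n → Kˣ) →* JacAut K n}
  {μ : (∀ i : Fin n, hGroup K i) →* JacAut K n}

/-- Writing uᵢ = λᵢwᵢ with wᵢ from ℋ₁(i), and wᵢxᵢ = xᵢwᵢ', the automorphism σ_u is induced by t_λ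
μ_{w'}: the units stand on opposite sides of xᵢ in the two actions. -/
theorem exists_xi_eq_sigma (hst : AIdealStable K n)
    (ht : ∀ l, Intertwines (rampHom (torusRamp l)) (t l))
    (hμ : ∀ u, Intertwines (rampHom (muRamp u)) (μ u)) (ht' : IsTorusAction t)
    (hμ' : IsMuAction μ) (u : ∀ i : Fin n, (lAlg K i)ˣ) : ∃ σ ∈ t.range ⊔ μ.range, ∀ i,
      xi hst σ (red K n (xEl K i)) = ((u i : lAlg K i) : JacQuot K n) * red K n (xEl K i) ∧
      xi hst σ (red K n (hEl K i)) = red K n (hEl K i) := by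
  choose l w hw using fun i => exists_lAlg_unit_eq (u i)
  choose w' hw' using fun i => exists_hGroup_mul_xEl (w i)
  refine ⟨t l * μ w', mul_mem (Subgroup.mem_sup_left ⟨l, rfl⟩) (Subgroup.mem_sup_right ⟨w', rfl⟩),
    fun i => ⟨?_, ?_⟩⟩
  · rw [xi_red, torus_mul_mu_xEl ht hμ ht' hμ', ← hw' i, map_smul, map_mul, hw, smul_mul_assoc]
  · rw [xi_red, torus_mul_mu_hEl ht' hμ']

theorem exists_isSigmaAction (hst : AIdealStable K n)
    (ht : ∀ l, Intertwines (rampHom (torusRamp l)) (t l))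
    (hμ : ∀ u, Intertwines (rampHom (muRamp u)) (μ u)) (ht' : IsTorusAction t)
    (hμ' : IsMuAction μ) : ∃ sg : (∀ i : Fin n, (lAlg K i)ˣ) →* QuotAut K n,
      IsSigmaAction sg ∧ sg.range = (t.range ⊔ μ.range).map (xi hst) := by
  choose ρ hρ hρ' using exists_xi_eq_sigma hst ht hμ ht' hμ'
  let sg : (∀ i : Fin n, (lAlg K i)ˣ) →* QuotAut K n := MonoidHom.mk' (fun u => xi hst (ρ u)) (by
    -- Multiplicativity holds because ρ(u) fixes Hᵢ, hence ℒ₁(i) pointwise, and ℒ₁(i) is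
    -- commutative.
    intro u v
    refine quotAut_ext (fun i => ?_) fun i => ?_
    · rw [(hρ' _ i).1, AlgEquiv.mul_apply, (hρ' v i).1, map_mul,
        lAlg_fixed (hρ' u i).2 (v i : lAlg K i).2, (hρ' u i).1, ← mul_assoc,
        lAlg_commute (v i : lAlg K i).2 (u i : lAlg K i).2]
      rfl
    · rw [(hρ' _ i).2, AlgEquiv.mul_apply, (hρ' v i).2, (hρ' u i).2])
  refine ⟨sg, fun u i => hρ' u i, le_antisymm ?_ ?_⟩
  · rintro _ ⟨u, rfl⟩
    exact ⟨ρ u, hρ u, rfl⟩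
  · rintro _ ⟨σ, hσ, rfl⟩
    obtain ⟨l, w', rfl⟩ := exists_torus_mul_mu ht hμ hσ
    choose w hw using fun i => exists_xEl_mul_hGroup (w' i)
    refine ⟨fun i => lUnit (l i) (w i), quotAut_ext (fun i => ?_) fun i => ?_⟩
    · rw [xi_red, torus_mul_mu_xEl ht hμ ht' hμ', ← hw i]
      refine (hρ' _ i).1.trans ?_
      change (_ • _) * _ = _
      rw [map_smul, map_mul, smul_mul_assoc]
    · rw [xi_red, torus_mul_mu_hEl ht' hμ']
      exact (hρ' _ i).2

theorem IsSigmaAction.injective {sg : (∀ i : Fin n, (lAlg K i)ˣ) →* QuotAut K n}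
    (h : IsSigmaAction sg) : Function.Injective sg := by
  intro u v huv
  funext i
  refine Units.ext (Subtype.ext ?_)
  have h1 := (h u i).1
  rw [huv, (h v i).1] at h1
  have h2 := congrArg (· * red K n (yEl K i)) h1
  simp only [mul_assoc, red_xEl_mul_yEl, mul_one] at h2
  exact h2.symm

theorem IsPermActionQuot.injective {s' : Equiv.Perm (Fin n) →* QuotAut K n}
    (h : IsPermActionQuot s') : Function.Injective s' := by
  intro τ τ' heq
  ext1 i
  refine hEl_red_injective (K := K) ?_
  rw [← (h τ i).2, ← (h τ' i).2, heq]

/-- The decomposition of 𝔾ₙ is pushed forward by ξ, which kills the last factor; the Hᵢ still detect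
permutations in 𝒜ₙ. -/
theorem isSemidirect_range_xi (hst : AIdealStable K n) (hs : IsPermAction s)
    (ht : ∀ l, Intertwines (rampHom (torusRamp l)) (t l))
    (hμ : ∀ u, Intertwines (rampHom (muRamp u)) (μ u)) (ht' : IsTorusAction t)
    (hμ' : IsMuAction μ) :
    IsSemidirect ((xi hst).comp s).range ((t.range ⊔ μ.range).map (xi hst)) (xi hst).range := by
  refine ⟨?_, eq_bot_iff.2 ?_, ?_⟩
  · rintro _ ⟨τ, rfl⟩ _ ⟨b, hb, rfl⟩
    exact ⟨s τ * b * (s τ)⁻¹, (isSemidirect_perm hs ht' hμ').1 _ ⟨τ, rfl⟩ b hb, by simp⟩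
  · rintro _ ⟨⟨τ, rfl⟩, ⟨b, hb, h⟩⟩
    obtain ⟨l, u, rfl⟩ := exists_torus_mul_mu ht hμ hb
    have hτ : τ = 1 := by
      ext1 i
      refine hEl_red_injective (K := K) ?_
      have h1 := DFunLike.congr_fun h (red K n (hEl K i))
      rw [MonoidHom.comp_apply, xi_red, xi_red, torus_mul_mu_hEl ht' hμ', (hs τ i).2.2] at h1
      exact h1.symm
    rw [Subgroup.mem_bot, hτ, map_one]
  · rw [MonoidHom.range_comp, ← Subgroup.map_sup, MonoidHom.range_eq_map (xi hst),
      ← (isSemidirect_ker hst hs ht hμ ht' hμ').2.2, Subgroup.map_sup _ (xi hst).ker]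
    rw [(Subgroup.map_eq_bot_iff _).2 le_rfl, sup_bot_eq]

end Quotient

/-! ### The filtration of 𝔞ₙ by bounded matrix units -/

section Bounded

variable {K : Type*} [Field K] {n : ℕ}

/-- The generators of the `k`-th tensor factor of `𝔸ₙ`. -/
def IsGen (k : Fin n) (g : Jac K n) : Prop := g = xEl K k ∨ g = dEl K k ∨ g = hInvEl K k

theorem xEl_mul_dEl_comm {l k : Fin n} (h : l ≠ k) : xEl K l * dEl K k = dEl K k * xEl K l := by
  refine Subtype.ext (LinearMap.ext fun p => ?_)
  change MvPolynomial.X l * MvPolynomial.pderiv k p = MvPolynomial.pderiv k (MvPolynomial.X l * p)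
  rw [Derivation.leibniz, MvPolynomial.pderiv_X_of_ne h]
  simp

theorem xEl_mul_hInvEl_comm {l k : Fin n} (h : l ≠ k) :
    xEl K l * hInvEl K k = hInvEl K k * xEl K l := by
  refine jac_ext fun α h0 => ?_
  rw [jac_mul_apply, jac_mul_apply, hInvEl_zm, map_smul, xEl_zm l h0, hInvEl_zm]
  simp [h.symm]

theorem dEl_mul_hInvEl_comm {l k : Fin n} (h : l ≠ k) :
    dEl K l * hInvEl K k = hInvEl K k * dEl K l := by
  refine jac_ext fun α h0 => ?_
  rw [jac_mul_apply, jac_mul_apply, hInvEl_zm, map_smul, dEl_zm, map_smul, hInvEl_zm, smul_comm]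
  simp [h.symm]

theorem dEl_commute {l k : Fin n} (h : l ≠ k) : dEl K l * dEl K k = dEl K k * dEl K l := by
  refine jac_ext fun α h0 => ?_
  rw [jac_mul_apply, jac_mul_apply, dEl_zm, dEl_zm, map_smul, map_smul, dEl_zm, dEl_zm, smul_comm,
    sub_right_comm]
  simp [h, h.symm]

theorem hInvEl_commute (l k : Fin n) : hInvEl K l * hInvEl K k = hInvEl K k * hInvEl K l := by
  refine jac_ext fun α h0 => ?_
  rw [jac_mul_apply, jac_mul_apply, hInvEl_zm, hInvEl_zm, map_smul, map_smul, hInvEl_zm, hInvEl_zm,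
    smul_comm]

theorem IsGen.commute {l k : Fin n} (h : l ≠ k) {g g' : Jac K n} (hg : IsGen l g)
    (hg' : IsGen k g') : g * g' = g' * g := by
  rcases hg with rfl | rfl | rfl <;> rcases hg' with rfl | rfl | rfl
  · exact xEl_commute l k
  · exact xEl_mul_dEl_comm h
  · exact xEl_mul_hInvEl_comm h
  · exact (xEl_mul_dEl_comm h.symm).symm
  · exact dEl_commute h
  · exact dEl_mul_hInvEl_comm h
  · exact (xEl_mul_hInvEl_comm h.symm).symm
  · exact (dEl_mul_hInvEl_comm h.symm).symm
  · exact hInvEl_commute l k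

theorem IsGen.commute_jacOmit {k : Fin n} {g b : Jac K n} (hg : IsGen k g)
    (hb : b ∈ jacOmit K k) : g * b = b * g := by
  have h : jacOmit K k ≤ Subalgebra.centralizer K {g} := by
    refine Algebra.adjoin_le ?_
    rintro a ⟨l, hl, ha⟩
    refine (Subalgebra.mem_centralizer_iff K).2 fun g' hg' => ?_
    rw [Set.mem_singleton_iff.1 hg']
    exact hg.commute hl.symm ha
  exact (Subalgebra.mem_centralizer_iff K).1 (h hb) g rfl

theorem matUnit_commute_jacOmit {k : Fin n} {b : Jac K n} (hb : b ∈ jacOmit K k) (s t : ℕ) :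
    matUnit K k s t * b = b * matUnit K k s t := by
  have hx : Commute (xEl K k) b := IsGen.commute_jacOmit (Or.inl rfl) hb
  have hy : Commute (yEl K k) b :=
    Commute.mul_left (IsGen.commute_jacOmit (Or.inr (Or.inr rfl)) hb)
      (IsGen.commute_jacOmit (Or.inr (Or.inl rfl)) hb)
  have h : ∀ s t, xEl K k ^ s * yEl K k ^ t * b = b * (xEl K k ^ s * yEl K k ^ t) := fun s t =>
    (hx.pow_left s).mul_left (hy.pow_left t)
  refine jac_ext fun α _ => ?_
  have h' : ∀ s t, (xEl K k ^ s * yEl K k ^ t).1 (b.1 (zm K α)) =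
      b.1 ((xEl K k ^ s * yEl K k ^ t).1 (zm K α)) := fun s t => by
    rw [← jac_mul_apply, h, jac_mul_apply b]
  rw [jac_mul_apply, jac_mul_apply, matUnit, jac_sub_apply, jac_sub_apply, map_sub, h', h']

theorem boundedPart_mono {d d' : ℕ} (h : d ≤ d') : boundedPart K n d ≤ boundedPart K n d' := by
  refine Submodule.span_mono ?_
  rintro a ⟨k, s, t, b, hs, ht, hb, rfl⟩
  exact ⟨k, s, t, b, hs.trans_le h, ht.trans_le h, hb, rfl⟩

theorem mul_matUnit_mem_boundedPart {d : ℕ} {k : Fin n} {s t : ℕ} {b : Jac K n} (hs : s < d)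
    (ht : t < d) (hb : b ∈ jacOmit K k) : b * matUnit K k s t ∈ boundedPart K n d :=
  Submodule.subset_span ⟨k, s, t, b, hs, ht, hb, rfl⟩

theorem boundedPart_le_of {d d' : ℕ} {f : Jac K n →ₗ[K] Jac K n}
    (h : ∀ (k : Fin n) (s t : ℕ) (b : Jac K n), s < d → t < d → b ∈ jacOmit K k →
      f (b * matUnit K k s t) ∈ boundedPart K n d') {a : Jac K n} (ha : a ∈ boundedPart K n d) :
    f a ∈ boundedPart K n d' := by
  have : boundedPart K n d ≤ (boundedPart K n d').comap f := by
    refine Submodule.span_le.2 ?_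
    rintro a ⟨k, s, t, b, hs, ht, hb, rfl⟩
    exact h k s t b hs ht hb
  exact this ha

variable [CharZero K]

theorem IsGen.mul_matUnit {k : Fin n} {g : Jac K n} (hg : IsGen k g) (s t : ℕ) :
    ∃ (c : K) (s' : ℕ), s' ≤ s + 1 ∧ g * matUnit K k s t = c • matUnit K k s' t := by
  rcases hg with rfl | rfl | rfl
  · refine ⟨1, s + 1, le_rfl, jac_ext fun α h0 => ?_⟩
    rw [jac_mul_apply, jac_smul_apply, one_smul, matUnit_zm, matUnit_zm]
    split_ifs with h
    · rw [xEl_zm, add_assoc, ← Pi.single_add]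
      · push_cast; congr 3; ring
      · intro j
        have := h0 j
        by_cases hj : j = k
        · subst hj; simp [h]
        · simpa [hj] using this
    · exact map_zero _
  · refine ⟨s, s - 1, by omega, jac_ext fun α h0 => ?_⟩
    rw [jac_mul_apply, jac_smul_apply, matUnit_zm, matUnit_zm]
    split_ifs with h
    · rw [dEl_zm, Pi.add_apply, Pi.single_eq_same, h, add_sub_cancel]
      rcases s with _ | s
      · simp
      · rw [add_sub_assoc, ← Pi.single_sub]
        push_cast; congr 4; ring
    · rw [map_zero, smul_zero]
  · refine ⟨(s + 1 : K)⁻¹, s, by omega, jac_ext fun α h0 => ?_⟩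
    rw [jac_mul_apply, jac_smul_apply, matUnit_zm]
    split_ifs with h
    · rw [hInvEl_zm, Pi.add_apply, Pi.single_eq_same, h, add_sub_cancel, Int.cast_natCast]
    · rw [map_zero, smul_zero]

theorem IsGen.matUnit_mul {k : Fin n} {g : Jac K n} (hg : IsGen k g) (s t : ℕ) :
    ∃ (c : K) (t' : ℕ), t' ≤ t + 1 ∧ matUnit K k s t * g = c • matUnit K k s t' := by
  rcases hg with rfl | rfl | rfl
  · rcases t with _ | t
    · refine ⟨0, 0, by omega, jac_ext fun α h0 => ?_⟩
      have h1 : 0 ≤ α k := h0 k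
      rw [jac_mul_apply, xEl_zm k h0, matUnit_zm, zero_smul, jac_zero_apply, if_neg]
      intro h2
      rw [Pi.add_apply, Pi.single_eq_same, Nat.cast_zero] at h2
      omega
    · refine ⟨1, t, by omega, jac_ext fun α h0 => ?_⟩
      rw [jac_mul_apply, jac_smul_apply, one_smul, xEl_zm k h0, matUnit_zm, matUnit_zm]
      simp only [Pi.add_apply, Pi.single_eq_same, Nat.cast_succ, add_left_inj]
      rw [add_assoc, ← Pi.single_add]
      congr 4; ring
  · refine ⟨t + 1, t + 1, le_rfl, jac_ext fun α h0 => ?_⟩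
    rw [jac_mul_apply, jac_smul_apply, dEl_zm, map_smul, matUnit_zm, matUnit_zm]
    simp only [Pi.sub_apply, Pi.single_eq_same, Nat.cast_succ, sub_eq_iff_eq_add]
    split_ifs with h
    · rw [sub_eq_add_neg α, add_assoc, ← Pi.single_neg, ← Pi.single_add, h]
      push_cast
      congr 4; ring
    · rw [smul_zero, smul_zero]
  · refine ⟨(t + 1 : K)⁻¹, t, by omega, jac_ext fun α h0 => ?_⟩
    rw [jac_mul_apply, jac_smul_apply, hInvEl_zm, map_smul, matUnit_zm]
    split_ifs with h
    · rw [h, Int.cast_natCast]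
    · rw [smul_zero, smul_zero]

theorem IsGen.mul_mem_boundedPart {l : Fin n} {g : Jac K n} (hg : IsGen l g) {d : ℕ} {a : Jac K n}
    (ha : a ∈ boundedPart K n d) : g * a ∈ boundedPart K n (d + 1) := by
  refine boundedPart_le_of (f := LinearMap.mulLeft K g) (fun k s t b hs ht hb => ?_) ha
  rw [LinearMap.mulLeft_apply]
  by_cases h : l = k
  · subst h
    obtain ⟨c, s', hs', h⟩ := hg.mul_matUnit s t
    rw [← mul_assoc, hg.commute_jacOmit hb, mul_assoc, h, mul_smul_comm]
    exact Submodule.smul_mem _ _ (mul_matUnit_mem_boundedPart (by omega) (by omega) hb)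
  · rw [← mul_assoc]
    exact mul_matUnit_mem_boundedPart (by omega) (by omega)
      (mul_mem (Algebra.subset_adjoin ⟨l, h, hg⟩) hb)

theorem IsGen.mem_boundedPart_mul {l : Fin n} {g : Jac K n} (hg : IsGen l g) {d : ℕ} {a : Jac K n}
    (ha : a ∈ boundedPart K n d) : a * g ∈ boundedPart K n (d + 1) := by
  refine boundedPart_le_of (f := LinearMap.mulRight K g) (fun k s t b hs ht hb => ?_) ha
  rw [LinearMap.mulRight_apply, mul_assoc]
  by_cases h : l = k
  · subst h
    obtain ⟨c, t', ht', h⟩ := hg.matUnit_mul s t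
    rw [h, mul_smul_comm]
    exact Submodule.smul_mem _ _ (mul_matUnit_mem_boundedPart (by omega) (by omega) hb)
  · have hgk : g ∈ jacOmit K k := Algebra.subset_adjoin ⟨l, h, hg⟩
    rw [matUnit_commute_jacOmit hgk, ← mul_assoc]
    exact mul_matUnit_mem_boundedPart (by omega) (by omega) (mul_mem hb hgk)

/-- A generator of the k-th tensor factor changes one index of E_st(k) to at most one more than it
was, up to a scalar, and a generator of another factor is absorbed into the coefficient. -/
theorem exists_mul_mem_boundedPart (a : Jac K n) : ∀ d, ∃ d', ∀ b ∈ boundedPart K n d,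
    a * b ∈ boundedPart K n d' ∧ b * a ∈ boundedPart K n d' := by
  have hgen : ∀ {l : Fin n} {g : Jac K n}, IsGen l g → ∀ d, ∃ d', ∀ b ∈ boundedPart K n d,
      g * b ∈ boundedPart K n d' ∧ b * g ∈ boundedPart K n d' := fun hg d =>
    ⟨d + 1, fun b hb => ⟨hg.mul_mem_boundedPart hb, hg.mem_boundedPart_mul hb⟩⟩
  induction a using jac_induction with
  | hx i => exact hgen (l := i) (Or.inl rfl)
  | hd i => exact hgen (l := i) (Or.inr (Or.inl rfl))
  | hh i => exact hgen (l := i) (Or.inr (Or.inr rfl))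
  | hc c =>
    refine fun d => ⟨d, fun b hb => ?_⟩
    rw [← Algebra.commutes, ← Algebra.smul_def]
    exact ⟨Submodule.smul_mem _ _ hb, Submodule.smul_mem _ _ hb⟩
  | hadd a b ha hb =>
    intro d
    obtain ⟨d₁, h₁⟩ := ha d
    obtain ⟨d₂, h₂⟩ := hb d
    refine ⟨max d₁ d₂, fun c hc => ?_⟩
    rw [add_mul, mul_add]
    exact ⟨add_mem (boundedPart_mono (le_max_left ..) (h₁ c hc).1)
      (boundedPart_mono (le_max_right ..) (h₂ c hc).1),
      add_mem (boundedPart_mono (le_max_left ..) (h₁ c hc).2)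
      (boundedPart_mono (le_max_right ..) (h₂ c hc).2)⟩
  | hmul a b ha hb =>
    intro d
    obtain ⟨d₁, h₁⟩ := hb d
    obtain ⟨d₂, h₂⟩ := ha d₁
    obtain ⟨d₃, h₃⟩ := ha d
    obtain ⟨d₄, h₄⟩ := hb d₃
    refine ⟨max d₂ d₄, fun c hc => ?_⟩
    rw [mul_assoc, ← mul_assoc c]
    exact ⟨boundedPart_mono (le_max_left ..) (h₂ _ (h₁ c hc).1).1,
      boundedPart_mono (le_max_right ..) (h₄ _ (h₃ c hc).2).2⟩

/-- The union of the bounded parts is a two-sided ideal containing all matrix units, hence contains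
𝔞ₙ. -/
theorem exists_mem_boundedPart {a : Jac K n} (ha : a ∈ aIdeal K n) :
    ∃ d, a ∈ boundedPart K n d := by
  let U : TwoSidedIdeal (Jac K n) :=
    TwoSidedIdeal.mk' {a | ∃ d, a ∈ boundedPart K n d} ⟨0, zero_mem _⟩
      (by
        rintro a b ⟨d, hd⟩ ⟨d', hd'⟩
        exact ⟨max d d', add_mem (boundedPart_mono (le_max_left ..) hd)
          (boundedPart_mono (le_max_right ..) hd')⟩)
      (by
        rintro a ⟨d, hd⟩
        have h : -a = (-1 : K) • a := jac_ext fun α _ => by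
          rw [jac_neg_apply, jac_smul_apply, neg_one_smul]
        exact ⟨d, by rw [h]; exact Submodule.smul_mem _ _ hd⟩)
      (by
        rintro a b ⟨d, hd⟩
        obtain ⟨d', h⟩ := exists_mul_mem_boundedPart a d
        exact ⟨d', (h b hd).1⟩)
      (by
        rintro a b ⟨d, hd⟩
        obtain ⟨d', h⟩ := exists_mul_mem_boundedPart b d
        exact ⟨d', (h a hd).2⟩)
  have mem_U : ∀ a, a ∈ U ↔ ∃ d, a ∈ boundedPart K n d := fun a =>
    TwoSidedIdeal.mem_mk' _ _ _ _ _ _ a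
  have hU : aIdeal K n ≤ U := by
    refine iSup_le fun i => TwoSidedIdeal.span_le.2 ?_
    rintro _ ⟨⟨s, t⟩, rfl⟩
    refine (mem_U _).2 ⟨max s t + 1, ?_⟩
    change matUnit K i s t ∈ _
    rw [← one_mul (matUnit K i _ _)]
    exact mul_matUnit_mem_boundedPart (Nat.lt_succ_of_le (le_max_left ..))
      (Nat.lt_succ_of_le (le_max_right ..)) (one_mem _)
  exact (mem_U a).1 (hU ha)

theorem exists_isBound (hst : AIdealStable K n) {σ : JacAut K n} (hσ : σ ∈ (xi hst).ker) :
    ∃ d, IsBound σ d := by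
  have h : ∀ a, ∃ d, σ a - a ∈ boundedPart K n d := fun a => by
    refine exists_mem_boundedPart (red_eq_zero_iff'.1 ?_)
    rw [map_sub (red K n) (σ a), (mem_ker_xi hst).1 hσ, sub_self]
  choose D hD using h
  refine ⟨∑ i, (D (hEl K i) + D (xEl K i) + D (yEl K i)), fun i => ?_⟩
  have hle := Finset.single_le_sum (f := fun i => D (hEl K i) + D (xEl K i) + D (yEl K i))
    (fun _ _ => Nat.zero_le _) (Finset.mem_univ i)
  exact ⟨boundedPart_mono (by omega) (hD _), boundedPart_mono (by omega) (hD _),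
    boundedPart_mono (by omega) (hD _)⟩

theorem boundedPart_zm {d : ℕ} {a : Jac K n} (ha : a ∈ boundedPart K n d) {α : Fin n → ℤ}
    (h : ∀ i, (d : ℤ) ≤ α i) : a.1 (zm K α) = 0 := by
  induction ha using Submodule.span_induction with
  | mem x hx =>
    obtain ⟨k, s, t, b, _, ht, _, rfl⟩ := hx
    have := h k
    rw [jac_mul_apply, matUnit_zm, if_neg (by omega), map_zero]
  | zero => rfl
  | add x y _ _ hx hy => rw [jac_add_apply, hx, hy, add_zero]
  | smul c x _ hx => rw [jac_smul_apply, hx, smul_zero]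

end Bounded

/-! ### Evaluation of the ordered products on monomials -/

section OrderedProducts

variable {K : Type*} [Field K] {n : ℕ}

/-- The predicate `R` carries the invariant of the intermediate exponents: nonnegativity for powers
of xᵢ, nothing for powers of yᵢ. -/
theorem list_ofFn_prod_zm {R : (Fin n → ℤ) → Prop} {m : ℕ} {g : Fin m → Jac K n}
    {v : Fin m → Fin n → ℤ}
    (h : ∀ i β, R β → (g i).1 (zm K β) = zm K (β + v i) ∧ R (β + v i)) {β : Fin n → ℤ} (hβ : R β) :
    (List.ofFn g).prod.1 (zm K β) = zm K (β + ∑ i, v i) ∧ R (β + ∑ i, v i) := by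
  induction m with
  | zero => simpa using hβ
  | succ m ih =>
    obtain ⟨h1, h2⟩ := ih (g := fun i => g i.succ) (v := fun i => v i.succ) fun i => h i.succ
    rw [List.ofFn_succ, List.prod_cons, jac_mul_apply, h1, Fin.sum_univ_succ, add_comm (v 0),
      ← add_assoc]
    exact h 0 _ h2

theorem list_ofFn_prod_indicator {m : ℕ} {g : Fin m → Jac K n} {P : Fin m → Prop}
    [DecidablePred P] [Decidable (∀ i, P i)] {p : MvPolynomial (Fin n) K} (h : ∀ i, (g i).1 p = if P i then p else 0) :
    (List.ofFn g).prod.1 p = if ∀ i, P i then p else 0 := by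
  induction m with
  | zero => simp
  | succ m ih =>
    rw [List.ofFn_succ, List.prod_cons, jac_mul_apply,
      ih (g := fun i => g i.succ) (P := fun i => P i.succ) fun i => h i.succ]
    simp only [Fin.forall_fin_succ]
    by_cases h0 : P 0 <;> by_cases h1 : ∀ i : Fin m, P i.succ <;> simp [h0, h1, h 0]

theorem prodOver_indicator {I : Finset (Fin n)} {f : I → Jac K n} {P : I → Prop}
    [DecidablePred P] [Decidable (∀ i, P i)] {p : MvPolynomial (Fin n) K} (h : ∀ i, (f i).1 p = if P i then p else 0) :
    (prodOver I f).1 p = if ∀ i, P i then p else 0 := by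
  classical
  rw [prodOver, list_ofFn_prod_indicator (P := fun i => ∀ hi : i ∈ I, P ⟨i, hi⟩)]
  · exact if_congr Subtype.forall.symm rfl rfl
  · intro i
    by_cases hi : i ∈ I
    · rw [dif_pos hi, h]
      simp [hi]
    · simp [hi]

theorem sum_single_dite {I : Finset (Fin n)} (c : I → ℤ) :
    ∑ i : Fin n, (if hi : i ∈ I then (Pi.single i (c ⟨i, hi⟩) : Fin n → ℤ) else 0) =
      fun j => if hj : j ∈ I then c ⟨j, hj⟩ else 0 := by
  ext j
  rw [Finset.sum_apply, Finset.sum_eq_single j]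
  · split_ifs <;> simp
  · intro b _ hb
    split_ifs
    · exact Pi.single_eq_of_ne hb.symm _
    · rfl
  · simp

theorem prodOver_map (σ : JacAut K n) {I : Finset (Fin n)} (f : I → Jac K n) :
    (prodOver I fun i => σ (f i)) = σ (prodOver I f) := by
  rw [prodOver, prodOver, map_list_prod, List.map_ofFn]
  congr 2
  ext1 i
  simp only [Function.comp_apply]
  split_ifs
  · rfl
  · exact (map_one σ).symm

theorem Intertwines.smul {φ : MvPolynomial (Fin n) K ≃ₗ[K] MvPolynomial (Fin n) K} {σ : JacAut K n}
    (hφ : Intertwines φ σ) (c : Kˣ) :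
    Intertwines (φ.trans (LinearEquiv.smulOfUnit c)) σ := fun a p => by
  change (c : K) • φ (a.1 p) = (σ a).1 ((c : K) • φ p)
  rw [hφ, map_smul]

variable [CharZero K]

theorem prodOver_xEl_pow_zm {I : Finset (Fin n)} (k : I → ℕ) {β : Fin n → ℤ} (hβ : 0 ≤ β) :
    (prodOver I fun i => xEl K i.1 ^ k i).1 (zm K β) =
      zm K (β + fun j => if hj : j ∈ I then (k ⟨j, hj⟩ : ℤ) else 0) := by
  rw [← sum_single_dite fun i => (k i : ℤ)]
  refine (list_ofFn_prod_zm (R := fun β => 0 ≤ β) (fun i β h => ?_) hβ).1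
  split_ifs with hi
  · exact ⟨xEl_pow_zm i _ h, add_nonneg h (Pi.single_nonneg.2 (Int.natCast_nonneg _))⟩
  · simpa using h

theorem pProj_zm (i : Fin n) (d : ℕ) {α : Fin n → ℤ} (h : 0 ≤ α) :
    (pProj K i d).1 (zm K α) = if α i < d then zm K α else 0 := by
  rw [pProj, jac_sum_apply]
  simp only [matUnit_zm_self]
  have h1 : 0 ≤ α i := h i
  split_ifs with hd
  · rw [Finset.sum_eq_single (α i).toNat]
    · rw [if_pos (by omega)]
    · intro b _ hb; rw [if_neg (by omega)]
    · intro hb; simp at hb; omega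
  · refine Finset.sum_eq_zero fun j hj => ?_
    rw [Finset.mem_range] at hj
    rw [if_neg (by omega)]

theorem qProj_zm (i : Fin n) (d : ℕ) {α : Fin n → ℤ} (h : 0 ≤ α) :
    (qProj K i d).1 (zm K α) = if (d : ℤ) ≤ α i then zm K α else 0 := by
  rw [qProj, jac_sub_apply, jac_one_apply, pProj_zm i d h]
  by_cases hd : α i < d
  · rw [if_pos hd, if_neg (by omega), sub_self]
  · rw [if_neg hd, if_pos (by omega), sub_zero]

theorem prodOver_yEl_pow_zm {I : Finset (Fin n)} (k : I → ℕ) (β : Fin n → ℤ) :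
    (prodOver I fun i => yEl K i.1 ^ k i).1
      (zm K (β + fun j => if hj : j ∈ I then (k ⟨j, hj⟩ : ℤ) else 0)) = zm K β := by
  have h1 : (fun j => if hj : j ∈ I then -(k ⟨j, hj⟩ : ℤ) else 0) =
      -fun j => if hj : j ∈ I then (k ⟨j, hj⟩ : ℤ) else 0 := by
    ext j
    rw [Pi.neg_apply]
    split_ifs <;> simp
  have h2 := fun γ => (list_ofFn_prod_zm (K := K) (R := fun _ : Fin n → ℤ => True)
    (g := fun i => if hi : i ∈ I then yEl K i ^ k ⟨i, hi⟩ else 1)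
    (v := fun i => if hi : i ∈ I then Pi.single i (-(k ⟨i, hi⟩ : ℤ)) else 0) (fun i β _ => by
      split_ifs
      · rw [yEl_pow_zm, sub_eq_add_neg, Pi.single_neg]; exact ⟨rfl, trivial⟩
      · simp) (β := γ) trivial).1
  rw [prodOver, h2, sum_single_dite (fun i => -(k i : ℤ)), h1, add_neg_cancel_right]

end OrderedProducts

/-! ### The conjugating unit -/

section Conjugator

variable {K : Type*} [Field K] [CharZero K] {n : ℕ}
  {φ : MvPolynomial (Fin n) K ≃ₗ[K] MvPolynomial (Fin n) K} {σ : JacAut K n} {d : ℕ}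

/-- The matrix units select the tuple formed by the exponents αᵢ with i in I. The powers of xᵢ then
raise these exponents to exactly d, where φ is the identity, and the intertwining property turns
σ(y^(d-α)) φ into φ y^(d-α), which lowers them back. -/
theorem conjUnit_summand_zm (hφ : Intertwines φ σ)
    (hd : ∀ α : Fin n → ℤ, (∀ i, (d : ℤ) ≤ α i) → φ (zm K α) = zm K α) {α : Fin n → ℤ}
    (h0 : 0 ≤ α) {I : Finset (Fin n)} (hI : ∀ i, i ∈ I ↔ α i < d) :
    (∑ γ : I → Fin d, prodOver I (fun j => σ (yEl K j.1 ^ (d - (γ j : ℕ)))) *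
      prodOver I (fun i => xEl K i.1 ^ (d - (γ i : ℕ))) *
      prodOver I (fun i => matUnit K i.1 (γ i : ℕ) (γ i : ℕ))).1 (zm K α) = φ (zm K α) := by
  classical
  have hpos : ∀ i, 0 ≤ α i := h0
  rw [jac_sum_apply, Finset.sum_eq_single fun i : I =>
    (⟨(α i).toNat, by have := (hI i).1 i.2; have := hpos i; omega⟩ : Fin d)]
  · dsimp only
    have hE : (prodOver I fun i => matUnit K i.1 (α i).toNat (α i).toNat).1 (zm K α) = zm K α := by
      rw [prodOver_indicator (P := fun _ => True), if_pos fun _ => trivial]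
      intro i
      have := hpos i
      rw [matUnit_zm_self]
      simp [this]
    rw [jac_mul_apply, jac_mul_apply, hE,
      prodOver_xEl_pow_zm (fun i : I => d - (α i).toNat) h0, prodOver_map,
      ← hd _, ← hφ, prodOver_yEl_pow_zm (fun i : I => d - (α i).toNat)]
    intro i
    have := hpos i
    simp only [Pi.add_apply]
    split_ifs with hi
    · have := (hI i).1 hi
      omega
    · have := mt (hI i).2 hi
      omega
  · intro γ _ hγ
    rw [jac_mul_apply, prodOver_indicator (P := fun i : I => α i = (γ i : ℕ)), if_neg, map_zero]
    · intro h
      apply hγ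
      ext i
      have := h i
      simp only
      omega
    · exact fun i => matUnit_zm_self _ _ _
  · simp

/-- The projections p and q annihilate every summand on x^α except the one for the set I of indices
with αᵢ < d. The empty set corresponds to the leading product of q's. -/
theorem conjUnit_eq (hφ : Intertwines φ σ)
    (hd : ∀ α : Fin n → ℤ, (∀ i, (d : ℤ) ≤ α i) → φ (zm K α) = zm K α) :
    (conjUnit σ d).1 = φ.toLinearMap := by
  classical
  refine linearMap_ext_zm fun α h0 => ?_
  rw [LinearEquiv.coe_coe, conjUnit, jac_add_apply, jac_sum_apply]
  simp only [jac_mul_apply _ (prodOver _ _)]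
  have hq : ∀ I : Finset (Fin n), (prodOver I fun i => qProj K i.1 d).1 (zm K α) =
      if ∀ i : I, (d : ℤ) ≤ α i then zm K α else 0 := fun I =>
    prodOver_indicator fun i => qProj_zm _ d h0
  have hp : ∀ I : Finset (Fin n), (prodOver I fun i => pProj K i.1 d).1 (zm K α) =
      if ∀ i : I, α i < (d : ℤ) then zm K α else 0 := fun I =>
    prodOver_indicator fun i => pProj_zm _ d h0
  simp only [hq]
  by_cases hall : ∀ i, (d : ℤ) ≤ α i
  · rw [if_pos (fun i => hall i.1 : ∀ i : (Finset.univ : Finset (Fin n)), (d : ℤ) ≤ α i), hd α hall, Finset.sum_eq_zero, add_zero]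
    rintro ⟨I, i, hi⟩ _
    rw [if_pos (fun i => hall i.1 : ∀ i : (Iᶜ : Finset (Fin n)), (d : ℤ) ≤ α i), hp, if_neg, map_zero]
    exact fun h => absurd (hall i) (not_le.2 (h ⟨i, hi⟩))
  · obtain ⟨i₀, hi₀⟩ := not_forall.1 hall
    rw [if_neg (fun h => hall fun i => h ⟨i, Finset.mem_univ i⟩ :
      ¬ ∀ i : (Finset.univ : Finset (Fin n)), (d : ℤ) ≤ α i), zero_add,
      Finset.sum_eq_single ⟨Finset.univ.filter fun i => α i < d, i₀, by simpa using hi₀⟩]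
    · rw [if_pos (by simp), hp, if_pos (by simp)]
      exact conjUnit_summand_zm hφ hd h0 (by simp)
    · rintro ⟨I, hI⟩ _ hne
      split_ifs with h1
      · rw [hp, if_neg, map_zero]
        intro h2
        apply hne
        ext i
        by_cases hi : i ∈ I
        · simpa [hi] using h2 ⟨i, hi⟩
        · simpa [hi] using h1 ⟨i, by simpa using hi⟩
      · rw [map_zero, map_zero]
    · simp

/-- Far out, an intertwiner of an automorphism which is close to the identity is a scalar. -/
theorem exists_map_zm_eq_smul (hφ : Intertwines φ σ) (hσ : IsBound σ d) :
    ∃ c : K, c ≠ 0 ∧ ∀ α : Fin n → ℤ, (∀ i, (d : ℤ) ≤ α i) → φ (zm K α) = c • zm K α := by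
  have hnn : ∀ α : Fin n → ℤ, (∀ i, (d : ℤ) ≤ α i) → 0 ≤ α := fun α h i =>
    (Int.natCast_nonneg d).trans (h i)
  -- The inverse of φ commutes with Hᵢ and xᵢ on monomials with exponents at least d. The first
  -- makes it diagonal there, the second makes its entries invariant under adding a basis vector.
  have hfix : ∀ {g : Jac K n}, σ g - g ∈ boundedPart K n d → ∀ α : Fin n → ℤ,
      (∀ i, (d : ℤ) ≤ α i) → φ.symm (g.1 (zm K α)) = g.1 (φ.symm (zm K α)) := by
    intro g hg α hα
    have h1 := boundedPart_zm hg hα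
    rw [jac_sub_apply, sub_eq_zero] at h1
    rw [LinearEquiv.symm_apply_eq, hφ, LinearEquiv.apply_symm_apply, h1]
  have hc : ∀ α : Fin n → ℤ, ∃ c : K, (∀ i, (d : ℤ) ≤ α i) → φ.symm (zm K α) = c • zm K α := by
    intro α
    by_cases hα : ∀ i, (d : ℤ) ≤ α i
    · obtain ⟨c, hc⟩ := exists_eq_smul_zm (hnn α hα) fun i => by
        rw [← hfix (hσ i).1 α hα, hEl_zm, map_smul]
      exact ⟨c, fun _ => hc⟩
    · exact ⟨0, fun h => absurd h hα⟩
  choose c hc using hc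
  have hstep : ∀ (α : Fin n → ℤ) (i : Fin n), (∀ i, (d : ℤ) ≤ α i) →
      c (α + Pi.single i 1) = c α := by
    intro α i hα
    have h1 := hfix (hσ i).2.1 α hα
    have h2 : ∀ j, (d : ℤ) ≤ (α + Pi.single i 1 : Fin n → ℤ) j := fun j =>
      (hα j).trans (le_add_of_nonneg_right (α := ℤ) (single_nonneg i j))
    rw [xEl_zm i (hnn α hα), hc _ h2, hc _ hα, map_smul, xEl_zm i (hnn α hα)] at h1
    exact smul_left_injective K (zm_ne_zero K (hnn _ h2)) h1
  have hconst : ∀ (β : Fin n →₀ ℕ) (α : Fin n → ℤ), (∀ i, (d : ℤ) ≤ α i) →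
      c (α + intExp β) = c α := by
    intro β
    induction β using Finsupp.induction_linear with
    | zero => intro α _; congr 1; ext j; simp [intExp]
    | add f g hf hg =>
      intro α hα
      rw [show α + intExp (f + g) = α + intExp f + intExp g by
        ext j; simp [intExp, add_assoc], hg, hf α hα]
      exact fun i => (hα i).trans (by simp [intExp])
    | single i k =>
      induction k with
      | zero => intro α _; congr 1; ext j; simp [intExp]
      | succ k ih =>
        intro α hα
        rw [show α + intExp (Finsupp.single i (k + 1)) =
            α + intExp (Finsupp.single i k) + Pi.single i 1 by
          ext j
          by_cases hj : j = i
          · subst hj; simp [intExp, add_assoc]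
          · simp [intExp, hj], hstep, ih α hα]
        exact fun i => (hα i).trans (by simp [intExp])
  have hall : ∀ α : Fin n → ℤ, (∀ i, (d : ℤ) ≤ α i) → c α = c fun _ => d := by
    intro α hα
    have h0 : 0 ≤ α - fun _ => (d : ℤ) := fun i => sub_nonneg.2 (hα i)
    have h1 : α = (fun _ => (d : ℤ)) + intExp (natExp (α - fun _ => (d : ℤ))) := by
      rw [intExp_natExp h0, add_sub_cancel]
    rw [h1, hconst _ _ fun _ => le_rfl]
  have hc0 : c (fun _ => d) ≠ 0 := by
    intro h
    have h1 := hc (fun _ => d) fun _ => le_rfl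
    rw [h, zero_smul, LinearEquiv.map_eq_zero_iff] at h1
    exact zm_ne_zero K (hnn _ fun _ => le_rfl) h1
  refine ⟨(c fun _ => d)⁻¹, inv_ne_zero hc0, fun α hα => ?_⟩
  have h1 := hc α hα
  rw [hall α hα, LinearEquiv.symm_apply_eq, map_smul] at h1
  rw [eq_inv_smul_iff₀ hc0]
  exact h1.symm

theorem exists_intertwines_fixing (hσ : IsBound σ d) :
    ∃ φ, Intertwines φ σ ∧
      ∀ α : Fin n → ℤ, (∀ i, (d : ℤ) ≤ α i) → φ (zm K α) = zm K α := by
  obtain ⟨φ, hφ⟩ := exists_intertwines σ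
  obtain ⟨c, hc, h⟩ := exists_map_zm_eq_smul hφ hσ
  refine ⟨_, hφ.smul (Units.mk0 c hc)⁻¹, fun α hα => ?_⟩
  change c⁻¹ • φ (zm K α) = _
  rw [h α hα, smul_smul, inv_mul_cancel₀ hc, one_smul]

/-- The given formula realizes φ inside 𝔸ₙ, and the formula for the inverse automorphism, with its
own bound, realizes the inverse of φ. Membership in 1 + 𝔞ₙ holds because φ fixes all monomials far
out. -/
theorem exists_unit_eq_conjUnit (hst : AIdealStable K n) (hσ : σ ∈ (xi hst).ker)
    (hd : IsBound σ d) : ∃ v : (Jac K n)ˣ, (v : Jac K n) = conjUnit σ d ∧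
      (v : Jac K n) - 1 ∈ aIdeal K n ∧
      ∀ a, σ a = (v : Jac K n) * a * ((v⁻¹ : (Jac K n)ˣ) : Jac K n) := by
  obtain ⟨φ, hφ, hfix⟩ := exists_intertwines_fixing hd
  have hv := conjUnit_eq hφ hfix
  obtain ⟨d', hd'⟩ := exists_isBound hst (inv_mem hσ)
  have hfix' : ∀ α : Fin n → ℤ, (∀ i, (d' : ℤ) ≤ α i) → φ.symm (zm K α) = zm K α := by
    -- The inverse of φ is a scalar beyond d'; a monomial beyond both bounds is fixed by φ, so this
    -- scalar is 1.
    obtain ⟨c, -, hc⟩ := exists_map_zm_eq_smul hφ.symm hd'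
    have h1 := hc (fun _ => max d d') fun _ => le_max_right _ _
    have h2 := hfix (fun _ => max d d') fun _ => le_max_left _ _
    have h0 : (0 : Fin n → ℤ) ≤ fun _ => max (d : ℤ) d' := fun _ => by simp
    rw [← h2, LinearEquiv.symm_apply_apply, h2] at h1
    have h3 : (1 : K) = c :=
      smul_left_injective K (zm_ne_zero K h0) ((one_smul K _).trans h1)
    intro α hα
    rw [hc α hα, ← h3, one_smul]
  have hw := conjUnit_eq hφ.symm hfix'
  have happ : ∀ p, (conjUnit σ d).1 p = φ p := fun p => LinearMap.congr_fun hv p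
  have happ' : ∀ p, (conjUnit σ.symm d').1 p = φ.symm p := fun p => LinearMap.congr_fun hw p
  let v : (Jac K n)ˣ :=
    { val := conjUnit σ d
      inv := conjUnit σ.symm d'
      val_inv := jac_ext fun α _ => by
        rw [jac_mul_apply, happ', happ, LinearEquiv.apply_symm_apply, jac_one_apply]
      inv_val := jac_ext fun α _ => by
        rw [jac_mul_apply, happ, happ', LinearEquiv.symm_apply_apply, jac_one_apply] }
  refine ⟨v, rfl, mem_aIdeal_iff.2 ?_, fun a => ?_⟩
  · filter_upwards [eventually_ge_atTop fun _ => (d : ℤ)] with α hα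
    rw [jac_sub_apply, jac_one_apply]
    exact sub_eq_zero.2 ((happ _).trans (hfix α hα))
  · refine (Units.eq_mul_inv_iff_mul_eq v).2 (jac_ext fun α _ => ?_)
    rw [jac_mul_apply, jac_mul_apply]
    exact (congrArg _ (happ _)).trans ((hφ a _).symm.trans (happ _).symm)

end Conjugator

end BavulaJacobian

end

theorem mainTheorem2 (K : Type*) [Field K] [CharZero K] (n : ℕ) :
    -- `𝔞ₙ` is the unique maximal two-sided ideal of `𝔸ₙ`, and it is stable under `𝔾ₙ`
    (IsCoatom (aIdeal K n) ∧ ∀ J : TwoSidedIdeal (Jac K n), IsCoatom J → J = aIdeal K n) ∧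
    ∃ hs : AIdealStable K n,
      -- (1)
      (∃ (s : Equiv.Perm (Fin n) →* JacAut K n) (t : (Fin n → Kˣ) →* JacAut K n)
          (μ : (∀ i : Fin n, hGroup K i) →* JacAut K n),
        (IsPermAction s ∧ IsTorusAction t ∧ IsMuAction μ) ∧
        (Function.Injective s ∧ Function.Injective t ∧ Function.Injective μ) ∧
        IsDirect t.range μ.range (t.range ⊔ μ.range) ∧
        IsSemidirect s.range (t.range ⊔ μ.range) (s.range ⊔ (t.range ⊔ μ.range)) ∧
        IsSemidirect (s.range ⊔ (t.range ⊔ μ.range)) (xi hs).ker ⊤) ∧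
      -- (2)
      (∃ (s : Equiv.Perm (Fin n) →* QuotAut K n)
          (sg : (∀ i : Fin n, (lAlg K i)ˣ) →* QuotAut K n),
        (IsPermActionQuot s ∧ IsSigmaAction sg) ∧
        (Function.Injective s ∧ Function.Injective sg) ∧
        IsSemidirect s.range sg.range (xi hs).range) ∧
      -- (3)
      ((xi hs).ker ≤ innerAut K (Jac K n) ∧
        ∀ σ ∈ (xi hs).ker, (∃ d, IsBound σ d) ∧
          ∀ d, IsBound σ d → ∃ v : (Jac K n)ˣ, (v : Jac K n) = conjUnit σ d ∧
            (v : Jac K n) - 1 ∈ aIdeal K n ∧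
            ∀ a, σ a = (v : Jac K n) * a * ((v⁻¹ : (Jac K n)ˣ) : Jac K n)) := by
  refine ⟨⟨isCoatom_aIdeal, fun J hJ => eq_aIdeal_of_isCoatom hJ⟩, aIdealStable, ?_, ?_, ?_⟩
  · obtain ⟨s, hs⟩ := exists_isPermAction K n
    obtain ⟨t, ht', ht⟩ := exists_isTorusAction K n
    obtain ⟨μ, hμ', hμ⟩ := exists_isMuAction K n
    exact ⟨s, t, μ, ⟨hs, ht', hμ'⟩, ⟨hs.injective, ht'.injective, hμ'.injective⟩,
      isDirect_torus_mu ht hμ ht' hμ', isSemidirect_perm hs ht' hμ',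
      isSemidirect_ker aIdealStable hs ht hμ ht' hμ'⟩
  · obtain ⟨s, hs⟩ := exists_isPermAction K n
    obtain ⟨t, ht', ht⟩ := exists_isTorusAction K n
    obtain ⟨μ, hμ', hμ⟩ := exists_isMuAction K n
    obtain ⟨sg, hsg, hrange⟩ := exists_isSigmaAction aIdealStable ht hμ ht' hμ'
    -- The symmetric group on 𝒜ₙ is taken to be the image under ξ of the one on 𝔸ₙ.
    have hs' : IsPermActionQuot ((xi aIdealStable).comp s) := fun τ i => by
      rw [MonoidHom.comp_apply, xi_red, xi_red, (hs τ i).1, (hs τ i).2.2]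
      exact ⟨rfl, rfl⟩
    refine ⟨(xi aIdealStable).comp s, sg, ⟨hs', hsg⟩, ⟨hs'.injective, hsg.injective⟩, ?_⟩
    rw [hrange]
    exact isSemidirect_range_xi aIdealStable hs ht hμ ht' hμ'
  · refine ⟨fun σ hσ => ?_, fun σ hσ => ⟨exists_isBound aIdealStable hσ, fun d hd =>
      exists_unit_eq_conjUnit aIdealStable hσ hd⟩⟩
    obtain ⟨d, hd⟩ := exists_isBound aIdealStable hσ
    obtain ⟨v, -, -, hv⟩ := exists_unit_eq_conjUnit aIdealStable hσ hd
    exact ⟨v, hv⟩
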